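/- Let $q\in\{3,5\}$, let $v\ge 0$ be an integer and let $V$ be a vector space of dimension $v$ over $\mathrm{GF}(q)$. For integers $n,k\ge 0$ let \[ \begin{bmatrix} n\\ k\end{bmatrix}_q=\prod_{i=0}^{k-1}\frac{q^{n-i}-1}{q^{i+1}-1} \] for $k\le n$ denote the Gaussian binomial coefficient. A $t$-$(v,k,\lambda)_q$ subspace design on $V$ is a set $\mathcal B$ of $k$-dimensional subspaces of $V$ such that every $t$-dimensional subspace of $V$ is contained in exactly $\lambda$ elements of $\mathcal B$. A large set $\mathrm{LS}_q[N](t,k,v)$ is a partition of the set of all $k$-dimensional subspaces of $V$ into $N$ (nonempty) parts, all of which are $t$-$(v,k,\lambda)_q$ subspace designs with one common $\lambda$. The parameters $\mathrm{LS}_q[N](t,k,v)$ are called realizable if such a large set exists, and admissible if $0\le t\le k\le v$ and \[ N \;\Big|\; \begin{bmatrix} v-i\\ k-i\end{bmatrix}_q\qquad\text{for all } i\in\{0,\ldots,t\}. \] Then the parameters $\mathrm{LS}_q[2](2,3,v)$ are admissible if and only if they are realizable. Moreover, they are admissible if and only if $v\ge 6$ and $v\equiv 2 \pmod 4$. -/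

import Mathlib

/-- The Grassmannian: the set of all subspaces of `V` of dimension `k`. -/
def subspaceGrassmannian (F V : Type*) [Field F] [AddCommGroup V] [Module F V] (k : ℕ) :
    Set (Submodule F V) :=
  {U | FiniteDimensional F U ∧ Module.finrank F U = k}

/-- `(V, B)` is a `t`-`(v, k, lam)_q` subspace design, where `v = dim V` and `q` is the order of
the field `F`: a set `B` of `k`-subspaces such that every `t`-subspace is contained in exactly
`lam` elements of `B`. -/
structure IsSubspaceDesign (F V : Type*) [Field F] [AddCommGroup V] [Module F V]
    (t v k lam : ℕ) (B : Set (Submodule F V)) : Prop where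
  finiteDimensional : FiniteDimensional F V
  finrank_eq : Module.finrank F V = v
  subset_grassmannian : B ⊆ subspaceGrassmannian F V k
  encard_eq : ∀ T ∈ subspaceGrassmannian F V t, {U ∈ B | T ≤ U}.encard = lam

/-- The collection `D` is a large set `LS_q[N](t, k, v)`: a partition of the set of all
`k`-subspaces of `V` into `N` (nonempty) parts, which are subspace designs with the same
parameters `t`-`(v, k, lam)_q`. -/
structure IsLargeSet (F V : Type*) [Field F] [AddCommGroup V] [Module F V]
    (N t k v : ℕ) (D : Set (Set (Submodule F V))) : Prop where
  encard_eq : D.encard = N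
  nonempty : ∀ B ∈ D, B.Nonempty
  pairwiseDisjoint : D.PairwiseDisjoint id
  sUnion_eq : ⋃₀ D = subspaceGrassmannian F V k
  exists_design : ∃ lam : ℕ, ∀ B ∈ D, IsSubspaceDesign F V t v k lam B

/-- The parameters `LS_q[N](t, k, v)` are realizable on the `v`-dimensional space `V` over the
field `F` of order `q`: a large set with these parameters exists. -/
def LargeSetRealizable (F V : Type*) [Field F] [AddCommGroup V] [Module F V]
    (N t k v : ℕ) : Prop :=
  ∃ D : Set (Set (Submodule F V)), IsLargeSet F V N t k v D

/-- The Gaussian binomial coefficient. For `q ≥ 2` the division is exact; for `k ≤ v` no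
subtraction is truncated, and for `k > v` the numerator has the factor `q ^ 0 - 1 = 0`. -/
def gaussianBinomial (q v k : ℕ) : ℕ :=
  (∏ i ∈ Finset.range k, (q ^ (v - i) - 1)) / ∏ i ∈ Finset.range k, (q ^ (i + 1) - 1)

/-- The parameters `LS_q[N](t, k, v)` (with `0 ≤ t ≤ k ≤ v`) are admissible: they satisfy the
integrality conditions. -/
def LargeSetAdmissible (q N t k v : ℕ) : Prop :=
  t ≤ k ∧ k ≤ v ∧ ∀ i ≤ t, N ∣ gaussianBinomial q (v - i) (k - i)

/-! The two parts of a large set are the fibres of a sign function `f` on the 3-subspaces, and the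
design property says that the signs through every plane `T` cancel (`IsHalving`). Summing over
vectors `c` instead of subspaces counts each 3-subspace through `T` equally often, and vectors of
`T` contribute zero.

Necessity. Dividing by a point turns a halving into one of lower rank (`IsHalving.derived`). So
there are halvings of the 2-subspaces in dimension v - 1 and of the points in dimension v - 2, and
the corresponding Gaussian binomials are even. For q = 3, 5 and v ≥ 3 this already forces v ≡ 2 mod
4 and v ≥ 6; conversely all three binomials are even for these v.

Existence goes by induction in steps of four. Take A₄ ≤ A₅ ≤ A₆ of dimensions 4, 5, 6. The
dimensions of U ∩ A₄, U ∩ A₅, U ∩ A₆ grow by at most one at each step, which sorts the 3-subspaces U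
into four classes. On each class a halving on some A times a halving on some quotient V / B is
balanced (`productSign_balanced`), and all factors are derived from the cases 6 and v - 4
(`exists_isHalving_three_of_chain`).

The base case v = 6 is explicit. Identify V with K = E(√2), where E / F is cubic with Frobenius σ. A
3-subspace of K either is {x α + σ(x) β} for E-independent α, β (scattered), or meets some E-line in
dimension at least two (club). A `SignRule` gives signs to both types so that multiplication by a ∈
K* multiplies the sign by χ(N a), with χ quadratic. Uniqueness of the normal forms makes this well
defined (`HasSign.unique`), and only planes ⟨1, b⟩ have to be balanced. If b ∈ E this is one
condition on φ (`pencilSum_eq_zero_of_im`). Otherwise the sign of ⟨1, b, x + y b⟩ depends only on b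
and on the trace-zero elements σ x - x, σ y - y, and cancellation is a finite check on a table of
discrete logarithms. The moves b ↦ s + t b and b ↦ b⁻¹ reduce the number of planes to be checked. -/

open Module

/-- A sign function on the `k`-subspaces of `V`, extended by zero to all subspaces, such that the
`k`-subspaces through any subspace of codimension one in them are split evenly. -/
structure IsHalving (F : Type*) {V : Type*} [Field F] [AddCommGroup V] [Module F V] (k : ℕ)
    (f : Submodule F V → ℤ) : Prop where
  sign : ∀ U : Submodule F V, finrank F U = k → f U = 1 ∨ f U = -1
  zero : ∀ U : Submodule F V, finrank F U ≠ k → f U = 0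
  balanced : ∀ T : Submodule F V, finrank F T + 1 = k → ∑ᶠ c : V, f (T ⊔ Submodule.span F {c}) = 0

/-! ### Adjoining one vector to a subspace -/

section Span

variable {F V : Type*} [Field F] [AddCommGroup V] [Module F V]

theorem Submodule.sup_span_singleton_eq_self {T : Submodule F V} {c : V} (hc : c ∈ T) :
    T ⊔ Submodule.span F {c} = T :=
  sup_eq_left.2 (by simpa using hc)

theorem Submodule.exists_eq_sup_span_singleton [FiniteDimensional F V] {S T : Submodule F V}
    (h : S ≤ T) (hr : finrank F T = finrank F S + 1) :
    ∃ c ∈ T, c ∉ S ∧ T = S ⊔ Submodule.span F {c} := by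
  obtain ⟨c, hcT, hcS⟩ : ∃ c ∈ T, c ∉ S := by
    by_contra! hall
    have := Submodule.finrank_mono (R := F) (s := T) (t := S) hall
    omega
  refine ⟨c, hcT, hcS, (Submodule.eq_of_le_of_finrank_eq (sup_le h (by simpa using hcT)) ?_).symm⟩
  rw [Submodule.finrank_sup_span_singleton hcS, hr]

theorem Submodule.exists_eq_span_pair [FiniteDimensional F V] {T : Submodule F V}
    (hr : finrank F T = 2) {a : V} (ha : a ∈ T) (ha0 : a ≠ 0) :
    ∃ b ∈ T, b ∉ Submodule.span F {a} ∧ T = Submodule.span F {a, b} := by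
  obtain ⟨b, hb, hba, e⟩ := Submodule.exists_eq_sup_span_singleton (S := Submodule.span F {a})
    (by simpa using ha) (by rw [hr, finrank_span_singleton ha0])
  exact ⟨b, hb, hba, by rw [e, ← Submodule.span_union]; rfl⟩

end Span

/-! ### Cubic extensions with a generating automorphism -/

section CubicFrobenius

variable {F E : Type*} [Field F] [Field E] [Algebra F E]

/-- `σ` generates the automorphism group of the cubic extension `E / F`. -/
structure IsCubicFrobenius (σ : E →ₐ[F] E) : Prop where
  cube : ∀ x, σ (σ (σ x)) = x
  fixed : ∀ x, σ x = x → ∃ c : F, algebraMap F E c = x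
  finrank_eq : finrank F E = 3

def traceForm (σ : E →ₐ[F] E) (x : E) : E := x + σ x + σ (σ x)

theorem traceForm_algebraMap_mul (σ : E →ₐ[F] E) (c : F) (x : E) :
    traceForm σ (algebraMap F E c * x) = algebraMap F E c * traceForm σ x := by
  simp only [traceForm, map_mul, AlgHom.commutes]; ring

namespace IsCubicFrobenius

variable {σ : E →ₐ[F] E} (hσ : IsCubicFrobenius σ)
include hσ

theorem exists_ne : ∃ x, σ x ≠ x := by
  by_contra! h
  have : (⊥ : Subalgebra F E) = ⊤ := by
    rw [eq_top_iff]
    intro x _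
    obtain ⟨c, hc⟩ := hσ.fixed x (h x)
    exact Algebra.mem_bot.2 ⟨c, hc⟩
  have h1 := Subalgebra.bot_eq_top_iff_finrank_eq_one.1 this
  rw [hσ.finrank_eq] at h1
  omega

theorem finiteDimensional : FiniteDimensional F E :=
  FiniteDimensional.of_finrank_pos (by rw [hσ.finrank_eq]; norm_num)

/-- Dedekind's independence of characters, applied to 1, σ, σ², which are distinct because σ moves
some element and has order three. -/
theorem eq_zero_of_forall {a b c : E} (h : ∀ x, a * x + b * σ x + c * σ (σ x) = 0) :
    a = 0 ∧ b = 0 ∧ c = 0 := by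
  let m : Fin 3 → (E →* E) := ![MonoidHom.id E, (σ : E →* E), ((σ.comp σ : E →ₐ[F] E) : E →* E)]
  obtain ⟨x, hx⟩ := hσ.exists_ne
  have hinj : Function.Injective m := by
    have h01 : m 0 ≠ m 1 := fun e => hx (DFunLike.congr_fun e x).symm
    have h12 : m 1 ≠ m 2 := fun e => by
      have := DFunLike.congr_fun e x
      exact hx ((σ : E →+* E).injective (this.symm : σ (σ x) = σ x))
    have h02 : m 0 ≠ m 2 := fun e => by
      have : x = σ (σ x) := DFunLike.congr_fun e x
      exact hx (by conv_rhs => rw [← hσ.cube x, ← this])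
    intro i j hij
    fin_cases i <;> fin_cases j <;> first | rfl | exact absurd hij (by assumption) |
      exact absurd hij.symm (by assumption)
  have hli := (linearIndependent_monoidHom E E).comp m hinj
  rw [Fintype.linearIndependent_iff] at hli
  have := hli ![a, b, c] (by
    ext x
    simpa [Fin.sum_univ_three, m] using h x)
  exact ⟨this 0, this 1, this 2⟩

theorem map_div_fixed {x y : E} (hy : y ≠ 0) (h : x * σ y = y * σ x) :
    ∃ c : F, x = algebraMap F E c * y := by
  have hy' : σ y ≠ 0 := fun e => hy ((σ : E →+* E).injective (by simpa using e))
  obtain ⟨c, hc⟩ := hσ.fixed (x / y) (by rw [map_div₀, div_eq_div_iff hy' hy]; linear_combination -h)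
  exact ⟨c, by rw [hc]; field_simp⟩

theorem trace_fixed (x : E) : σ (traceForm σ x) = traceForm σ x := by
  simp only [traceForm, map_add, hσ.cube]; ring

end IsCubicFrobenius

end CubicFrobenius

set_option linter.unusedSectionVars false

/-! ### Scattered subspaces and clubs: the sign is unique -/

section QuadraticExtension

variable {F E : Type*} [Field F] [Field E] [Algebra F E] {σ : E →ₐ[F] E} {δ : E}

local notation "K" => QuadraticAlgebra E δ 0

/-- The `F`-linear map `x ↦ x α + σ x β`. -/
def scatteredMap (σ : E →ₐ[F] E) (α β : K) : E →ₗ[F] K :=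
  (LinearMap.toSpanSingleton E K α).restrictScalars F +
    ((LinearMap.toSpanSingleton E K β).restrictScalars F).comp σ.toLinearMap

@[simp] theorem scatteredMap_apply (α β : K) (x : E) :
    scatteredMap σ α β x = x • α + σ x • β := rfl

/-- The determinant of `α, β` over `E`. -/
def bracket (α β : K) : E := α.re * β.im - α.im * β.re

theorem eq_smul_add {α β : K} (h : bracket α β ≠ 0) (k : K) :
    ∃ a b : E, k = a • α + b • β := by
  refine ⟨bracket k β / bracket α β, bracket α k / bracket α β, ?_⟩
  ext <;> simp <;> field_simp <;> simp only [bracket] <;> ring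

theorem smul_add_inj {α β : K} (h : bracket α β ≠ 0) {a b c d : E}
    (e : a • α + b • β = c • α + d • β) : a = c ∧ b = d := by
  have h1 : bracket (a • α + b • β) β = bracket (c • α + d • β) β := by rw [e]
  have h2 : bracket (a • α + b • β) α = bracket (c • α + d • β) α := by rw [e]
  simp only [bracket, QuadraticAlgebra.re_add, QuadraticAlgebra.im_add, QuadraticAlgebra.re_smul,
    QuadraticAlgebra.im_smul, smul_eq_mul] at h h1 h2
  constructor
  · apply mul_right_cancel₀ h; linear_combination h1
  · apply mul_right_cancel₀ h; linear_combination -h2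

/-- A rule attaching signs to the `3`-subspaces of the quadratic extension `K` of the cubic
extension `E` of `F`. -/
structure SignRule (σ : E →ₐ[F] E) (δ : E) where
  χ : E →*₀ ℤ
  χ_sign : ∀ x, x ≠ 0 → χ x = 1 ∨ χ x = -1
  Φ : QuadraticAlgebra E δ 0 → ℤ
  Φ_sign : ∀ γ, Φ γ = 1 ∨ Φ γ = -1
  -- The substitution x ↦ a x replaces (α, β) by (a α, σ(a) β) without changing the image of
  -- `scatteredMap`, so β / α is only determined up to σ(a) / a.
  Φ_smul : ∀ a : E, a ≠ 0 → ∀ γ, Φ ((σ a / a) • γ) = Φ γ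
  φ : E → E → ℤ
  φ_sign : ∀ m u, φ m u = 1 ∨ φ m u = -1
  -- The equation tr(m · re) = u · im determines (m, u) only up to a factor in F*.
  φ_smul : ∀ c : F, c ≠ 0 → ∀ m u, φ (algebraMap F E c * m) (algebraMap F E c * u) = φ m u

theorem SignRule.χ_sq {P : SignRule σ δ} {x : E} (hx : x ≠ 0) : P.χ (x * x) = 1 := by
  rw [map_mul]
  rcases P.χ_sign x hx with h | h <;> simp [h]

variable [Fact (∀ r : E, r ^ 2 ≠ δ + 0 * r)]

variable (P : SignRule σ δ)

namespace SignRule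

/-- The sign of a `3`-subspace `U`: either `U` meets every `E`-line of `K` in at most a point, or
it contains two independent vectors of such a line. -/
inductive HasSign (U : Submodule F K) : ℤ → Prop
  | scattered (α β : K) (h : bracket α β ≠ 0) (hU : U ≤ LinearMap.range (scatteredMap σ α β)) :
      HasSign U (P.χ α.norm * P.Φ (β / α))
  | club (v : K) (m u : E) (hv : v ≠ 0) (hmu : m ≠ 0 ∨ u ≠ 0) (hu : σ u = u)
      (hU : ∀ k ∈ U, σ (v⁻¹ * k).im = (v⁻¹ * k).im ∧
        traceForm σ (m * (v⁻¹ * k).re) = u * (v⁻¹ * k).im) :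
      HasSign U (P.χ v.norm * P.φ m u)

variable {P}

theorem norm_ne_zero {v : K} (hv : v ≠ 0) : v.norm ≠ 0 := by
  intro h
  exact hv (QuadraticAlgebra.norm_eq_zero_iff_eq_zero.1 h)

theorem HasSign.sign {U : Submodule F K} {s : ℤ} (h : P.HasSign U s) : s = 1 ∨ s = -1 := by
  cases h with
  | scattered α β h hU =>
    have : α ≠ 0 := by rintro rfl; simp [bracket] at h
    rcases P.χ_sign _ (norm_ne_zero this) with h1 | h1 <;> rcases P.Φ_sign (β / α) with h2 | h2 <;>
      simp [h1, h2]
  | club v m u hv =>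
    rcases P.χ_sign _ (norm_ne_zero hv) with h1 | h1 <;> rcases P.φ_sign m u with h2 | h2 <;>
      simp [h1, h2]

theorem bracket_mul (k α β : K) : bracket (k * α) (k * β) = k.norm * bracket α β := by
  simp [bracket, QuadraticAlgebra.norm_def]; ring

theorem norm_smul (a : E) (α : K) : (a • α).norm = a * a * α.norm := by
  simp [QuadraticAlgebra.norm_def]; ring

theorem im_mul_of_im_eq_zero (w : K) {k : K} (h : k.im = 0) : (w * k).im = w.im * k.re := by
  simp [h]

theorem mul_of_im_eq_zero {w : K} (h : w.im = 0) (k : K) :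
    (w * k).re = w.re * k.re ∧ (w * k).im = w.re * k.im := by
  simp [h]

theorem eq_range_of_le (hσ : IsCubicFrobenius σ) {U : Submodule F K} (hU : finrank F U = 3)
    {α β : K} (h : U ≤ LinearMap.range (scatteredMap σ α β)) :
    U = LinearMap.range (scatteredMap σ α β) := by
  have := hσ.finiteDimensional
  apply Submodule.eq_of_le_of_finrank_le h
  rw [hU, ← hσ.finrank_eq]
  exact LinearMap.finrank_range_le _

/-- In the basis α', β' the inclusion becomes an identity between x, σ x and σ² x. Independence of
the characters leaves only α = a α', β = σ(a) β', under which the sign is invariant by `Φ_smul` and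
χ(a²) = 1. -/
theorem scattered_unique (hσ : IsCubicFrobenius σ) {α β α' β' : K} (h : bracket α β ≠ 0)
    (h' : bracket α' β' ≠ 0)
    (hle : LinearMap.range (scatteredMap σ α β) ≤ LinearMap.range (scatteredMap σ α' β')) :
    P.χ α.norm * P.Φ (β / α) = P.χ α'.norm * P.Φ (β' / α') := by
  obtain ⟨a, b, rfl⟩ := eq_smul_add h' α
  obtain ⟨c, d, rfl⟩ := eq_smul_add h' β
  have key : ∀ x, b * x + (d - σ a) * σ x + (-σ c) * σ (σ x) = 0 := by
    intro x
    obtain ⟨g, hg⟩ := hle ⟨x, rfl⟩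
    simp only [scatteredMap_apply] at hg
    have : (x * a + σ x * c) • α' + (x * b + σ x * d) • β' = g • α' + σ g • β' := by
      rw [hg]; module
    obtain ⟨h1, h2⟩ := smul_add_inj h' this
    rw [← h1, map_add, map_mul, map_mul] at h2
    linear_combination h2
  obtain ⟨rfl, hd, hc⟩ := hσ.eq_zero_of_forall key
  obtain rfl : c = 0 := (σ : E →+* E).injective (by simpa using hc)
  obtain rfl : d = σ a := by linear_combination hd
  have ha : a ≠ 0 := by
    rintro rfl
    simp [bracket] at h
  have hα' : α' ≠ 0 := by rintro rfl; simp [bracket] at h'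
  have hq : ((0 : E) • α' + σ a • β') / (a • α' + (0 : E) • β') = (σ a / a) • (β' / α') := by
    have : a • α' ≠ 0 := smul_ne_zero ha hα'
    rw [zero_smul, zero_smul, zero_add, add_zero, div_eq_iff this, smul_mul_smul_comm,
      div_mul_cancel₀ _ ha, div_mul_cancel₀ _ hα']
  rw [hq, P.Φ_smul a ha, zero_smul, add_zero, norm_smul, map_mul, χ_sq ha, one_mul]

/-- Invariance of the second coordinate under σ, again by independence of characters, makes the
second coordinates of v⁻¹ α and v⁻¹ β vanish, so α and β would be E-dependent. -/
theorem not_scattered_of_club (hσ : IsCubicFrobenius σ) {α β v : K} (h : bracket α β ≠ 0)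
    (hv : v ≠ 0) (hU : ∀ x, σ (v⁻¹ * scatteredMap σ α β x).im = (v⁻¹ * scatteredMap σ α β x).im) :
    False := by
  have e : ∀ x, (v⁻¹ * scatteredMap σ α β x).im = x * (v⁻¹ * α).im + σ x * (v⁻¹ * β).im := by
    intro x
    simp; ring
  have key : ∀ x, (v⁻¹ * α).im * x + ((v⁻¹ * β).im - σ (v⁻¹ * α).im) * σ x +
      (-σ (v⁻¹ * β).im) * σ (σ x) = 0 := by
    intro x
    have := hU x
    rw [e, map_add, map_mul, map_mul] at this
    linear_combination -this
  obtain ⟨h1, h2, -⟩ := hσ.eq_zero_of_forall key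
  rw [h1, map_zero, sub_zero] at h2
  have := bracket_mul v⁻¹ α β
  rw [bracket, h1, h2] at this
  have := mul_ne_zero (norm_ne_zero (inv_ne_zero hv)) h
  simp_all

/-- The vector (m, σ m, σ² m) is orthogonal to the conjugate vectors of a and b, hence proportional
to their cross product; conjugation shows that the factor lies in F. -/
theorem exists_smul_of_trace_eq_zero (hσ : IsCubicFrobenius σ) {a b m : E}
    (ha : traceForm σ (m * a) = 0) (hb : traceForm σ (m * b) = 0)
    (h : σ a * σ (σ b) - σ b * σ (σ a) ≠ 0) :
    ∃ c : F, m = algebraMap F E c * (σ a * σ (σ b) - σ b * σ (σ a)) := by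
  apply hσ.map_div_fixed h
  simp only [traceForm, map_sub, map_mul, hσ.cube] at *
  linear_combination (-σ (σ b)) * ha + σ (σ a) * hb

theorem cross_ne_zero (hσ : IsCubicFrobenius σ) {a b : E} (h : LinearIndependent F ![a, b]) :
    σ a * σ (σ b) - σ b * σ (σ a) ≠ 0 := by
  intro e
  have hb : b ≠ 0 := h.ne_zero 1
  obtain ⟨c, hc⟩ := hσ.map_div_fixed (x := a) hb ((σ : E →+* E).injective (by
    simp only [RingHom.coe_coe, map_mul]; linear_combination e))
  rw [LinearIndependent.pair_iff] at h
  exact one_ne_zero (h 1 (-c) (by rw [hc, Algebra.smul_def, Algebra.smul_def]; simp)).1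

theorem exists_pair_of_one_lt_finrank_ker {M : Type*} [AddCommGroup M] [Module F M]
    (g r : M →ₗ[F] E) (hgr : ∀ k, g k = 0 → r k = 0 → k = 0)
    (h : 1 < finrank F (LinearMap.ker g)) :
    ∃ k₁ k₂, g k₁ = 0 ∧ g k₂ = 0 ∧ LinearIndependent F ![r k₁, r k₂] := by
  have := Module.nontrivial_of_finrank_pos (R := F) (M := LinearMap.ker g) (by omega)
  obtain ⟨k₁, hk₁⟩ := exists_ne (0 : LinearMap.ker g)
  obtain ⟨k₂, hli⟩ : ∃ y, LinearIndependent F ![k₁, y] :=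
    exists_linearIndependent_pair_of_one_lt_finrank h hk₁
  refine ⟨k₁, k₂, k₁.2, k₂.2, LinearIndependent.pair_iff.2 fun s t hst => ?_⟩
  refine LinearIndependent.pair_iff.1 hli s t (Subtype.ext ?_)
  refine hgr _ (s • k₁ + t • k₂).2 ?_
  rw [← hst]
  simp

/-- The second coordinate maps the three-dimensional U into the line F, so its kernel, which lies on
a single E-line, has dimension at least two. -/
theorem exists_pair (hσ : IsCubicFrobenius σ) {U : Submodule F K} (hU : finrank F U = 3)
    {w : K} (hw : w ≠ 0) (h : ∀ k ∈ U, σ (w * k).im = (w * k).im) :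
    ∃ k₁ ∈ U, ∃ k₂ ∈ U, (w * k₁).im = 0 ∧ (w * k₂).im = 0 ∧
      LinearIndependent F ![(w * k₁).re, (w * k₂).re] := by
  have := hσ.finiteDimensional
  have : FiniteDimensional F U := FiniteDimensional.of_finrank_pos (by rw [hU]; norm_num)
  let g : U →ₗ[F] E :=
    { toFun := fun k => (w * (k : K)).im
      map_add' := fun a b => by simp; ring
      map_smul' := fun c a => by simp }
  let r : U →ₗ[F] E :=
    { toFun := fun k => (w * (k : K)).re
      map_add' := fun a b => by simp; ring
      map_smul' := fun c a => by simp }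
  have hgr : LinearMap.range g ≤ F ∙ (1 : E) := by
    rintro _ ⟨k, rfl⟩
    obtain ⟨c, hc⟩ := hσ.fixed _ (h k k.2)
    exact Submodule.mem_span_singleton.2 ⟨c, by
      rw [Algebra.smul_def, mul_one, hc]; rfl⟩
  have hker : 1 < finrank F (LinearMap.ker g) := by
    have h1 := LinearMap.finrank_range_add_finrank_ker g
    have h2 : finrank F (LinearMap.range g) ≤ 1 :=
      (Submodule.finrank_mono hgr).trans (finrank_span_singleton (one_ne_zero)).le
    omega
  obtain ⟨k₁, k₂, h₁, h₂, hli⟩ := exists_pair_of_one_lt_finrank_ker g r (fun k hg hr =>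
    Subtype.ext ((mul_eq_zero.1 (QuadraticAlgebra.ext hr hg)).resolve_left hw)) hker
  exact ⟨k₁, k₁.2, k₂, k₂.2, h₁, h₂, hli⟩

theorem club_unique (hσ : IsCubicFrobenius σ) {U : Submodule F K} (hU : finrank F U = 3)
    {v v' : K} {m m' u u' : E} (hv : v ≠ 0) (hv' : v' ≠ 0) (hmu : m ≠ 0 ∨ u ≠ 0)
    (hmu' : m' ≠ 0 ∨ u' ≠ 0) (hu : σ u = u) (hu' : σ u' = u')
    (h : ∀ k ∈ U, σ (v⁻¹ * k).im = (v⁻¹ * k).im ∧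
      traceForm σ (m * (v⁻¹ * k).re) = u * (v⁻¹ * k).im)
    (h' : ∀ k ∈ U, σ (v'⁻¹ * k).im = (v'⁻¹ * k).im ∧
      traceForm σ (m' * (v'⁻¹ * k).re) = u' * (v'⁻¹ * k).im) :
    P.χ v.norm * P.φ m u = P.χ v'.norm * P.φ m' u' := by
  have := hσ.finiteDimensional
  obtain ⟨k₁, hk₁, k₂, hk₂, hre₁, hre₂, hlia⟩ :=
    exists_pair hσ hU (inv_ne_zero hv) fun k hk => (h k hk).1
  set a₁ := (v⁻¹ * k₁).re with ha₁
  set a₂ := (v⁻¹ * k₂).re with ha₂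
  have hn := cross_ne_zero hσ hlia
  have htr : ∀ k ∈ U, (v⁻¹ * k).im = 0 → traceForm σ (m * (v⁻¹ * k).re) = 0 := fun k hk hk0 => by
    rw [(h _ hk).2, hk0, mul_zero]
  set w := v'⁻¹ * v with hw
  have hw0 : w ≠ 0 := mul_ne_zero (inv_ne_zero hv') hv
  have hwk : ∀ k, v'⁻¹ * k = w * (v⁻¹ * k) := fun k => by
    rw [hw, mul_assoc, mul_inv_cancel_left₀ hv]
  -- Both descriptions single out the same E-line: otherwise w.im a₁ and w.im a₂ would lie in F, and
  -- a₁, a₂ would be F-dependent.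
  have hwim : w.im = 0 := by
    by_contra hne
    have hfix : ∀ k ∈ U, (v⁻¹ * k).im = 0 →
        ∃ c : F, algebraMap F E c = w.im * (v⁻¹ * k).re := by
      intro k hk hk0
      refine hσ.fixed _ ?_
      have := (h' _ hk).1
      rwa [hwk, im_mul_of_im_eq_zero w hk0] at this
    obtain ⟨c₁, hc₁⟩ := hfix k₁ hk₁ hre₁
    obtain ⟨c₂, hc₂⟩ := hfix k₂ hk₂ hre₂
    rw [← ha₁] at hc₁
    rw [← ha₂] at hc₂
    have h1 := (LinearIndependent.pair_iff.1 hlia c₂ (-c₁) (by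
      rw [Algebra.smul_def, Algebra.smul_def, map_neg, hc₁, hc₂]; ring)).2
    have : c₁ = 0 := by simpa using h1
    rw [this, map_zero] at hc₁
    exact hlia.ne_zero 0 (by simpa [hne] using hc₁.symm)
  have hwre : w = algebraMap E K w.re := by ext <;> simp [hwim]
  set l := w.re with hl
  have hl0 : l ≠ 0 := by
    intro e
    rw [e, map_zero] at hwre
    exact hw0 hwre
  have hnorm : P.χ v.norm = P.χ v'.norm := by
    have : v = l • v' := by
      rw [Algebra.smul_def, ← hwre, hw, mul_comm _ v', mul_inv_cancel_left₀ hv']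
    rw [this, norm_smul, map_mul, χ_sq hl0, one_mul]
  rw [hnorm]
  congr 1
  have hre' : ∀ k, (v'⁻¹ * k).re = l * (v⁻¹ * k).re := fun k => by
    rw [hwk, (mul_of_im_eq_zero hwim _).1]
  have him' : ∀ k, (v'⁻¹ * k).im = l * (v⁻¹ * k).im := fun k => by
    rw [hwk, (mul_of_im_eq_zero hwim _).2]
  -- Either U is the whole E-line of v, and then m = m' = 0; or some k₀ ∈ U lies off it, which
  -- forces l ∈ F and makes m, m' multiples of the same cross product, while k₀ fixes the ratio of u
  -- and u'.
  by_cases hall : ∀ k ∈ U, (v⁻¹ * k).im = 0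
  · have hsurj : ∀ e : E, ∃ k ∈ U, (v⁻¹ * k).re = e := by
      have : FiniteDimensional F U := FiniteDimensional.of_finrank_pos (by rw [hU]; norm_num)
      let r : U →ₗ[F] E :=
        { toFun := fun k => (v⁻¹ * (k : K)).re
          map_add' := fun a b => by simp; ring
          map_smul' := fun c a => by simp }
      have hinj : Function.Injective r := by
        rw [← LinearMap.ker_eq_bot, LinearMap.ker_eq_bot']
        intro k hk0
        have : v⁻¹ * (k : K) = 0 := by
          ext
          · exact hk0
          · exact hall k k.2
        exact Subtype.ext (by simpa [hv] using this)
      have hs := (LinearMap.injective_iff_surjective_of_finrank_eq_finrank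
        (by rw [hU, hσ.finrank_eq])).1 hinj
      intro e
      obtain ⟨k, hk⟩ := hs e
      exact ⟨k, k.2, hk⟩
    have hm : m = 0 := by
      refine (hσ.eq_zero_of_forall (a := m) (b := σ m) (c := σ (σ m)) fun x => ?_).1
      obtain ⟨k, hk, rfl⟩ := hsurj x
      have := (h k hk).2
      rw [hall k hk, mul_zero] at this
      simpa [traceForm] using this
    have hm' : m' * l = 0 := by
      refine (hσ.eq_zero_of_forall (a := m' * l) (b := σ (m' * l)) (c := σ (σ (m' * l)))
        fun x => ?_).1
      obtain ⟨k, hk, rfl⟩ := hsurj x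
      have := (h' k hk).2
      rw [him', hall k hk, mul_zero, mul_zero, hre'] at this
      simpa [traceForm, mul_assoc] using this
    have hm'0 : m' = 0 := by simpa [hl0] using hm'
    subst hm hm'0
    simp only [ne_eq, not_true_eq_false, false_or] at hmu hmu'
    obtain ⟨c, hc⟩ := hσ.map_div_fixed (x := u') hmu (by rw [hu, hu', mul_comm])
    have hc0 : c ≠ 0 := by rintro rfl; simp at hc; exact hmu' hc
    rw [hc]
    have := P.φ_smul c hc0 0 u
    rw [mul_zero] at this
    exact this.symm
  · push Not at hall
    obtain ⟨k₀, hk₀, hj⟩ := hall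
    obtain ⟨d, hd⟩ : ∃ d : F, algebraMap F E d = l := by
      refine hσ.fixed _ ?_
      have h1 := (h' _ hk₀).1
      rw [him', map_mul, (h _ hk₀).1] at h1
      exact mul_right_cancel₀ hj h1
    have hd0 : d ≠ 0 := by rintro rfl; exact hl0 (by rw [← hd, map_zero])
    have htr' : ∀ k ∈ U, (v⁻¹ * k).im = 0 → traceForm σ (m' * (v⁻¹ * k).re) = 0 := by
      intro k hk hk0
      have := (h' _ hk).2
      rw [him', hk0, mul_zero, mul_zero, hre', ← hd, mul_left_comm,
        traceForm_algebraMap_mul, hd] at this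
      simpa [hl0] using this
    obtain ⟨c, hc⟩ := exists_smul_of_trace_eq_zero hσ (htr k₁ hk₁ hre₁) (htr k₂ hk₂ hre₂) hn
    obtain ⟨c', hc'⟩ := exists_smul_of_trace_eq_zero hσ (htr' k₁ hk₁ hre₁) (htr' k₂ hk₂ hre₂) hn
    have hmk := (h _ hk₀).2
    have hmk' := (h' _ hk₀).2
    rw [him', hre', ← hd, mul_left_comm, traceForm_algebraMap_mul, hd, mul_left_comm] at hmk'
    replace hmk' := mul_left_cancel₀ hl0 hmk'
    have hc0 : c ≠ 0 := by
      rintro rfl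
      rw [map_zero, zero_mul] at hc
      subst hc
      rw [zero_mul] at hmk
      have : u = 0 := by simpa [traceForm, -QuadraticAlgebra.im_mul, hj] using hmk.symm
      simp [this] at hmu
    have hc'0 : c' ≠ 0 := by
      rintro rfl
      rw [map_zero, zero_mul] at hc'
      subst hc'
      rw [zero_mul] at hmk'
      have : u' = 0 := by simpa [traceForm, -QuadraticAlgebra.im_mul, hj] using hmk'.symm
      simp [this] at hmu'
    have hE : algebraMap F E c ≠ 0 := by simpa using hc0
    have em : m' = algebraMap F E (c' / c) * m := by
      rw [hc, hc', map_div₀]; field_simp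
    have eu : u' = algebraMap F E (c' / c) * u := by
      rw [em, mul_assoc, traceForm_algebraMap_mul, hmk] at hmk'
      apply mul_right_cancel₀ hj
      linear_combination -hmk'
    rw [em, eu, P.φ_smul _ (div_ne_zero hc'0 hc0)]

theorem HasSign.unique (hσ : IsCubicFrobenius σ) {U : Submodule F K} (hU : finrank F U = 3)
    {s s' : ℤ} (h : P.HasSign U s) (h' : P.HasSign U s') : s = s' := by
  cases h with
  | scattered α β h hle =>
    have e := eq_range_of_le hσ hU hle
    cases h' with
    | scattered α' β' h' hle' => exact scattered_unique hσ h h' (e ▸ hle')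
    | club v m u hv hmu hu hk =>
      exact (not_scattered_of_club hσ h hv fun x => (hk _ (e ▸ ⟨x, rfl⟩)).1).elim
  | club v m u hv hmu hu hk =>
    cases h' with
    | scattered α β h hle =>
      have e := eq_range_of_le hσ hU hle
      exact (not_scattered_of_club hσ h hv fun x => (hk _ (e ▸ ⟨x, rfl⟩)).1).elim
    | club v' m' u' hv' hmu' hu' hk' => exact club_unique hσ hU hv hv' hmu hmu' hu hu' hk hk'

end SignRule
end QuadraticExtension

/-! ### The sign of the span of 1, b and x + y b -/

section QuadraticExtension

variable {F E : Type*} [Field F] [Field E] [Algebra F E] {σ : E →ₐ[F] E} {δ : E}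

local notation "K" => QuadraticAlgebra E δ 0

variable [Fact (∀ r : E, r ^ 2 ≠ δ + 0 * r)]

namespace SignRule

variable {P : SignRule σ δ}

theorem χ_eq_of_mul_sq {x y a : E} (ha : a ≠ 0) (h : x = y * (a * a)) : P.χ x = P.χ y := by
  rw [h, map_mul, χ_sq ha, mul_one]

/-- The vectors whose multiples by `w` have first coordinate `u c` under the form `tr (m ·)` and
second coordinate `c ∈ F`. -/
def clubSpace (σ : E →ₐ[F] E) (w : K) (m u : E) : Submodule F K where
  carrier := {k | σ (w * k).im = (w * k).im ∧ traceForm σ (m * (w * k).re) = u * (w * k).im}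
  zero_mem' := by simp [traceForm]
  add_mem' := by
    rintro a b ⟨h1, h2⟩ ⟨h3, h4⟩
    rw [Set.mem_ofPred_eq, mul_add, QuadraticAlgebra.im_add, QuadraticAlgebra.re_add]
    refine ⟨by rw [map_add, h1, h3], ?_⟩
    simp only [traceForm, mul_add, map_add] at *
    linear_combination h2 + h4
  smul_mem' := by
    rintro c a ⟨h1, h2⟩
    rw [Set.mem_ofPred_eq, mul_smul_comm, QuadraticAlgebra.im_smul, QuadraticAlgebra.re_smul]
    refine ⟨by rw [map_smul, h1], ?_⟩
    rw [mul_smul_comm, mul_smul_comm, Algebra.smul_def, Algebra.smul_def,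
      traceForm_algebraMap_mul, h2]

theorem mem_clubSpace {w k : K} {m u : E} : k ∈ clubSpace σ w m u ↔
    σ (w * k).im = (w * k).im ∧ traceForm σ (m * (w * k).re) = u * (w * k).im := Iff.rfl

/-- The sign of the `3`-subspace spanned by `1`, `b` and `x + y b`, as a function of
`X = σ x - x` and `Y = σ y - y`. -/
noncomputable def planeSign (P : SignRule σ δ) (b : K) (X Y : E) : ℤ :=
  open Classical in
  -- If Y = 0 then y ∈ F and the space contains 1 and x, a club on the E-line of 1; if X = 0 as
  -- well, the third vector lies in the plane and the value is 0.
  if Y = 0 then if X = 0 then 0 else P.φ (b.im * σ X) (traceForm σ (σ X * b.re))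
  else
    -- If t ∈ F, then x + t y ∈ F, so the space contains b - t and y (b - t): a club on the E-line
    -- of b - t. If t ∉ F, the space is scattered. Q is the norm of b - t.
    let t := -X / Y
    let y := b.re - t
    let Q := y * y - δ * (b.im * b.im)
    P.χ Q * if σ t = t then P.φ (b.im * σ Y / Q) (-traceForm σ (σ Y * y / Q))
      else P.Φ ((b - QuadraticAlgebra.C (σ (σ t))) / (QuadraticAlgebra.C t - b))

theorem sq_sub_ne_zero {y d : E} (hd : d ≠ 0) : y * y - δ * (d * d) ≠ 0 := by
  intro h
  have hf := Fact.out (p := ∀ r : E, r ^ 2 ≠ δ + 0 * r)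
  apply hf (y / d)
  field_simp
  linear_combination h

theorem mem_clubSpace_of {w k : K} {m u r i s : E} (hr : (w * k).re = r) (hi : (w * k).im = i)
    (hs : m * r = s) (hfix : σ i = i) (h : traceForm σ s = u * i) : k ∈ clubSpace σ w m u := by
  rw [mem_clubSpace, hr, hi, hs]
  exact ⟨hfix, h⟩

theorem traceForm_add (x y : E) : traceForm σ (x + y) = traceForm σ x + traceForm σ y := by
  simp only [traceForm, map_add]; ring

theorem traceForm_mul_of_fixed {c : E} (hc : σ c = c) (x : E) :
    traceForm σ (c * x) = c * traceForm σ x := by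
  simp only [traceForm, map_mul, hc]; ring

theorem traceForm_sub (hσ : IsCubicFrobenius σ) (x : E) : traceForm σ (σ (σ x - x)) = 0 := by
  simp only [traceForm, map_sub, hσ.cube]; ring

theorem traceForm_sub_mul (hσ : IsCubicFrobenius σ) (x : E) :
    traceForm σ (σ (σ x - x) * x) = 0 := by
  simp only [traceForm, map_sub, map_mul, hσ.cube]; ring

/-- The element n = σ(σ x - x) satisfies tr(n) = tr(n x) = 0, so the form tr(n ·) annihilates the
part of the space lying in E. Dividing by b.im brings all second coordinates into F. -/
theorem hasSign_span_of_fixed (hσ : IsCubicFrobenius σ) {b : K} (hb : b.im ≠ 0) {x y : E}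
    (hx : σ x - x ≠ 0) (hy : σ y = y) :
    P.HasSign (Submodule.span F {1, b, QuadraticAlgebra.C x + y • b})
      (P.φ (b.im * σ (σ x - x)) (traceForm σ (σ (σ x - x) * b.re))) := by
  have h1 := traceForm_sub hσ x
  have h2 := traceForm_sub_mul hσ x
  have hn0 : σ (σ x - x) ≠ 0 := fun e => hx ((σ : E →+* E).injective (e.trans (map_zero σ).symm))
  generalize σ (σ x - x) = n at *
  have e : P.φ (b.im * n) (traceForm σ (n * b.re)) = P.χ (QuadraticAlgebra.C b.im : K).norm *
      P.φ (b.im * n) (traceForm σ (n * b.re)) := by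
    rw [show (QuadraticAlgebra.C b.im : K).norm = b.im * b.im by
      simp [QuadraticAlgebra.norm_def], χ_sq hb, one_mul]
  rw [e]
  have hw : (QuadraticAlgebra.C b.im : K)⁻¹ = ⟨b.im⁻¹, 0⟩ := by
    apply inv_eq_of_mul_eq_one_right
    ext <;> simp [hb] <;> rfl
  refine .club _ _ _ (by simpa using hb) (.inl (mul_ne_zero hb hn0)) (hσ.trace_fixed _)
    (show _ ≤ clubSpace σ _ _ _ from ?_)
  rw [hw, Submodule.span_le]
  generalize hd : b.im = d at *
  rintro k (rfl | rfl | rfl) <;> rw [SetLike.mem_coe]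
  · refine mem_clubSpace_of (r := d⁻¹) (i := 0) (s := n) (by simp) (by simp) (by field_simp)
      (map_zero σ) (by rw [h1, mul_zero])
  · refine mem_clubSpace_of (r := d⁻¹ * k.re) (i := 1) (s := n * k.re) (by simp)
      (by simp [hd, hb]) (by field_simp) (map_one σ) (by rw [mul_one])
  · refine mem_clubSpace_of (r := d⁻¹ * (x + y * b.re)) (i := y) (s := n * x + y * (n * b.re))
      (by simp) (by simp [hd]; field_simp) (by field_simp) hy ?_
    rw [traceForm_add, h2, traceForm_mul_of_fixed hy]
    ring

theorem hasSign_span_of_div_fixed (hσ : IsCubicFrobenius σ) {b : K} (hb : b.im ≠ 0) {x y t Q r : E}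
    (hy : σ y - y ≠ 0) (ht : σ t = t) (hx : σ x - x = -t * (σ y - y)) (hr : r = b.re - t)
    (hQ : Q = r * r - δ * (b.im * b.im)) :
    P.HasSign (Submodule.span F {1, b, QuadraticAlgebra.C x + y • b})
      (P.χ Q * P.φ (b.im * σ (σ y - y) / Q) (-traceForm σ (σ (σ y - y) * r / Q))) := by
  have hQ0 : Q ≠ 0 := hQ ▸ sq_sub_ne_zero hb
  have h1 := traceForm_sub hσ y
  have h2 := traceForm_sub_mul hσ y
  have hn0 : σ (σ y - y) ≠ 0 := fun e => hy ((σ : E →+* E).injective (e.trans (map_zero σ).symm))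
  generalize σ (σ y - y) = n at *
  have hs : σ (x + t * y) = x + t * y := by
    rw [map_add, map_mul, ht]; linear_combination hx
  have hre : b.re = r + t := by rw [hr]; ring
  generalize hd : b.im = d at *
  -- The conjugate of (b - t) / d, hence an E-multiple of (b - t)⁻¹. It is scaled so that 1, b and x
  -- + y b get the second coordinates -1, -t and -(x + t y), all in F.
  let w : K := ⟨r / d, -1⟩
  have hw : w ≠ 0 := by
    intro e
    have := congrArg QuadraticAlgebra.im e
    simp [w] at this
  have hχ : P.χ Q = P.χ (w⁻¹).norm := by
    have hwn : w.norm = Q / (d * d) := by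
      rw [QuadraticAlgebra.norm_def, hQ]; simp only [w]; field_simp; ring
    have h0 : w.norm * (w⁻¹).norm = 1 := by
      rw [← map_mul, mul_inv_cancel₀ hw, map_one]
    refine χ_eq_of_mul_sq (a := Q / d) (div_ne_zero hQ0 hb) ?_
    have : (w⁻¹).norm = d * d / Q := by
      rw [hwn] at h0
      field_simp at h0 ⊢
      linear_combination h0
    rw [this]; field_simp
  rw [hχ]
  refine .club _ _ _ (inv_ne_zero hw) (.inl (div_ne_zero (mul_ne_zero hb hn0) hQ0))
    (by rw [map_neg, hσ.trace_fixed]) (show _ ≤ clubSpace σ _ _ _ from ?_)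
  rw [inv_inv, Submodule.span_le]
  rintro k (rfl | rfl | rfl) <;> rw [SetLike.mem_coe]
  · refine mem_clubSpace_of (r := r / d) (i := -1) (s := n * r / Q) (by simp [w]) (by simp [w])
      (by field_simp) (by simp) (by ring)
  · refine mem_clubSpace_of (r := (Q + t * r) / d) (i := -t) (s := n + t * (n * r / Q))
      ?_ ?_ (by field_simp) (by rw [map_neg, ht]) ?_
    · simp only [QuadraticAlgebra.re_mul, w, hre, hd, hQ]; field_simp; ring
    · simp only [QuadraticAlgebra.im_mul, w, hre, hd]; field_simp; ring
    · rw [traceForm_add, h1, traceForm_mul_of_fixed ht]; ring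
  · refine mem_clubSpace_of (r := (y * Q + (x + t * y) * r) / d) (i := -(x + t * y))
      (s := n * y + (x + t * y) * (n * r / Q)) ?_ ?_ (by field_simp) (by rw [map_neg, hs]) ?_
    · simp [w, hre, hd, hQ]; field_simp; ring
    · simp [w, hre, hd]; field_simp; ring
    · rw [traceForm_add, h2, traceForm_mul_of_fixed hs]; ring

theorem hasSign_span_of_not_fixed (hσ : IsCubicFrobenius σ) {b : K} (hb : b.im ≠ 0) {x y t Q r : E}
    (ht : σ t ≠ t) (hx : σ x - x = -t * (σ y - y)) (hr : r = b.re - t)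
    (hQ : Q = r * r - δ * (b.im * b.im)) :
    P.HasSign (Submodule.span F {1, b, QuadraticAlgebra.C x + y • b})
      (P.χ Q * P.Φ ((b - QuadraticAlgebra.C (σ (σ t))) / (QuadraticAlgebra.C t - b))) := by
  set z := σ (σ t) with hz
  have hσz : σ z = t := hσ.cube t
  have hζ : t - z ≠ 0 := by
    intro e
    apply ht
    conv_lhs => rw [sub_eq_zero.1 e, hσz]
  set ζ := t - z with hζd
  -- Solution of α + β = 1 and z α + t β = b, where t = σ z. Thus 1, b and x + y b are the images of
  -- 1, z and x + y z, the last because σ(x + y z) = x + y t.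
  let α : K := ζ⁻¹ • (QuadraticAlgebra.C t - b)
  let β : K := ζ⁻¹ • (b - QuadraticAlgebra.C z)
  have hdiv : β / α = (b - QuadraticAlgebra.C z) / (QuadraticAlgebra.C t - b) := by
    simp only [α, β, Algebra.smul_def]
    rw [mul_div_mul_left]
    simpa using hζ
  have hχ : P.χ Q = P.χ α.norm := by
    refine χ_eq_of_mul_sq hζ ?_
    simp only [α, norm_smul]
    field_simp
    rw [hQ, hr]
    simp [QuadraticAlgebra.norm_def]; ring
  rw [hχ, ← hdiv]
  have hbr : bracket α β ≠ 0 := by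
    have : bracket α β = b.im / ζ := by
      simp [bracket, α, β]; field_simp; rw [hζd]; ring
    rw [this]
    exact div_ne_zero hb hζ
  refine .scattered _ _ hbr ?_
  rw [Submodule.span_le]
  rintro k (rfl | rfl | rfl)
  · refine ⟨1, ?_⟩
    have h1 : (1 : K).re = 1 := rfl
    have h2 : (1 : K).im = 0 := rfl
    ext
    · simp [α, β, h1]; field_simp; rw [hζd]; ring
    · simp [α, β, h2]
  · refine ⟨z, ?_⟩
    ext <;> simp [α, β, hσz] <;> field_simp <;> rw [hζd] <;> ring
  · refine ⟨x + y * z, ?_⟩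
    have h3 : σ (x + y * z) = x + y * t := by
      rw [map_add, map_mul, hσz]; linear_combination hx
    ext <;> simp only [scatteredMap_apply, h3] <;> simp [α, β] <;> field_simp <;> rw [hζd] <;> ring

theorem hasSign_span (hσ : IsCubicFrobenius σ) {b : K} (hb : b.im ≠ 0) {x y : E}
    (hxy : σ x - x ≠ 0 ∨ σ y - y ≠ 0) :
    P.HasSign (Submodule.span F {1, b, QuadraticAlgebra.C x + y • b})
      (P.planeSign b (σ x - x) (σ y - y)) := by
  rw [planeSign]
  split_ifs with h h'
  · rcases hxy with e | e
    exacts [absurd h' e, absurd h e]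
  · exact hasSign_span_of_fixed hσ hb h' (sub_eq_zero.1 h)
  · have hx : σ x - x = -(-(σ x - x) / (σ y - y)) * (σ y - y) := by field_simp
    dsimp only
    split_ifs with ht
    · exact hasSign_span_of_div_fixed hσ hb h ht hx rfl rfl
    · exact hasSign_span_of_not_fixed hσ hb ht hx rfl rfl

end SignRule
end QuadraticExtension

/-! ### The sign function on K and its sums over pencils -/

section QuadraticExtension

variable {F E : Type*} [Field F] [Field E] [Algebra F E] {σ : E →ₐ[F] E} {δ : E}

local notation "K" => QuadraticAlgebra E δ 0

variable [Fact (∀ r : E, r ^ 2 ≠ δ + 0 * r)]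

namespace SignRule

variable {P : SignRule σ δ}

theorem re_one_eq : (1 : K).re = 1 := rfl

theorem im_one_eq : (1 : K).im = 0 := rfl

theorem exists_eq_C_add_smul {b : K} (hb : b.im ≠ 0) (c : K) :
    ∃ x y : E, c = QuadraticAlgebra.C x + y • b := by
  refine ⟨c.re - c.im / b.im * b.re, c.im / b.im, ?_⟩
  ext <;> simp <;> field_simp
  ring

theorem C_add_smul_inj {b : K} (hb : b.im ≠ 0) {x y x' y' : E}
    (h : (QuadraticAlgebra.C x + y • b : K) = QuadraticAlgebra.C x' + y' • b) :
    x = x' ∧ y = y' := by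
  have h1 := congrArg QuadraticAlgebra.im h
  have h2 := congrArg QuadraticAlgebra.re h
  simp only [QuadraticAlgebra.im_add, QuadraticAlgebra.re_add, QuadraticAlgebra.im_smul,
    QuadraticAlgebra.re_smul, QuadraticAlgebra.re_C, QuadraticAlgebra.im_C, smul_eq_mul,
    zero_add] at h1 h2
  obtain rfl := mul_right_cancel₀ hb h1
  exact ⟨add_right_cancel h2, rfl⟩

theorem algebraMap_add_smul (s t : F) (b : K) :
    (QuadraticAlgebra.C (algebraMap F E s) + algebraMap F E t • b : K) = s • (1 : K) + t • b := by
  ext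
  · simp only [QuadraticAlgebra.re_add, QuadraticAlgebra.re_smul, QuadraticAlgebra.re_C, re_one_eq]
    simp [Algebra.smul_def]
  · simp only [QuadraticAlgebra.im_add, QuadraticAlgebra.im_smul, QuadraticAlgebra.im_C, im_one_eq]
    simp [Algebra.smul_def]

theorem mem_span_iff (hσ : IsCubicFrobenius σ) {b : K} (hb : b.im ≠ 0) {x y : E} :
    (QuadraticAlgebra.C x + y • b : K) ∈ Submodule.span F {1, b} ↔
      σ x - x = 0 ∧ σ y - y = 0 := by
  rw [Submodule.mem_span_pair]
  constructor
  · rintro ⟨s, t, h⟩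
    rw [← algebraMap_add_smul] at h
    obtain ⟨rfl, rfl⟩ := C_add_smul_inj hb h
    simp
  · rintro ⟨h1, h2⟩
    obtain ⟨s, rfl⟩ := hσ.fixed x (sub_eq_zero.1 h1)
    obtain ⟨t, rfl⟩ := hσ.fixed y (sub_eq_zero.1 h2)
    exact ⟨s, t, (algebraMap_add_smul s t b).symm⟩

theorem HasSign.map_mulLeft {U : Submodule F K} {s : ℤ} {a : K} (ha : a ≠ 0)
    (h : P.HasSign U s) :
    P.HasSign (U.map (LinearMap.mulLeft F a)) (P.χ a.norm * s) := by
  cases h with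
  | scattered α β h hU =>
    have h1 := HasSign.scattered (P := P) (U := U.map (LinearMap.mulLeft F a)) (a * α) (a * β)
      (by rw [bracket_mul]; exact mul_ne_zero (norm_ne_zero ha) h) (by
        rintro _ ⟨k, hk, rfl⟩
        obtain ⟨x, rfl⟩ := hU hk
        exact ⟨x, by simp [mul_add]⟩)
    rwa [mul_div_mul_left _ _ ha, map_mul, map_mul, mul_assoc] at h1
  | club v m u hv hmu hu hU =>
    have h1 := HasSign.club (P := P) (U := U.map (LinearMap.mulLeft F a)) (a * v) m u
      (mul_ne_zero ha hv) hmu hu (by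
        rintro _ ⟨k, hk, rfl⟩
        have : (a * v)⁻¹ * (LinearMap.mulLeft F a) k = v⁻¹ * k := by
          simp only [LinearMap.mulLeft_apply]; field_simp
        rw [this]
        exact hU k hk)
    rwa [map_mul, map_mul, mul_assoc] at h1

theorem map_mulLeft_map {a b : K} (h : a * b = 1) (U : Submodule F K) :
    (U.map (LinearMap.mulLeft F b)).map (LinearMap.mulLeft F a) = U := by
  rw [← Submodule.map_comp, ← LinearMap.mulLeft_mul, h, LinearMap.mulLeft_one, Submodule.map_id]

theorem finrank_map_mulLeft [FiniteDimensional F K] {a : K} (ha : a ≠ 0) (U : Submodule F K) :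
    finrank F (U.map (LinearMap.mulLeft F a)) = finrank F U := by
  apply le_antisymm (Submodule.finrank_map_le _ _)
  conv_lhs => rw [← map_mulLeft_map (inv_mul_cancel₀ ha) U]
  exact Submodule.finrank_map_le _ _

theorem finrank_span_one_pair [FiniteDimensional F K] {b : K} (hb : b ∉ Submodule.span F {(1 : K)}) :
    finrank F (Submodule.span F {1, b}) = 2 := by
  rw [show ({1, b} : Set K) = {1} ∪ {b} from rfl, Submodule.span_union,
    Submodule.finrank_sup_span_singleton hb, finrank_span_singleton one_ne_zero]

theorem notMem_span_one {b : K} (hb : b.im ≠ 0) : b ∉ Submodule.span F {(1 : K)} := by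
  rw [Submodule.mem_span_singleton]
  rintro ⟨c, rfl⟩
  simp [im_one_eq] at hb

theorem span_one_pair_sup (b c : K) : Submodule.span F {1, b} ⊔ Submodule.span F {c} =
    Submodule.span F {1, b, c} := by
  rw [← Submodule.span_union]
  congr 1
  ext; simp; tauto

/-- Multiplying by the inverse of a nonzero element allows 1 ∈ U. Then U is E itself, or it is
spanned by 1, some b ∉ E and a third vector, where `hasSign_span` applies. -/
theorem exists_hasSign [FiniteDimensional F K] (hσ : IsCubicFrobenius σ) {U : Submodule F K}
    (hU : finrank F U = 3) : ∃ s, P.HasSign U s := by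
  obtain ⟨a, ha, ha0⟩ := Submodule.exists_mem_ne_zero_of_ne_bot
    (show U ≠ ⊥ by rintro rfl; simp at hU)
  suffices h : ∃ s, P.HasSign (U.map (LinearMap.mulLeft F a⁻¹)) s by
    obtain ⟨s, hs⟩ := h
    have := hs.map_mulLeft ha0
    rw [map_mulLeft_map (mul_inv_cancel₀ ha0)] at this
    exact ⟨_, this⟩
  have h1 : (1 : K) ∈ U.map (LinearMap.mulLeft F a⁻¹) := ⟨a, ha, by simp [ha0]⟩
  rw [← finrank_map_mulLeft (inv_ne_zero ha0)] at hU
  generalize U.map (LinearMap.mulLeft F a⁻¹) = W at *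
  by_cases h : ∀ k ∈ W, k.im = 0
  · exact ⟨_, .club 1 0 1 one_ne_zero (.inr one_ne_zero) (map_one σ) fun k hk => by
      simp [h k hk, traceForm]⟩
  · push Not at h
    obtain ⟨b, hbW, hb⟩ := h
    have hle : Submodule.span F {1, b} ≤ W := by
      rw [Submodule.span_le]
      rintro _ (rfl | rfl) <;> assumption
    obtain ⟨c, -, hc, rfl⟩ := Submodule.exists_eq_sup_span_singleton hle
      (by rw [hU, finrank_span_one_pair (notMem_span_one hb)])
    obtain ⟨x, y, rfl⟩ := exists_eq_C_add_smul hb c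
    rw [mem_span_iff hσ hb, not_and_or] at hc
    rw [span_one_pair_sup]
    exact ⟨_, hasSign_span hσ hb hc⟩

/-- The sign of a subspace, zero unless it has dimension three. -/
noncomputable def signFun (P : SignRule σ δ) (U : Submodule F K) : ℤ :=
  open Classical in if h : finrank F U = 3 ∧ ∃ s, P.HasSign U s then h.2.choose else 0

theorem signFun_eq (hσ : IsCubicFrobenius σ) {U : Submodule F K} (hU : finrank F U = 3) {s : ℤ}
    (h : P.HasSign U s) : P.signFun U = s := by
  have h' : finrank F U = 3 ∧ ∃ s, P.HasSign U s := ⟨hU, s, h⟩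
  rw [signFun, dif_pos h']
  exact h'.2.choose_spec.unique hσ hU h

theorem signFun_of_finrank_ne {U : Submodule F K} (hU : finrank F U ≠ 3) : P.signFun U = 0 := by
  rw [signFun, dif_neg fun h => hU h.1]

theorem signFun_map_mulLeft [FiniteDimensional F K] (hσ : IsCubicFrobenius σ) {a : K} (ha : a ≠ 0)
    (U : Submodule F K) :
    P.signFun (U.map (LinearMap.mulLeft F a)) = P.χ a.norm * P.signFun U := by
  by_cases hU : finrank F U = 3
  · obtain ⟨s, hs⟩ := exists_hasSign (P := P) hσ hU
    rw [signFun_eq hσ hU hs, signFun_eq hσ ((finrank_map_mulLeft ha U).trans hU)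
      (hs.map_mulLeft ha)]
  · rw [signFun_of_finrank_ne hU, signFun_of_finrank_ne, mul_zero]
    rwa [finrank_map_mulLeft ha]

/-- The sum of the signs of the `3`-subspaces through `T`, weighted by the number of vectors that
span them together with `T`. -/
noncomputable def pencilSum (P : SignRule σ δ) (T : Submodule F K) : ℤ :=
  ∑ᶠ c : K, P.signFun (T ⊔ Submodule.span F {c})

theorem pencilSum_map_mulLeft [Finite K] [FiniteDimensional F K] (hσ : IsCubicFrobenius σ) {a : K}
    (ha : a ≠ 0) (T : Submodule F K) :
    P.pencilSum (T.map (LinearMap.mulLeft F a)) = P.χ a.norm * P.pencilSum T := by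
  rw [pencilSum, pencilSum, mul_finsum,
    ← finsum_comp_equiv (Equiv.mulLeft₀ a ha)]
  refine finsum_congr fun c => ?_
  rw [← signFun_map_mulLeft hσ ha, Submodule.map_sup, Submodule.map_span, Set.image_singleton]
  rfl

theorem pencilSum_eq_sum [Fintype E] (hσ : IsCubicFrobenius σ) [FiniteDimensional F K] {b : K}
    (hb : b.im ≠ 0) :
    P.pencilSum (Submodule.span F {1, b}) = ∑ x : E, ∑ y : E, P.planeSign b (σ x - x) (σ y - y) := by
  have hbij : Function.Bijective fun p : E × E => (QuadraticAlgebra.C p.1 + p.2 • b : K) :=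
    ⟨fun p p' h => Prod.ext (C_add_smul_inj hb h).1 (C_add_smul_inj hb h).2, fun c => by
      obtain ⟨x, y, rfl⟩ := exists_eq_C_add_smul hb c
      exact ⟨(x, y), rfl⟩⟩
  rw [pencilSum, ← finsum_comp _ hbij, finsum_eq_sum_of_fintype, Fintype.sum_prod_type]
  refine Finset.sum_congr rfl fun x _ => Finset.sum_congr rfl fun y _ => ?_
  dsimp only
  have h2 := finrank_span_one_pair (F := F) (notMem_span_one hb)
  by_cases h : σ x - x = 0 ∧ σ y - y = 0
  · rw [Submodule.sup_span_singleton_eq_self ((mem_span_iff hσ hb).2 h),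
      signFun_of_finrank_ne (by rw [h2]; norm_num), planeSign, if_pos h.2, if_pos h.1]
  · refine signFun_eq hσ ?_ ?_
    · rw [Submodule.finrank_sup_span_singleton (mt (mem_span_iff hσ hb).1 h), h2]
    · rw [span_one_pair_sup]
      exact hasSign_span hσ hb (not_and_or.1 h)

theorem mem_span_C_iff {e x : E} : (QuadraticAlgebra.C x : K) ∈ Submodule.span F
    {1, QuadraticAlgebra.C e} ↔ x ∈ Submodule.span F {1, e} := by
  simp only [Submodule.mem_span_pair]
  refine exists_congr fun s => exists_congr fun t => ?_
  rw [QuadraticAlgebra.ext_iff]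
  simp [re_one_eq, im_one_eq]

/-- For n = σ(σ e - e), the form tr(n ·) vanishes on ⟨1, e⟩. A third vector in E gives E itself,
with sign φ(0, 1). A third vector x + c₁ √δ with c₁ ≠ 0 gives a club with parameters (n c₁, tr(n
x)). Substituting m = n c₁ and c = n x turns the pencil sum into the sum of the hypothesis. -/
theorem pencilSum_eq_zero_of_im [Fintype E] [DecidableEq E] (hσ : IsCubicFrobenius σ) [FiniteDimensional F K] {e : E}
    (he : σ e ≠ e) (h : ∑ m : E, (if m = 0 then P.φ 0 1 * (Nat.card E - Nat.card F ^ 2) else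
      ∑ c, P.φ m (traceForm σ c)) = 0) :
    P.pencilSum (Submodule.span F {1, QuadraticAlgebra.C e}) = 0 := by
  classical
  set n := σ (σ e - e) with hn
  have hn0 : n ≠ 0 := fun h0 => he (sub_eq_zero.1 ((σ : E →+* E).injective (h0.trans (map_zero σ).symm)))
  have h1 : traceForm σ n = 0 := traceForm_sub hσ e
  have h3 : traceForm σ (n * e) = 0 := traceForm_sub_mul hσ e
  have hbij : Function.Bijective fun p : E × E => (⟨p.2, p.1⟩ : K) :=
    ⟨fun p p' h => Prod.ext (congrArg QuadraticAlgebra.im h) (congrArg QuadraticAlgebra.re h),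
      fun c => ⟨(c.im, c.re), rfl⟩⟩
  rw [pencilSum, ← finsum_comp _ hbij, finsum_eq_sum_of_fintype, Fintype.sum_prod_type]
  refine Eq.trans ?_ ((Equiv.sum_comp (Equiv.mulLeft₀ n hn0) _).trans h)
  have hne : QuadraticAlgebra.C e ∉ Submodule.span F {(1 : K)} := by
    rw [Submodule.mem_span_singleton]
    rintro ⟨c, hc⟩
    have := congrArg QuadraticAlgebra.re hc
    rw [QuadraticAlgebra.re_smul, re_one_eq, Algebra.smul_def, mul_one] at this
    exact he (by rw [← QuadraticAlgebra.re_C (a := δ) (b := 0) e, ← this, AlgHom.commutes])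
  have h2 := finrank_span_one_pair (F := F) hne
  have hcard : Nat.card (Submodule.span F {1, e}) = Nat.card F ^ 2 := by
    have := hσ.finiteDimensional
    rw [@Module.natCard_eq_pow_finrank F, show ({1, e} : Set E) = {1} ∪ {e} from rfl,
      Submodule.span_union, Submodule.finrank_sup_span_singleton, finrank_span_singleton one_ne_zero]
    rw [Submodule.mem_span_singleton]
    rintro ⟨c, rfl⟩
    rw [Algebra.smul_def, mul_one, AlgHom.commutes] at he
    exact he rfl
  have hfin : ∀ c : K, c ∉ Submodule.span F {1, QuadraticAlgebra.C e} →
      finrank F ↥(Submodule.span F {1, QuadraticAlgebra.C e} ⊔ Submodule.span F {c}) = 3 := by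
    intro c hc
    rw [Submodule.finrank_sup_span_singleton hc, h2]
  refine Finset.sum_congr rfl fun c₁ _ => ?_
  have hmul : ∀ x, Equiv.mulLeft₀ n hn0 x = n * x := fun _ => rfl
  simp only [hmul, mul_eq_zero, hn0, false_or]
  split_ifs with hc
  · subst hc
    have key : ∀ x : E, P.signFun (Submodule.span F {1, QuadraticAlgebra.C e} ⊔
        Submodule.span F {(⟨x, 0⟩ : K)}) =
        if x ∈ Submodule.span F {1, e} then 0 else P.φ 0 1 := by
      intro x
      have hC : (⟨x, 0⟩ : K) = QuadraticAlgebra.C x := rfl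
      rw [hC]
      split_ifs with hx
      · rw [Submodule.sup_span_singleton_eq_self (mem_span_C_iff.2 hx),
          signFun_of_finrank_ne (by rw [h2]; norm_num)]
      · refine signFun_eq hσ (hfin _ (mt mem_span_C_iff.1 hx)) ?_
        have := HasSign.club (P := P) (U := Submodule.span F {1, QuadraticAlgebra.C e} ⊔
          Submodule.span F {(QuadraticAlgebra.C x : K)}) 1 0 1 one_ne_zero (.inr one_ne_zero)
          (map_one σ) (show _ ≤ clubSpace σ _ _ _ by
            rw [span_one_pair_sup, Submodule.span_le]
            rintro k (rfl | rfl | rfl) <;> simp [mem_clubSpace, traceForm, im_one_eq])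
        simpa using this
    have hle : Nat.card (Submodule.span F {1, e}) = (Finset.univ.filter fun x =>
        x ∈ Submodule.span F {1, e}).card := by
      rw [Nat.card_eq_fintype_card, Fintype.card_subtype]
    have hsum := Finset.card_filter_add_card_filter_not (s := (Finset.univ : Finset E))
      fun x => x ∈ Submodule.span F {1, e}
    simp only [key]
    rw [Finset.sum_ite, Finset.sum_const_zero, zero_add, Finset.sum_const, nsmul_eq_mul,
      ← Nat.cast_pow, ← hcard, hle, Nat.card_eq_fintype_card, ← Finset.card_univ, ← hsum]
    push_cast
    ring
  · refine Eq.trans ?_ (Equiv.sum_comp (Equiv.mulLeft₀ n hn0) _)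
    refine Finset.sum_congr rfl fun x _ => ?_
    refine signFun_eq hσ (hfin _ fun hmem => ?_) ?_
    · obtain ⟨s, t, hst⟩ := Submodule.mem_span_pair.1 hmem
      have := congrArg QuadraticAlgebra.im hst
      simp [im_one_eq] at this
      exact hc this.symm
    · have hw : (QuadraticAlgebra.C c₁ : K)⁻¹ = ⟨c₁⁻¹, 0⟩ := by
        apply inv_eq_of_mul_eq_one_right
        ext <;> simp [hc] <;> rfl
      have := HasSign.club (P := P) (U := Submodule.span F {1, QuadraticAlgebra.C e} ⊔
          Submodule.span F {(⟨x, c₁⟩ : K)}) (QuadraticAlgebra.C c₁) (n * c₁) (traceForm σ (n * x))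
          (by simpa using hc) (.inl (mul_ne_zero hn0 hc)) (hσ.trace_fixed _)
          (show _ ≤ clubSpace σ _ _ _ by
            rw [span_one_pair_sup, hw, Submodule.span_le]
            rintro k (rfl | rfl | rfl) <;> rw [SetLike.mem_coe]
            · exact mem_clubSpace_of (r := c₁⁻¹) (i := 0) (s := n) (by simp) (by simp)
                (by field_simp) (map_zero σ) (by rw [h1, mul_zero])
            · exact mem_clubSpace_of (r := c₁⁻¹ * e) (i := 0) (s := n * e) (by simp) (by simp)
                (by field_simp) (map_zero σ) (by rw [h3, mul_zero])
            · exact mem_clubSpace_of (r := c₁⁻¹ * x) (i := 1) (s := n * x) (by simp) (by simp [hc])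
                (by field_simp) (map_one σ) (by rw [mul_one]))
      rw [show (QuadraticAlgebra.C c₁ : K).norm = c₁ * c₁ by
        simp [QuadraticAlgebra.norm_def], χ_sq hc, one_mul] at this
      exact this

/-- Multiplication by a⁻¹ for a nonzero a ∈ T only changes the pencil sum by a sign, so planes
through 1 suffice. -/
theorem isHalving_signFun [Fintype E] [DecidableEq E] (hσ : IsCubicFrobenius σ) [FiniteDimensional F K]
    (h : ∑ m : E, (if m = 0 then P.φ 0 1 * (Nat.card E - Nat.card F ^ 2) else
      ∑ c, P.φ m (traceForm σ c)) = 0)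
    (h' : ∀ b : K, b.im ≠ 0 → P.pencilSum (Submodule.span F {1, b}) = 0) :
    IsHalving F 3 P.signFun where
  sign U hU := by
    obtain ⟨s, hs⟩ := exists_hasSign (P := P) hσ hU
    rw [signFun_eq hσ hU hs]
    exact hs.sign
  zero U hU := signFun_of_finrank_ne hU
  balanced T hT := by
    have : Finite K := Finite.of_injective (fun k : K => (k.re, k.im)) fun k k' h =>
      QuadraticAlgebra.ext (congrArg Prod.fst h) (congrArg Prod.snd h)
    replace hT : finrank F T = 2 := by omega
    obtain ⟨a, ha, ha0⟩ := Submodule.exists_mem_ne_zero_of_ne_bot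
      (show T ≠ ⊥ by rintro rfl; simp at hT)
    have h1 : (1 : K) ∈ T.map (LinearMap.mulLeft F a⁻¹) := ⟨a, ha, by simp [ha0]⟩
    change P.pencilSum T = 0
    rw [← map_mulLeft_map (mul_inv_cancel₀ ha0) T, pencilSum_map_mulLeft hσ ha0]
    obtain ⟨b, -, hb, e⟩ := Submodule.exists_eq_span_pair
      ((finrank_map_mulLeft (inv_ne_zero ha0) T).trans hT) h1 one_ne_zero
    rw [e]
    by_cases him : b.im = 0
    · obtain ⟨x, rfl⟩ : ∃ x, b = QuadraticAlgebra.C x := ⟨b.re, by ext <;> simp [him]⟩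
      rw [pencilSum_eq_zero_of_im hσ _ h, mul_zero]
      intro hx
      obtain ⟨c, rfl⟩ := hσ.fixed x hx
      refine hb (Submodule.mem_span_singleton.2 ⟨c, ?_⟩)
      ext
      · rw [QuadraticAlgebra.re_smul, re_one_eq, Algebra.smul_def, mul_one, QuadraticAlgebra.re_C]
      · rw [QuadraticAlgebra.im_smul, im_one_eq, smul_zero, QuadraticAlgebra.im_C]
    · rw [h' b him, mul_zero]

/-- The relation `b ↦ b⁻¹` on planes through `1`. -/
theorem pencilSum_inv [Finite K] [FiniteDimensional F K] (hσ : IsCubicFrobenius σ) {b : K}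
    (hb : b ≠ 0) (h : P.pencilSum (Submodule.span F {1, b⁻¹}) = 0) :
    P.pencilSum (Submodule.span F {1, b}) = 0 := by
  have : Submodule.span F {1, b} = (Submodule.span F {1, b⁻¹}).map (LinearMap.mulLeft F b) := by
    rw [Submodule.map_span, Set.image_pair]
    simp [hb, Set.pair_comm]
  rw [this, pencilSum_map_mulLeft hσ hb, h, mul_zero]

theorem span_one_add_smul {s t : F} (ht : t ≠ 0) (b : K) :
    Submodule.span F {1, s • (1 : K) + t • b} = Submodule.span F {1, b} := by
  apply le_antisymm <;> rw [Submodule.span_le] <;> rintro k (rfl | rfl)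
  · exact Submodule.subset_span (by simp)
  · exact Submodule.mem_span_pair.2 ⟨s, t, rfl⟩
  · exact Submodule.subset_span (by simp)
  · refine Submodule.mem_span_pair.2 ⟨-(t⁻¹ * s), t⁻¹, ?_⟩
    rw [smul_add, smul_smul, smul_smul, inv_mul_cancel₀ ht]
    module

end SignRule
end QuadraticExtension

/-! ### Sign tables and the finite check -/

/-- A finite table of signs for the subspaces of a six-dimensional space over the field of order
`q`. The elements of the cubic extension are represented by the integers with the digits of their
coordinates in base `16`, and by their logarithms, with `M` in the place of the logarithm of `0`;
`N` is the logarithm of `2` and `H` that of `-1`. -/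
structure SignTable where
  (q M H N expT logT sgn₀ sgn₁ sgn : ℕ)
  (pts ker : List ℕ)

namespace SignTable

/-- Tables are arrays of w-bit words packed into one number. -/
def field (T w i : ℕ) : ℕ := (T >>> (w * i)) % 2 ^ w

variable (D : SignTable)

def ex (i : ℕ) : ℕ := field D.expT 12 (i % D.M)

/-- Each hexadecimal digit is reduced mod q, so a sum of two codes may be passed unreduced: for q ≤
5 the base 16 rules out carries. -/
def lg (n : ℕ) : ℕ :=
  field D.logT 7 (n % 16 % D.q + D.q * (n / 16 % 16 % D.q + D.q * (n / 256 % D.q)))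

def tr (i : ℕ) : ℕ := (D.ex i + D.ex (D.q * i) + D.ex (D.q ^ 2 * i)) % 16 % D.q

def mulEx (a b : ℕ) (k : ℕ) : ℕ := if a = D.M then 0 else if b = D.M then 0 else D.ex (a + b + k)

/-- Exponent of the sign φ(γ ^ m, u), with u < q a residue and not a logarithm. -/
def phiBit (m u : ℕ) : ℕ :=
  if u = 0 then field D.sgn₀ 1 (m % D.N) else field D.sgn₁ 1 ((m + D.M - D.lg u) % D.M)

/-- Logarithm of the norm y² - 2 d²; both arguments are logarithms. -/
def normLog (ld y : ℕ) : ℕ := D.lg (D.mulEx y y 0 + D.ex (2 * ld + D.N + D.H))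

/-- Here b has real part coded by `e` and imaginary part γ ^ `ld`, `nt` is the code of -t for t ∈ F,
and Y = γ ^ `j`. The functions `inftyBit` and `scatBit` treat Y = 0 and t ∉ F. -/
def clubBit (ld e nt j : ℕ) : ℕ :=
  let y := D.lg (e + nt)
  let lQ := D.normLog ld y
  lQ + D.phiBit (ld + D.q * j + D.M - lQ)
    (if y = D.M then 0 else D.tr (D.q * j + y + D.H + D.M - lQ))

def inftyBit (ld e i : ℕ) : ℕ :=
  let y := D.lg e
  D.phiBit (ld + D.q * i) (if y = D.M then 0 else D.tr (D.q * i + y))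

def scatBit (ld e lt : ℕ) : ℕ :=
  let lz := D.q ^ 2 * lt
  let y₁ := D.lg (e + D.ex (lz + D.H))
  let y₂ := D.lg (e + D.ex (lt + D.H))
  let lQ := D.normLog ld y₂
  let lζ := D.lg (D.ex lt + D.ex (lz + D.H))
  let w := D.lg (D.ex (2 * ld + D.N) + D.mulEx y₁ y₂ D.H)
  lQ + field D.sgn 1 ((ld + lζ + D.M - lQ) % (D.q - 1) * (D.M + 1) +
    if w = D.M then D.M else (w + D.M + D.M - ld - lζ) % D.M)

def sumBits (l : List ℕ) (f : ℕ → ℕ) : ℕ := (l.map fun i => f i % 2).sum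

def pairBit (ld e i j : ℕ) : ℕ :=
  let lt := (i + D.M + D.H - j) % D.M
  if lt % D.N = 0 then D.clubBit ld e (D.ex (lt + D.H)) j else D.scatBit ld e lt

/-- Number of negative signs among the pairs (X, Y) ≠ (0, 0) of trace-zero elements modulo F*: these
are (X, 0) and (0, Y) up to scalars, and the pairs with X normalised and Y ≠ 0 arbitrary. -/
def lineSum (ld e : ℕ) : ℕ :=
  sumBits D.pts (D.inftyBit ld e) + sumBits D.pts (D.clubBit ld e 0) +
    (D.pts.map fun i => sumBits D.ker (D.pairBit ld e i)).sum

/-- The conditions on the table; the last one says that the signs of the `3`-subspaces through a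
plane are balanced, up to a symmetry that moves the plane to an earlier one. -/
structure Valid : Prop where
  q_mem : D.q ∈ [3, 5]
  M_eq : D.M = D.N * (D.q - 1)
  H_eq : D.M = 2 * D.H
  H_mod : D.H % D.N = 0
  N_odd : D.N % 2 = 1
  ex_zero : D.ex 0 = 1
  ex_succ : ∀ i < D.M, D.ex i % 16 < D.q ∧ D.ex i / 16 % 16 < D.q ∧ D.ex i / 256 < D.q ∧
    D.ex (i + 1) = 2 * (D.ex i / 256) % D.q + 16 * ((D.ex i % 16 + D.ex i / 256) % D.q) +
      256 * (D.ex i / 16 % 16)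
  ex_lg : ∀ a < D.q, ∀ b < D.q, ∀ c < D.q,
    (a = 0 ∧ b = 0 ∧ c = 0 ∧ D.lg (a + 16 * b + 256 * c) = D.M) ∨
      D.lg (a + 16 * b + 256 * c) < D.M ∧
        D.ex (D.lg (a + 16 * b + 256 * c)) = a + 16 * b + 256 * c
  tr_mod : ∀ i < D.M, (D.ex i + D.ex (D.q * i) + D.ex (D.q ^ 2 * i)) / 16 % 16 % D.q = 0 ∧
    (D.ex i + D.ex (D.q * i) + D.ex (D.q ^ 2 * i)) / 256 % D.q = 0 ∧ (D.tr i = 0 → i ∈ D.ker)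
  -- `ker` lists the logarithms of the nonzero trace-zero elements and `pts` those of
  -- representatives modulo F*, whose elements are the powers of 2 = γ ^ N.
  ker_eq : D.ker = (List.range (D.q - 1)).flatMap fun a => D.pts.map (· + a * D.N)
  ker_length : D.ker.length + 1 = D.q ^ 2
  ker_nodup : D.ker.Nodup
  ker_lt : ∀ i ∈ D.ker, i < D.M
  -- Position M stands for m = 0, so φ(0, 1) = -1.
  sgn₁_M : field D.sgn₁ 1 D.M = 1
  -- The entries of `sgn₀` and `sgn₁`, without position M, have total sign 1, which cancels φ(0, 1)
  -- = -1. This is the condition from the planes inside E.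
  sum_sgn : 2 * (((List.range D.N).map (field D.sgn₀ 1)).sum +
    ((List.range D.M).map (field D.sgn₁ 1)).sum) + 1 = D.N + D.M
  -- First alternative: the inverse of b + s has an imaginary part with a smaller logarithm mod N.
  -- Second: exactly half of the (q + 1)(q² + 1) signs are negative.
  lineSum_eq : ∀ ld < D.N, ∀ a < D.q, ∀ b < D.q,
    (∃ s < D.q, (ld + D.M - D.normLog ld (D.lg (16 * a + 256 * b + s))) % D.N < ld) ∨
      2 * D.lineSum ld (16 * a + 256 * b) = D.pts.length * (D.ker.length + 2)

end SignTable

/-- M = 3³ - 1, N = 1 + 3 + 9 and H = M / 2; `table5` is analogous. The sign tables have N, M + 1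
and (q - 1)(M + 1) entries. -/
def table3 : SignTable where
  q := 3
  M := 26
  H := 13
  N := 13
  expT := 1045270563075186746840528357107989050018107633970665834558170698314549354018982327173349703681
  logT := 117627653157877534436619629457758094032612386924415631386
  sgn₀ := 623
  sgn₁ := 112101604
  sgn := 18014398444480641
  pts := [0, 1, 3, 9]
  ker := [0, 1, 3, 9, 13, 14, 16, 22]

def table5 : SignTable where
  q := 5
  M := 124
  H := 62
  N := 31
  expT := 1609929107520376574423488522593787045928103483986834911569882298640195178260727934255338995980549546733341424295234975167604780218520515868208036840110476544792712946857392378358058075896717218464311262870446129071025740286424376791780312063671677230609180907181524278589993077320645972923963543852106389423854134607900351585655869471257343846926018673223943938611848407851957832027189088408011407594957391986116982424197928598266132527859701448705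
  logT := 232935617989225346765235095130844921777377408991306744533214665500839020548348141129348473187517714831150067464101452003740383347467821279734117981169330325712444016481113221196507526529454904985907750933389699091244180318693275527272543135815693240611756107612284
  sgn₀ := 185134894
  sgn₁ := 29683924146516746228307576849324921681
  sgn := 2173267125100299846869096124985779028209787670209515426343888252912706775256840797754386109509533599909039149210986711269337408934513710722793802155485
  pts := [1, 5, 11, 24, 25, 27]
  ker := [1, 5, 11, 24, 25, 27, 32, 36, 42, 55, 56, 58, 63, 67, 73, 86, 87, 89, 94, 98, 104, 117, 118, 120]

set_option maxRecDepth 10000 in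
theorem table3_valid : table3.Valid where
  q_mem := by decide +kernel
  M_eq := by decide +kernel
  H_eq := by decide +kernel
  H_mod := by decide +kernel
  N_odd := by decide +kernel
  ex_zero := by decide +kernel
  ex_succ := by decide +kernel
  ex_lg := by decide +kernel
  tr_mod := by decide +kernel
  ker_eq := by decide +kernel
  ker_length := by decide +kernel
  ker_nodup := by decide +kernel
  ker_lt := by decide +kernel
  sgn₁_M := by decide +kernel
  sum_sgn := by decide +kernel
  lineSum_eq := by decide +kernel

set_option maxRecDepth 10000 in
theorem table5_valid : table5.Valid where
  q_mem := by decide +kernel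
  M_eq := by decide +kernel
  H_eq := by decide +kernel
  H_mod := by decide +kernel
  N_odd := by decide +kernel
  ex_zero := by decide +kernel
  ex_succ := by decide +kernel
  ex_lg := by decide +kernel
  tr_mod := by decide +kernel
  ker_eq := by decide +kernel
  ker_length := by decide +kernel
  ker_nodup := by decide +kernel
  ker_lt := by decide +kernel
  sgn₁_M := by decide +kernel
  sum_sgn := by decide +kernel
  lineSum_eq := by decide +kernel

/-! ### Discrete logarithms in E and their codes -/

namespace SignTable

section Represents

variable {F E : Type*} [Field F] [Field E] [Algebra F E]

/-- The powers of `γ` run through the nonzero elements of `E` and satisfy the relations that are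
built into the table `D`. -/
structure Represents (D : SignTable) (γ : E) (σ : E →ₐ[F] E) : Prop where
  valid : D.Valid
  cast_q : (D.q : E) = 0
  cube : γ ^ 3 = γ + 2
  pow_eq_one : ∀ i, γ ^ i = 1 ↔ D.M ∣ i
  exists_pow : ∀ x : E, x ≠ 0 → ∃ i, γ ^ i = x
  map_eq : ∀ x, σ x = x ^ D.q
  pow_N : γ ^ D.N = 2
  card_F : Nat.card F = D.q
  card_E : Nat.card E = D.q ^ 3
  frob : IsCubicFrobenius σ

/-- The element with the coordinates given by the digits of `n`. -/
def elt (γ : E) (n : ℕ) : E :=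
  ((n % 16 : ℕ) : E) + ((n / 16 % 16 : ℕ) : E) * γ + ((n / 256 : ℕ) : E) * γ ^ 2

/-- The logarithm to the base `γ`. -/
noncomputable def dlog (D : SignTable) (γ x : E) : ℕ :=
  open Classical in if h : ∃ i, i < D.M ∧ γ ^ i = x then h.choose else D.M

/-- The digits of `n` are smaller than `q`. -/
def IsCode (D : SignTable) (n : ℕ) : Prop :=
  n % 16 < D.q ∧ n / 16 % 16 < D.q ∧ n / 256 < D.q

theorem Valid.q_le {D : SignTable} (h : D.Valid) : 3 ≤ D.q ∧ D.q ≤ 5 := by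
  have := h.q_mem
  simp only [List.mem_cons, List.not_mem_nil, or_false] at this
  omega

theorem elt_add (γ : E) {m n : ℕ} (h : m % 16 + n % 16 < 16)
    (h' : m / 16 % 16 + n / 16 % 16 < 16) : elt γ (m + n) = elt γ m + elt γ n := by
  rw [elt, elt, elt, show (m + n) % 16 = m % 16 + n % 16 by omega,
    show (m + n) / 16 % 16 = m / 16 % 16 + n / 16 % 16 by omega,
    show (m + n) / 256 = m / 256 + n / 256 by omega]
  push_cast
  ring

theorem elt_mk (γ : E) {a b c : ℕ} (ha : a < 16) (hb : b < 16) :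
    elt γ (a + 16 * b + 256 * c) = a + b * γ + c * γ ^ 2 := by
  rw [elt, show (a + 16 * b + 256 * c) % 16 = a by omega,
    show (a + 16 * b + 256 * c) / 16 % 16 = b by omega,
    show (a + 16 * b + 256 * c) / 256 = c by omega]

@[simp] theorem elt_zero (γ : E) : elt γ 0 = 0 := by simp [elt]

namespace Represents

variable {D : SignTable} {γ : E} {σ : E →ₐ[F] E} (R : D.Represents γ σ)
include R

theorem cast_mod (n : ℕ) : ((n % D.q : ℕ) : E) = n := by
  conv_rhs => rw [← Nat.mod_add_div n D.q]
  push_cast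
  rw [R.cast_q, zero_mul, add_zero]

theorem M_pos : 0 < D.M := by
  have h1 := R.valid.M_eq
  rcases Nat.eq_zero_or_pos D.M with h | h
  · have := (R.pow_eq_one D.N).2 (by
      rw [h]
      have := R.valid.q_le
      rw [h] at h1
      rcases Nat.mul_eq_zero.1 h1.symm with h2 | h2
      · rw [h2]
      · omega)
    rw [R.pow_N] at this
    have h2 : (1 : E) = 0 := by linear_combination this
    exact absurd h2 one_ne_zero
  · exact h

theorem ne_zero : γ ≠ 0 := by
  rintro rfl
  have := (R.pow_eq_one D.M).2 dvd_rfl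
  rw [zero_pow R.M_pos.ne'] at this
  exact zero_ne_one this

theorem pow_M : γ ^ D.M = 1 := (R.pow_eq_one _).2 dvd_rfl

theorem pow_mod (i : ℕ) : γ ^ (i % D.M) = γ ^ i := by
  conv_rhs => rw [← Nat.mod_add_div i D.M, pow_add, pow_mul, R.pow_M, one_pow, mul_one]

theorem pow_inj {i j : ℕ} : γ ^ i = γ ^ j ↔ i ≡ j [MOD D.M] := by
  constructor
  · intro h
    wlog hij : i ≤ j generalizing i j
    · exact (this h.symm (le_of_not_ge hij)).symm
    rw [Nat.modEq_iff_dvd' hij, ← R.pow_eq_one]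
    refine mul_left_cancel₀ (pow_ne_zero i R.ne_zero) ?_
    rw [← pow_add, Nat.add_sub_cancel' hij, mul_one, h]
  · intro h
    rw [← R.pow_mod i, ← R.pow_mod j, h]

theorem pow_sub {a b : ℕ} (h : b ≤ a + D.M) : γ ^ (a + D.M - b) = γ ^ a / γ ^ b := by
  rw [eq_div_iff (pow_ne_zero _ R.ne_zero), ← pow_add, Nat.sub_add_cancel h, pow_add, R.pow_M,
    mul_one]

theorem dlog_pow (i : ℕ) : D.dlog γ (γ ^ i) = i % D.M := by
  have h : ∃ j, j < D.M ∧ γ ^ j = γ ^ i := ⟨i % D.M, Nat.mod_lt _ R.M_pos, R.pow_mod i⟩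
  rw [dlog, dif_pos h]
  have := R.pow_inj.1 h.choose_spec.2
  rwa [Nat.ModEq, Nat.mod_eq_of_lt h.choose_spec.1] at this

theorem dlog_zero : D.dlog γ 0 = D.M := by
  rw [dlog, dif_neg]
  rintro ⟨i, -, h⟩
  exact pow_ne_zero i R.ne_zero h

theorem exists_lt (x : E) (hx : x ≠ 0) : ∃ i < D.M, γ ^ i = x := by
  obtain ⟨i, rfl⟩ := R.exists_pow x hx
  exact ⟨i % D.M, Nat.mod_lt _ R.M_pos, R.pow_mod i⟩

theorem pow_dlog {x : E} (hx : x ≠ 0) : γ ^ D.dlog γ x = x := by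
  obtain ⟨i, rfl⟩ := R.exists_pow x hx
  rw [R.dlog_pow, R.pow_mod]

theorem dlog_lt {x : E} (hx : x ≠ 0) : D.dlog γ x < D.M := by
  obtain ⟨i, rfl⟩ := R.exists_pow x hx
  rw [R.dlog_pow]
  exact Nat.mod_lt _ R.M_pos

theorem dlog_le (x : E) : D.dlog γ x ≤ D.M := by
  by_cases hx : x = 0
  · rw [hx, R.dlog_zero]
  · exact (R.dlog_lt hx).le

theorem dlog_eq_M {x : E} : D.dlog γ x = D.M ↔ x = 0 :=
  ⟨fun h => by_contra fun hx => (R.dlog_lt hx).ne h, fun h => h ▸ R.dlog_zero⟩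

/-- The recursion of the table is multiplication by γ: a + b γ + c γ² becomes 2 c + (a + c) γ + b γ²
because γ³ = γ + 2. -/
theorem ex_spec (i : ℕ) : D.IsCode (D.ex i) ∧ elt γ (D.ex i) = γ ^ i := by
  have hq := R.valid.q_le
  have hmod : ∀ i, D.ex (i % D.M) = D.ex i := fun i => by simp [ex]
  have hs : ∀ i, D.ex (i + 1) = D.ex (i % D.M + 1) := fun i => by simp [ex]
  have hc : ∀ i, D.IsCode (D.ex i) := fun i => by
    rw [← hmod]
    obtain ⟨h1, h2, h3, -⟩ := R.valid.ex_succ (i % D.M) (Nat.mod_lt _ R.M_pos)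
    exact ⟨h1, h2, h3⟩
  refine ⟨hc i, ?_⟩
  induction i with
  | zero => rw [R.valid.ex_zero]; simp [elt]
  | succ i ih =>
    obtain ⟨h1, h2, h3, h4⟩ := R.valid.ex_succ (i % D.M) (Nat.mod_lt _ R.M_pos)
    have l1 := Nat.mod_lt (2 * (D.ex i / 256)) (show 0 < D.q by omega)
    have l2 := Nat.mod_lt (D.ex i % 16 + D.ex i / 256) (show 0 < D.q by omega)
    rw [hs, h4, hmod, elt_mk γ (by omega) (by omega), R.cast_mod, R.cast_mod, pow_succ γ i, ← ih, elt]
    push_cast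
    linear_combination -((D.ex i / 256 : ℕ) : E) * R.cube

theorem isCode_ex (i : ℕ) : D.IsCode (D.ex i) := (R.ex_spec i).1

theorem elt_ex (i : ℕ) : elt γ (D.ex i) = γ ^ i := (R.ex_spec i).2

theorem lg_eq (n : ℕ) : D.lg n = D.dlog γ (elt γ n) := by
  have hq := R.valid.q_le
  have h1 := Nat.mod_lt (n % 16) (show 0 < D.q by omega)
  have h2 := Nat.mod_lt (n / 16 % 16) (show 0 < D.q by omega)
  have h3 := Nat.mod_lt (n / 256) (show 0 < D.q by omega)
  have key := R.valid.ex_lg _ h1 _ h2 _ h3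
  have he : elt γ (n % 16 % D.q + 16 * (n / 16 % 16 % D.q) + 256 * (n / 256 % D.q)) = elt γ n := by
    rw [elt_mk γ (by omega) (by omega), R.cast_mod, R.cast_mod, R.cast_mod, elt]
  have hlg : D.lg (n % 16 % D.q + 16 * (n / 16 % 16 % D.q) + 256 * (n / 256 % D.q)) = D.lg n := by
    have aux : ∀ a < D.q, ∀ b < D.q, ∀ c < D.q,
        D.lg (a + 16 * b + 256 * c) = field D.logT 7 (a + D.q * (b + D.q * c)) := by
      intro a ha b hb c hc
      rw [lg, show (a + 16 * b + 256 * c) % 16 = a by omega,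
        show (a + 16 * b + 256 * c) / 16 % 16 = b by omega,
        show (a + 16 * b + 256 * c) / 256 = c by omega, Nat.mod_eq_of_lt ha, Nat.mod_eq_of_lt hb,
        Nat.mod_eq_of_lt hc]
    rw [aux _ h1 _ h2 _ h3, lg]
  rw [hlg] at key
  rcases key with ⟨ha, hb, hc, h⟩ | ⟨hlt, h⟩
  · rw [h, ← he, ha, hb, hc]
    simp [R.dlog_zero]
  · rw [← he, ← h, R.elt_ex, R.dlog_pow, Nat.mod_eq_of_lt hlt]

theorem elt_add_code {m n : ℕ} (hm : D.IsCode m) (hn : D.IsCode n) :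
    elt γ (m + n) = elt γ m + elt γ n := by
  have := R.valid.q_le
  exact elt_add γ (by have := hm.1; have := hn.1; omega) (by have := hm.2.1; have := hn.2.1; omega)

theorem lg_add {m n : ℕ} (hm : D.IsCode m) (hn : D.IsCode n) :
    D.lg (m + n) = D.dlog γ (elt γ m + elt γ n) := by
  rw [R.lg_eq, R.elt_add_code hm hn]

theorem isCode_zero : D.IsCode 0 := by
  have := R.valid.q_le
  exact ⟨by omega, by omega, by omega⟩

theorem mulEx_spec (x y : E) (k : ℕ) : D.IsCode (D.mulEx (D.dlog γ x) (D.dlog γ y) k) ∧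
    elt γ (D.mulEx (D.dlog γ x) (D.dlog γ y) k) = x * y * γ ^ k := by
  rw [mulEx]
  split_ifs with h h'
  · rw [R.dlog_eq_M] at h
    exact ⟨R.isCode_zero, by simp [h]⟩
  · rw [R.dlog_eq_M] at h'
    exact ⟨R.isCode_zero, by simp [h']⟩
  · refine ⟨R.isCode_ex _, ?_⟩
    rw [R.dlog_eq_M] at h h'
    rw [R.elt_ex, pow_add, pow_add, R.pow_dlog h, R.pow_dlog h']

theorem pow_H : γ ^ D.H = -1 := by
  have h : γ ^ D.H * γ ^ D.H = 1 := by
    rw [← pow_add, ← two_mul, ← R.valid.H_eq, R.pow_M]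
  rcases mul_self_eq_one_iff.1 h with h | h
  · have h1 := Nat.le_of_dvd ?_ ((R.pow_eq_one _).1 h)
    · have := R.M_pos
      have := R.valid.H_eq
      omega
    · have := R.M_pos
      have := R.valid.H_eq
      omega
  · exact h

theorem pow_q_mul (i : ℕ) : γ ^ (D.q * i) = σ (γ ^ i) := by
  rw [R.map_eq, mul_comm, pow_mul]

theorem pow_q_sq_mul (i : ℕ) : γ ^ (D.q ^ 2 * i) = σ (σ (γ ^ i)) := by
  rw [R.map_eq, R.map_eq, ← pow_mul, ← pow_mul]
  congr 1
  ring

theorem tr_spec (i : ℕ) : D.tr i < D.q ∧ ((D.tr i : ℕ) : E) = traceForm σ (γ ^ i) ∧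
    (D.tr i = 0 → i % D.M ∈ D.ker) := by
  have hq := R.valid.q_le
  have hmod : ∀ i j : ℕ, D.ex (j * (i % D.M)) = D.ex (j * i) := fun i j => by
    simp [ex]
  have hmod' : ∀ i, D.ex (i % D.M) = D.ex i := fun i => by simp [ex]
  have htr : D.tr (i % D.M) = D.tr i := by rw [tr, tr, hmod, hmod, hmod']
  obtain ⟨h1, h2, h3⟩ := R.valid.tr_mod (i % D.M) (Nat.mod_lt _ R.M_pos)
  rw [htr] at h3
  rw [hmod, hmod, hmod'] at h1 h2
  refine ⟨Nat.mod_lt _ (by omega), ?_, h3⟩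
  have e : elt γ (D.ex i + D.ex (D.q * i) + D.ex (D.q ^ 2 * i)) = traceForm σ (γ ^ i) := by
    have c1 := R.isCode_ex i
    have c2 := R.isCode_ex (D.q * i)
    have c3 := R.isCode_ex (D.q ^ 2 * i)
    unfold IsCode at c1 c2 c3
    rw [elt_add γ (by omega) (by omega), elt_add γ (by omega) (by omega), R.elt_ex, R.elt_ex,
      R.elt_ex, R.pow_q_mul, R.pow_q_sq_mul, traceForm]
  rw [← e, elt, tr, R.cast_mod, ← R.cast_mod (_ / 16 % 16), h1, ← R.cast_mod (_ / 256), h2]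
  simp

theorem pow_N_mul (a : ℕ) : γ ^ (D.N * a) = algebraMap F E (2 ^ a) := by
  rw [pow_mul, R.pow_N, map_pow, map_ofNat (algebraMap F E) 2]

theorem pow_eq (k : ℕ) : γ ^ k = algebraMap F E (2 ^ (k / D.N)) * γ ^ (k % D.N) := by
  rw [← R.pow_N_mul, ← pow_add, add_comm, Nat.mod_add_div]

theorem two_ne_zero : (2 : F) ≠ 0 := by
  intro h
  have := R.pow_N
  rw [← map_ofNat (algebraMap F E) 2, show (OfNat.ofNat 2 : F) = 0 from h, map_zero] at this
  exact pow_ne_zero _ R.ne_zero this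

theorem N_pos : 0 < D.N := by
  rcases Nat.eq_zero_or_pos D.N with h | h
  · have h1 := R.valid.M_eq
    have h2 := R.M_pos
    rw [h, zero_mul] at h1
    omega
  · exact h

/-- Fixed by Frobenius means (q - 1) N ∣ i (q - 1). -/
theorem map_pow_eq_iff (i : ℕ) : σ (γ ^ i) = γ ^ i ↔ i % D.N = 0 := by
  have hq := R.valid.q_le
  rw [R.map_eq, ← pow_mul, R.pow_inj, ← Nat.dvd_iff_mod_eq_zero]
  have : i * D.q = i + i * (D.q - 1) := by
    conv_lhs => rw [show D.q = 1 + (D.q - 1) by omega]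
    ring
  rw [this, R.valid.M_eq]
  constructor
  · intro h
    have h2 := (Nat.modEq_iff_dvd' (by omega)).1 h.symm
    rw [Nat.add_sub_cancel_left] at h2
    exact Nat.dvd_of_mul_dvd_mul_right (by omega) h2
  · intro h
    refine ((Nat.modEq_iff_dvd' (by omega)).2 ?_).symm
    rw [Nat.add_sub_cancel_left]
    exact Nat.mul_dvd_mul_right h _

end Represents
end Represents
end SignTable

/-! ### The sign rule given by a table -/

namespace SignTable

section Represents
variable {F E : Type*} [Field F] [Field E] [Algebra F E]
namespace Represents
variable {D : SignTable} {γ : E} {σ : E →ₐ[F] E} (R : D.Represents γ σ)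
include R

theorem N_dvd_M : D.N ∣ D.M := ⟨_, R.valid.M_eq⟩

theorem dlog_mul {x y : E} (hx : x ≠ 0) (hy : y ≠ 0) :
    D.dlog γ (x * y) = (D.dlog γ x + D.dlog γ y) % D.M := by
  rw [← R.dlog_pow, pow_add, R.pow_dlog hx, R.pow_dlog hy]

theorem neg_one_pow_mod (n : ℕ) : (-1 : ℤ) ^ (n % D.M) = (-1) ^ n := by
  conv_rhs => rw [← Nat.mod_add_div n D.M, pow_add, pow_mul]
  rw [(show Even D.M by rw [R.valid.H_eq]; exact even_two_mul _).neg_one_pow, one_pow, mul_one]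

theorem dlog_algebraMap_mul_mod {c : F} (hc : c ≠ 0) (m : E) :
    D.dlog γ (algebraMap F E c * m) % D.N = D.dlog γ m % D.N := by
  by_cases hm : m = 0
  · rw [hm, mul_zero]
  · have hc' : algebraMap F E c ≠ 0 := by simpa using hc
    rw [R.dlog_mul hc' hm, Nat.mod_mod_of_dvd _ R.N_dvd_M, Nat.add_mod,
      (R.map_pow_eq_iff (D.dlog γ (algebraMap F E c))).1 (by rw [R.pow_dlog hc', AlgHom.commutes]),
      zero_add, Nat.mod_mod]

/-- σ(a) / a = a ^ (q - 1) has a logarithm divisible by q - 1; this gives the invariance required of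
Φ. -/
theorem dlog_map_div_mul_mod {a : E} (ha : a ≠ 0) (x : E) :
    D.dlog γ (σ a / a * x) % (D.q - 1) = D.dlog γ x % (D.q - 1) := by
  by_cases hx : x = 0
  · rw [hx, mul_zero]
  · obtain ⟨i, rfl⟩ := R.exists_pow a ha
    have hq := R.valid.q_le
    have h : σ (γ ^ i) / γ ^ i = γ ^ (i * (D.q - 1)) := by
      rw [div_eq_iff ha, ← pow_add, R.map_eq, ← pow_mul]
      congr 1
      rw [← Nat.mul_succ]
      congr 1
      omega
    have hd : D.q - 1 ∣ D.M := by rw [R.valid.M_eq]; exact Dvd.intro_left _ rfl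
    rw [h, R.dlog_mul (pow_ne_zero _ R.ne_zero) hx, R.dlog_pow, Nat.mod_mod_of_dvd _ hd, Nat.add_mod,
      Nat.mod_mod_of_dvd _ hd, Nat.mul_mod_left, zero_add, Nat.mod_mod]

open Classical in
/-- The rule attaching signs to `3`-subspaces that is given by the table. -/
noncomputable def signRule : SignRule σ (2 : E) where
  χ :=
    { toFun x := if x = 0 then 0 else (-1) ^ D.dlog γ x
      map_zero' := by simp
      map_one' := by
        rw [if_neg one_ne_zero, ← pow_zero γ, R.dlog_pow, Nat.zero_mod, pow_zero]
      map_mul' x y := by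
        by_cases hx : x = 0
        · simp [hx]
        by_cases hy : y = 0
        · simp [hy]
        rw [if_neg hx, if_neg hy, if_neg (mul_ne_zero hx hy), R.dlog_mul hx hy, R.neg_one_pow_mod,
          pow_add] }
  χ_sign x hx := by
    simp only [MonoidWithZeroHom.coe_mk, ZeroHom.coe_mk, if_neg hx]
    exact neg_one_pow_eq_or ℤ _
  -- Rows are indexed by the class of k.im modulo the elements σ(a) / a, columns by k.re / k.im,
  -- which such elements do not change; the last column M is for quotient 0.
  Φ k := (-1) ^ field D.sgn 1 (D.dlog γ k.im % (D.q - 1) * (D.M + 1) + D.dlog γ (k.re / k.im))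
  Φ_sign k := neg_one_pow_eq_or ℤ _
  Φ_smul a ha k := by
    have ha' : σ a / a ≠ 0 := div_ne_zero ((map_ne_zero_iff σ (σ : E →+* E).injective).2 ha) ha
    simp only [QuadraticAlgebra.im_smul, QuadraticAlgebra.re_smul, smul_eq_mul,
      R.dlog_map_div_mul_mod ha, mul_div_mul_left _ _ ha']
  φ m u := (-1) ^ if u = 0 then field D.sgn₀ 1 (D.dlog γ m % D.N)
    else field D.sgn₁ 1 (D.dlog γ (m / u))
  φ_sign m u := neg_one_pow_eq_or ℤ _
  φ_smul c hc m u := by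
    have hc' : algebraMap F E c ≠ 0 := by simpa using hc
    simp only [mul_eq_zero, hc', false_or, R.dlog_algebraMap_mul_mod hc, mul_div_mul_left _ _ hc']

theorem χ_apply {x : E} (hx : x ≠ 0) : R.signRule.χ x = (-1) ^ D.dlog γ x := if_neg hx

theorem Φ_apply (k : QuadraticAlgebra E 2 0) : R.signRule.Φ k = (-1) ^
    field D.sgn 1 (D.dlog γ k.im % (D.q - 1) * (D.M + 1) + D.dlog γ (k.re / k.im)) := rfl

theorem φ_zero (m : E) : R.signRule.φ m 0 = (-1) ^ field D.sgn₀ 1 (D.dlog γ m % D.N) := by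
  simp [signRule]

theorem φ_apply (m : E) {u : E} (hu : u ≠ 0) :
    R.signRule.φ m u = (-1) ^ field D.sgn₁ 1 (D.dlog γ (m / u)) := by
  simp [signRule, hu]

theorem elt_of_lt {u : ℕ} (hu : u < D.q) : elt γ u = u := by
  have := R.valid.q_le
  have := elt_mk γ (a := u) (b := 0) (c := 0) (by omega) (by omega)
  simpa using this

theorem natCast_ne_zero {u : ℕ} (hu : u < D.q) (hu0 : u ≠ 0) : (u : E) ≠ 0 := by
  have hq := R.valid.q_le
  rw [← R.elt_of_lt hu, Ne, ← R.dlog_eq_M, ← R.lg_eq]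
  rcases R.valid.ex_lg u hu 0 (by omega) 0 (by omega) with h | h
  · exact absurd h.1 hu0
  · simpa using h.1.ne

theorem φ_pow (m : ℕ) {u : ℕ} (hu : u < D.q) :
    R.signRule.φ (γ ^ m) u = (-1) ^ D.phiBit m u := by
  rw [phiBit]
  split_ifs with h
  · rw [h, Nat.cast_zero, φ_zero, R.dlog_pow, Nat.mod_mod_of_dvd _ R.N_dvd_M]
  · have h0 := R.natCast_ne_zero hu h
    have hlg : D.lg u = D.dlog γ (u : E) := by rw [R.lg_eq, R.elt_of_lt hu]
    rw [R.φ_apply _ h0, hlg, ← R.dlog_pow, R.pow_sub ((R.dlog_le _).trans (by omega)),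
      R.pow_dlog h0]

theorem φ_trace (m : ℕ) {y : E} (k : ℕ) (k' : ℕ) (hk : y ≠ 0 → γ ^ k' = y * γ ^ k) :
    R.signRule.φ (γ ^ m) (traceForm σ (y * γ ^ k)) =
      (-1) ^ D.phiBit m (if D.dlog γ y = D.M then 0 else D.tr k') := by
  have hq := R.valid.q_le
  split_ifs with h
  · rw [R.dlog_eq_M.1 h, ← R.φ_pow m (by omega)]
    simp [traceForm]
  · rw [R.dlog_eq_M] at h
    rw [← R.φ_pow m (R.tr_spec _).1, (R.tr_spec _).2.1, hk h]

variable [Fact (∀ r : E, r ^ 2 ≠ 2 + 0 * r)]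

local notation "K" => QuadraticAlgebra E 2 0

theorem normLog_eq (ld : ℕ) (y : E) :
    D.normLog ld (D.dlog γ y) = D.dlog γ (y * y - 2 * (γ ^ ld * γ ^ ld)) := by
  obtain ⟨h1, h2⟩ := R.mulEx_spec y y 0
  rw [normLog, R.lg_add h1 (R.isCode_ex _), h2, R.elt_ex]
  congr 1
  rw [pow_add, pow_add, R.pow_N, R.pow_H, two_mul, pow_add]
  ring

theorem clubBit_spec {b : K} {ld e nt j : ℕ} (he : D.IsCode e) (hnt : D.IsCode nt) {t : E}
    (ht : elt γ nt = -t) (hre : b.re = elt γ e) (him : b.im = γ ^ ld) :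
    R.signRule.χ ((b.re - t) * (b.re - t) - 2 * (b.im * b.im)) *
      R.signRule.φ (b.im * σ (γ ^ j) / ((b.re - t) * (b.re - t) - 2 * (b.im * b.im)))
        (-traceForm σ (σ (γ ^ j) * (b.re - t) / ((b.re - t) * (b.re - t) - 2 * (b.im * b.im)))) =
      (-1) ^ D.clubBit ld e nt j := by
  have hd : b.im ≠ 0 := him ▸ pow_ne_zero _ R.ne_zero
  have hQ := SignRule.sq_sub_ne_zero (δ := (2 : E)) (y := b.re - t) hd
  rw [clubBit]
  have hlg : D.lg (e + nt) = D.dlog γ (b.re - t) := by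
    rw [R.lg_add he hnt, ht, hre, sub_eq_add_neg]
  rw [hlg, R.normLog_eq, ← him]
  generalize hy : b.re - t = y at *
  generalize hQ' : y * y - 2 * (b.im * b.im) = Q at *
  rw [R.χ_apply hQ, pow_add]
  congr 1
  have hl := R.dlog_le Q
  have e1 : b.im * σ (γ ^ j) / Q = γ ^ (ld + D.q * j + D.M - D.dlog γ Q) := by
    rw [R.pow_sub (by omega), pow_add, R.pow_q_mul, R.pow_dlog hQ, him]
  have e2 : -traceForm σ (σ (γ ^ j) * y / Q) =
      traceForm σ (y * γ ^ (D.q * j + D.H + D.M - D.dlog γ Q)) := by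
    rw [R.pow_sub (by omega), pow_add, R.pow_q_mul, R.pow_dlog hQ, R.pow_H]
    simp only [traceForm, map_mul, map_div₀, map_neg, map_one]
    ring
  rw [e1, e2, R.φ_trace _ _ (D.q * j + D.dlog γ y + D.H + D.M - D.dlog γ Q)]
  intro hy0
  rw [R.pow_sub (by omega), R.pow_sub (by omega), pow_add, pow_add, pow_add, R.pow_dlog hy0]
  ring

theorem inftyBit_spec {b : K} {ld e i : ℕ} (hre : b.re = elt γ e)
    (him : b.im = γ ^ ld) : R.signRule.planeSign b (γ ^ i) 0 = (-1) ^ D.inftyBit ld e i := by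
  rw [SignRule.planeSign, if_pos rfl, if_neg (pow_ne_zero _ R.ne_zero), inftyBit]
  rw [R.lg_eq, ← hre, ← R.φ_trace (ld + D.q * i) (D.q * i) (D.q * i + D.dlog γ b.re), pow_add,
    R.pow_q_mul, him, mul_comm b.re]
  intro h
  rw [pow_add, R.pow_dlog h, mul_comm]

theorem clubBit_zero_spec {b : K} {ld e j : ℕ} (he : D.IsCode e) (hre : b.re = elt γ e)
    (him : b.im = γ ^ ld) : R.signRule.planeSign b 0 (γ ^ j) = (-1) ^ D.clubBit ld e 0 j := by
  rw [SignRule.planeSign, if_neg (pow_ne_zero _ R.ne_zero),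
    ← R.clubBit_spec he R.isCode_zero (t := 0) (by simp) hre him]
  simp

theorem scatBit_spec {b : K} {ld e lt : ℕ} (hld : ld ≤ D.M) (he : D.IsCode e) (hre : b.re = elt γ e)
    (him : b.im = γ ^ ld) {t : E} (ht : t = γ ^ lt) (hσt : σ t ≠ t) :
    R.signRule.χ ((b.re - t) * (b.re - t) - 2 * (b.im * b.im)) *
      R.signRule.Φ ((b - QuadraticAlgebra.C (σ (σ t))) / (QuadraticAlgebra.C t - b)) =
      (-1) ^ D.scatBit ld e lt := by
  have hd : b.im ≠ 0 := him ▸ pow_ne_zero _ R.ne_zero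
  have hQ := SignRule.sq_sub_ne_zero (δ := (2 : E)) (y := b.re - t) hd
  rw [scatBit]
  have hz : γ ^ (D.q ^ 2 * lt) = σ (σ t) := by rw [R.pow_q_sq_mul, ht]
  have hneg : ∀ k, elt γ (D.ex (k + D.H)) = -γ ^ k := fun k => by
    rw [R.elt_ex, pow_add, R.pow_H]; ring
  have h1 : D.lg (e + D.ex (D.q ^ 2 * lt + D.H)) = D.dlog γ (b.re - σ (σ t)) := by
    rw [R.lg_add he (R.isCode_ex _), hneg, hz, hre, sub_eq_add_neg]
  have h2 : D.lg (e + D.ex (lt + D.H)) = D.dlog γ (b.re - t) := by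
    rw [R.lg_add he (R.isCode_ex _), hneg, ht, hre, sub_eq_add_neg]
  have h3 : D.lg (D.ex lt + D.ex (D.q ^ 2 * lt + D.H)) = D.dlog γ (t - σ (σ t)) := by
    rw [R.lg_add (R.isCode_ex _) (R.isCode_ex _), hneg, hz, R.elt_ex, ← ht, sub_eq_add_neg]
  have h4 : D.lg (D.ex (2 * ld + D.N) + D.mulEx (D.dlog γ (b.re - σ (σ t))) (D.dlog γ (b.re - t)) D.H)
      = D.dlog γ (2 * (b.im * b.im) - (b.re - σ (σ t)) * (b.re - t)) := by
    obtain ⟨m1, m2⟩ := R.mulEx_spec (b.re - σ (σ t)) (b.re - t) D.H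
    rw [R.lg_add (R.isCode_ex _) m1, m2, R.elt_ex, R.pow_H, pow_add, R.pow_N, two_mul, pow_add, him]
    congr 1
    ring
  rw [h1, h2, h3, h4, R.normLog_eq, ← him, R.χ_apply hQ, pow_add, Φ_apply]
  have hζ : t - σ (σ t) ≠ 0 := by
    intro h0
    apply hσt
    conv_lhs => rw [sub_eq_zero.1 h0, R.frob.cube]
  generalize hzz : σ (σ t) = z at *
  generalize hQ' : (b.re - t) * (b.re - t) - 2 * (b.im * b.im) = Q at *
  -- Multiplying numerator and denominator by the conjugate of t - b makes the denominator Q up to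
  -- sign; this exhibits the row and column read by `scatBit`.
  have hk : (b - QuadraticAlgebra.C z) / (QuadraticAlgebra.C t - b) =
      ⟨(2 * (b.im * b.im) - (b.re - z) * (b.re - t)) / Q, b.im * (t - z) / Q⟩ := by
    have hne : QuadraticAlgebra.C t - b ≠ 0 := by
      intro h0
      have := congrArg QuadraticAlgebra.im h0
      simp at this
      exact hd this
    rw [div_eq_iff hne]
    ext
    · simp
      field_simp
      rw [← hQ']
      ring
    · simp
      field_simp
      rw [← hQ']
      ring
  rw [hk]
  dsimp only
  have hl := R.dlog_le Q
  have hlζ := R.dlog_lt hζ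
  have e1 : D.dlog γ (b.im * (t - z) / Q) % (D.q - 1) =
      (ld + D.dlog γ (t - z) + D.M - D.dlog γ Q) % (D.q - 1) := by
    have : b.im * (t - z) / Q = γ ^ (ld + D.dlog γ (t - z) + D.M - D.dlog γ Q) := by
      rw [R.pow_sub (by omega), pow_add, R.pow_dlog hζ, R.pow_dlog hQ, him]
    rw [this, R.dlog_pow, Nat.mod_mod_of_dvd]
    rw [R.valid.M_eq]
    exact Dvd.intro_left _ rfl
  have e2 : (2 * (b.im * b.im) - (b.re - z) * (b.re - t)) / Q / (b.im * (t - z) / Q) =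
      (2 * (b.im * b.im) - (b.re - z) * (b.re - t)) / (b.im * (t - z)) := by
    field_simp
  rw [e1, e2]
  congr 4
  generalize 2 * (b.im * b.im) - (b.re - z) * (b.re - t) = w
  split_ifs with hw
  · rw [R.dlog_eq_M.1 hw, zero_div, R.dlog_zero]
  · have hl := R.dlog_le w
    rw [← R.dlog_pow, show D.dlog γ w + D.M + D.M - ld - D.dlog γ (t - z) =
      D.dlog γ w + D.M - ld + D.M - D.dlog γ (t - z) by omega, R.pow_sub (by omega),
      R.pow_sub (by omega), R.pow_dlog (mt R.dlog_eq_M.2 hw), R.pow_dlog hζ, him, div_div]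

theorem pairBit_spec {b : K} {ld e i j : ℕ} (hld : ld ≤ D.M) (hj : j < D.M) (he : D.IsCode e)
    (hre : b.re = elt γ e) (him : b.im = γ ^ ld) :
    R.signRule.planeSign b (γ ^ i) (γ ^ j) = (-1) ^ D.pairBit ld e i j := by
  have ht' : -γ ^ i / γ ^ j = γ ^ ((i + D.M + D.H - j) % D.M) := by
    rw [R.pow_mod, add_right_comm, R.pow_sub (by omega), pow_add, R.pow_H, mul_neg_one]
  rw [SignRule.planeSign, if_neg (pow_ne_zero _ R.ne_zero), pairBit]
  dsimp only
  generalize -γ ^ i / γ ^ j = t at *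
  by_cases h : (i + D.M + D.H - j) % D.M % D.N = 0
  · have hσ : σ t = t := by rw [ht', R.map_pow_eq_iff, h]
    rw [if_pos h, if_pos hσ]
    refine R.clubBit_spec he (R.isCode_ex _) ?_ hre him
    rw [R.elt_ex, pow_add, R.pow_H, mul_neg_one, ht']
  · have hσ : σ t ≠ t := by rwa [ht', Ne, R.map_pow_eq_iff]
    rw [if_neg h, if_neg hσ]
    exact R.scatBit_spec hld he hre him ht' hσ

end Represents
end Represents
end SignTable

/-! ### Trace-zero elements and planes inside E -/

namespace SignTable

theorem field_one_le (T i : ℕ) : field T 1 i ≤ 1 := by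
  have := Nat.mod_lt (T >>> (1 * i)) (show 0 < 2 ^ 1 by norm_num)
  unfold field
  omega

theorem sum_neg_one_pow (l : List ℕ) (f : ℕ → ℕ) :
    (l.map fun i => (-1 : ℤ) ^ f i).sum = l.length - 2 * sumBits l f := by
  induction l with
  | nil => simp [sumBits]
  | cons a l ih =>
    have : (-1 : ℤ) ^ f a = 1 - 2 * (f a % 2 : ℕ) := by
      rw [neg_one_pow_eq_pow_mod_two]
      rcases Nat.mod_two_eq_zero_or_one (f a) with h | h <;> simp [h]
    rw [List.map_cons, List.sum_cons, ih, this, sumBits, sumBits, List.map_cons, List.sum_cons,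
      List.length_cons]
    push_cast
    ring

section Represents
variable {F E : Type*} [Field F] [Field E] [Algebra F E]
namespace Represents
variable {D : SignTable} {γ : E} {σ : E →ₐ[F] E} (R : D.Represents γ σ)
variable [Fintype E] [DecidableEq E]
include R

theorem sum_ne_zero (h : E → ℤ) :
    ∑ m, (if m = 0 then 0 else h m) = ∑ i ∈ Finset.range D.M, h (γ ^ i) := by
  have e : (Finset.univ : Finset E) = insert 0 ((Finset.range D.M).image fun i => γ ^ i) := by
    symm
    rw [Finset.eq_univ_iff_forall]
    intro x
    by_cases hx : x = 0
    · simp [hx]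
    · obtain ⟨i, hi, rfl⟩ := R.exists_lt x hx
      exact Finset.mem_insert_of_mem (Finset.mem_image_of_mem _ (Finset.mem_range.2 hi))
  rw [e, Finset.sum_insert, if_pos rfl, zero_add, Finset.sum_image]
  · exact Finset.sum_congr rfl fun i _ => if_neg (pow_ne_zero _ R.ne_zero)
  · intro i hi j hj hij
    have := R.pow_inj.1 hij
    rw [Finset.coe_range, Set.mem_Iio] at hi hj
    rwa [Nat.ModEq, Nat.mod_eq_of_lt hi, Nat.mod_eq_of_lt hj] at this
  · simp [R.ne_zero]

theorem finite_F : Finite F := by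
  have := R.valid.q_le
  exact Nat.finite_of_card_ne_zero (by rw [R.card_F]; omega)

theorem card_fiber (b : E) (hb : b ∈ Finset.univ.image fun x => σ x - x) :
    (Finset.univ.filter fun x => σ x - x = b).card = D.q := by
  obtain ⟨a, -, rfl⟩ := Finset.mem_image.1 hb
  have := R.finite_F
  have := Fintype.ofFinite F
  have e : (Finset.univ.filter fun x => σ x - x = σ a - a) =
      Finset.univ.image fun c : F => a + algebraMap F E c := by
    ext x
    simp only [Finset.mem_filter, Finset.mem_univ, true_and, Finset.mem_image]
    constructor
    · intro h
      obtain ⟨c, hc⟩ := R.frob.fixed (x - a) (by rw [map_sub]; linear_combination h)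
      exact ⟨c, by rw [hc]; ring⟩
    · rintro ⟨c, rfl⟩
      rw [map_add, AlgHom.commutes]
      ring
  rw [e, Finset.card_image_of_injective, Finset.card_univ, ← Nat.card_eq_fintype_card, R.card_F]
  intro c c' h
  exact (algebraMap F E).injective (add_left_cancel h)

theorem ker_map_nodup : (D.ker.map fun j => γ ^ j).Nodup := by
  refine List.Nodup.map_on ?_ R.valid.ker_nodup
  intro i hi j hj hij
  have := R.pow_inj.1 hij
  rwa [Nat.ModEq, Nat.mod_eq_of_lt (R.valid.ker_lt i hi), Nat.mod_eq_of_lt (R.valid.ker_lt j hj)]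
    at this

theorem card_image : (Finset.univ.image fun x => σ x - x).card = D.q ^ 2 := by
  have hq := R.valid.q_le
  have h := Finset.card_eq_sum_card_image (fun x => σ x - x) (Finset.univ : Finset E)
  rw [Finset.sum_congr rfl R.card_fiber, Finset.sum_const, Finset.card_univ,
    ← Nat.card_eq_fintype_card, R.card_E, smul_eq_mul, pow_succ] at h
  exact (Nat.eq_of_mul_eq_mul_right (by omega) h).symm

theorem image_subset : (Finset.univ.image fun x => σ x - x) ⊆
    Finset.univ.filter fun x => traceForm σ x = 0 := by
  intro x hx
  obtain ⟨a, -, rfl⟩ := Finset.mem_image.1 hx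
  refine Finset.mem_filter.2 ⟨Finset.mem_univ _, ?_⟩
  simp only [traceForm, map_sub, R.frob.cube]
  ring

theorem filter_subset : (Finset.univ.filter fun x => traceForm σ x = 0) ⊆
    insert 0 (D.ker.map fun j => γ ^ j).toFinset := by
  intro x hx
  simp only [Finset.mem_filter, Finset.mem_univ, true_and] at hx
  by_cases h0 : x = 0
  · simp [h0]
  · obtain ⟨i, hi, rfl⟩ := R.exists_lt x h0
    obtain ⟨h1, h2, h3⟩ := R.tr_spec i
    rw [hx] at h2
    have h4 : D.tr i = 0 := by
      by_contra h
      exact R.natCast_ne_zero h1 h h2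
    have := h3 h4
    rw [Nat.mod_eq_of_lt hi] at this
    refine Finset.mem_insert_of_mem ?_
    rw [List.mem_toFinset, List.mem_map]
    exact ⟨i, this, rfl⟩

theorem card_insert : (insert 0 (D.ker.map fun j => γ ^ j).toFinset).card = D.q ^ 2 := by
  rw [Finset.card_insert_of_notMem, List.toFinset_card_of_nodup R.ker_map_nodup, List.length_map,
    R.valid.ker_length]
  simp [R.ne_zero]

/-- A squeeze: {σ x - x} ⊆ {tr = 0} ⊆ {0} ∪ γ ^ `ker`. The outer sets both have q² elements, the
first because the fibres of x ↦ σ x - x are cosets of F. -/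
theorem image_eq : (Finset.univ.image fun x => σ x - x) =
    insert 0 (D.ker.map fun j => γ ^ j).toFinset :=
  Finset.eq_of_subset_of_card_le (R.image_subset.trans R.filter_subset)
    (by rw [R.card_image, R.card_insert])

theorem card_filter : (Finset.univ.filter fun x => traceForm σ x = 0).card = D.q ^ 2 :=
  le_antisymm (R.card_insert ▸ Finset.card_le_card R.filter_subset)
    (R.card_image ▸ Finset.card_le_card R.image_subset)

theorem sum_map_sub (g : E → ℤ) :
    ∑ x, g (σ x - x) = D.q * (g 0 + (D.ker.map fun j => g (γ ^ j)).sum) := by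
  rw [Finset.sum_comp, Finset.sum_congr rfl fun b hb => by rw [R.card_fiber b hb],
    ← Finset.smul_sum, R.image_eq, Finset.sum_insert, List.sum_toFinset _ R.ker_map_nodup,
    List.map_map]
  · simp [Function.comp_def]
  · simp [R.ne_zero]

theorem sum_ker_mul {c : F} (hc : c ≠ 0) (g : E → ℤ) :
    (D.ker.map fun j => g (algebraMap F E c * γ ^ j)).sum = (D.ker.map fun j => g (γ ^ j)).sum := by
  have hq := R.valid.q_le
  have hc' : algebraMap F E c ≠ 0 := by simpa using hc
  have h1 := R.sum_map_sub g
  have h2 := R.sum_map_sub fun x => g (algebraMap F E c * x)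
  have h3 : ∑ x, g (algebraMap F E c * (σ x - x)) = ∑ x, g (σ x - x) := by
    refine Eq.trans ?_ (Equiv.sum_comp (Equiv.mulLeft₀ _ hc') _)
    refine Finset.sum_congr rfl fun x _ => ?_
    change _ = g (σ (algebraMap F E c * x) - algebraMap F E c * x)
    rw [map_mul, AlgHom.commutes, mul_sub]
  rw [h3, h1, mul_zero] at h2
  have := mul_left_cancel₀ (by exact_mod_cast (show D.q ≠ 0 by omega)) h2
  linarith

theorem sum_ker_eq (g : E → ℤ) (hg : ∀ c : F, c ≠ 0 → ∀ x, g (algebraMap F E c * x) = g x) :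
    (D.ker.map fun j => g (γ ^ j)).sum = (D.q - 1) * (D.pts.map fun j => g (γ ^ j)).sum := by
  have hq := R.valid.q_le
  rw [R.valid.ker_eq, List.map_flatMap, List.flatMap_def, List.sum_flatten, List.map_map]
  have : ∀ a, (List.map (fun j => g (γ ^ j)) (D.pts.map (· + a * D.N))).sum =
      (D.pts.map fun j => g (γ ^ j)).sum := by
    intro a
    rw [List.map_map]
    congr 1
    refine List.map_congr_left fun j _ => ?_
    rw [Function.comp_apply, add_comm, mul_comm, pow_add, R.pow_N_mul,
      hg _ (pow_ne_zero _ R.two_ne_zero)]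
  simp only [Function.comp_def, this]
  simp
  rw [Nat.cast_sub (by omega)]
  simp

theorem sum_φ_zero : ∑ m, (if m = 0 then 0 else R.signRule.φ m 0) =
    (D.q - 1) * ∑ i ∈ Finset.range D.N, (-1) ^ field D.sgn₀ 1 i := by
  have hq := R.valid.q_le
  have key : ∀ k, ∑ i ∈ Finset.range (D.N * k), (-1 : ℤ) ^ field D.sgn₀ 1 (i % D.N) =
      k * ∑ i ∈ Finset.range D.N, (-1) ^ field D.sgn₀ 1 i := by
    intro k
    induction k with
    | zero => simp
    | succ k ih =>
      rw [Nat.mul_succ, Finset.sum_range_add, ih]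
      have : ∑ x ∈ Finset.range D.N, (-1 : ℤ) ^ field D.sgn₀ 1 ((D.N * k + x) % D.N) =
          ∑ x ∈ Finset.range D.N, (-1 : ℤ) ^ field D.sgn₀ 1 x :=
        Finset.sum_congr rfl fun x hx => by
          rw [Nat.mul_add_mod, Nat.mod_eq_of_lt (Finset.mem_range.1 hx)]
      rw [this]
      push_cast
      ring
  have := key (D.q - 1)
  rw [← R.valid.M_eq, Nat.cast_sub (by omega), Nat.cast_one] at this
  rw [R.sum_ne_zero, ← this]
  refine Finset.sum_congr rfl fun i _ => ?_
  rw [R.φ_zero, R.dlog_pow, Nat.mod_mod_of_dvd _ R.N_dvd_M]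

theorem sum_φ {u : E} (hu : u ≠ 0) : ∑ m, (if m = 0 then 0 else R.signRule.φ m u) =
    ∑ i ∈ Finset.range D.M, (-1) ^ field D.sgn₁ 1 i := by
  rw [← Equiv.sum_comp (Equiv.mulRight₀ u hu)]
  have : ∀ m, (if (Equiv.mulRight₀ u hu) m = 0 then 0 else
      R.signRule.φ ((Equiv.mulRight₀ u hu) m) u) =
      if m = 0 then 0 else (-1) ^ field D.sgn₁ 1 (D.dlog γ m) := by
    intro m
    change (if m * u = 0 then 0 else R.signRule.φ (m * u) u) = _
    simp only [mul_eq_zero, hu, or_false, R.φ_apply _ hu, mul_div_cancel_right₀ _ hu]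
  simp only [this]
  rw [R.sum_ne_zero]
  refine Finset.sum_congr rfl fun i hi => ?_
  rw [R.dlog_pow, Nat.mod_eq_of_lt (Finset.mem_range.1 hi)]

/-- For fixed c, the sum over m ≠ 0 depends only on whether tr c = 0, which holds for q² of the q³
elements. Since N (q - 1) = M, everything is a multiple of q³ - q², with cofactor zero by `sum_sgn`.
-/
theorem sum_φ_trace : ∑ m : E, (if m = 0 then R.signRule.φ 0 1 * (Nat.card E - Nat.card F ^ 2) else
    ∑ c, R.signRule.φ m (traceForm σ c)) = 0 := by
  have hq := R.valid.q_le
  have h1 : ∀ m : E, (if m = 0 then R.signRule.φ 0 1 * ((Nat.card E : ℤ) - Nat.card F ^ 2) else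
      ∑ c, R.signRule.φ m (traceForm σ c)) =
      (if m = 0 then R.signRule.φ 0 1 * ((Nat.card E : ℤ) - Nat.card F ^ 2) else 0) +
      ∑ c, if m = 0 then 0 else R.signRule.φ m (traceForm σ c) := by
    intro m
    split_ifs <;> simp
  have h2 : ∀ c, ∑ m, (if m = 0 then 0 else R.signRule.φ m (traceForm σ c)) =
      if traceForm σ c = 0 then (D.q - 1) * ∑ i ∈ Finset.range D.N, (-1 : ℤ) ^ field D.sgn₀ 1 i else
        ∑ i ∈ Finset.range D.M, (-1 : ℤ) ^ field D.sgn₁ 1 i := by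
    intro c
    split_ifs with h
    · rw [h, R.sum_φ_zero]
    · rw [R.sum_φ h]
  have h3 : R.signRule.φ 0 1 = -1 := by
    rw [R.φ_apply _ one_ne_zero, zero_div, R.dlog_zero, R.valid.sgn₁_M, pow_one]
  have h4 : (Finset.univ.filter fun x => ¬ traceForm σ x = 0).card + D.q ^ 2 = D.q ^ 3 := by
    rw [← R.card_filter, ← R.card_E, Nat.card_eq_fintype_card, ← Finset.card_univ, add_comm]
    exact Finset.card_filter_add_card_filter_not _
  have h5 : ∀ T n, ∑ i ∈ Finset.range n, (-1 : ℤ) ^ field T 1 i =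
      n - 2 * ((List.range n).map (field T 1)).sum := by
    intro T n
    have := sum_neg_one_pow (List.range n) (field T 1)
    rw [List.length_range, sumBits, List.map_congr_left (g := field T 1) fun i _ =>
      Nat.mod_eq_of_lt (Nat.lt_succ_of_le (field_one_le T i))] at this
    rw [← this]
    rfl
  have h6 := R.valid.sum_sgn
  simp only [h1]
  rw [Finset.sum_add_distrib, Finset.sum_comm]
  simp only [h2]
  rw [Finset.sum_ite_eq' , if_pos (Finset.mem_univ _), Finset.sum_ite, Finset.sum_const,
    Finset.sum_const, R.card_filter, h3, R.card_E, R.card_F, h5, h5, nsmul_eq_mul, nsmul_eq_mul]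
  generalize ((List.range D.N).map (field D.sgn₀ 1)).sum = A,
    ((List.range D.M).map (field D.sgn₁ 1)).sum = B at h6 ⊢
  zify at h4 h6
  push_cast at *
  generalize (Finset.card (Finset.univ.filter fun x => ¬ traceForm σ x = 0) : ℤ) = z at *
  linear_combination (D.M - 2 * B : ℤ) * h4 -
    (D.q ^ 2 * (D.q - 1) : ℤ) * h6

end Represents
end Represents
end SignTable

/-! ### Planes outside E -/

namespace SignRule

variable {F E : Type*} [Field F] [Field E] [Algebra F E] {σ : E →ₐ[F] E} {δ : E}

theorem planeSign_mul (P : SignRule σ δ) {c : F} (hc : c ≠ 0) (b : QuadraticAlgebra E δ 0)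
    (X Y : E) : P.planeSign b (algebraMap F E c * X) (algebraMap F E c * Y) =
      P.planeSign b X Y := by
  have hc' : algebraMap F E c ≠ 0 := by simpa using hc
  have h1 : ∀ d Q, d * (algebraMap F E c * σ Y) / Q = algebraMap F E c * (d * σ Y / Q) := by
    intros; ring
  have h2 : ∀ y Q, -traceForm σ (algebraMap F E c * σ Y * y / Q) =
      algebraMap F E c * -traceForm σ (σ Y * y / Q) := by
    intro y Q
    rw [mul_assoc, mul_div_assoc, traceForm_algebraMap_mul, mul_neg]
  have h3 : -(algebraMap F E c * X) / (algebraMap F E c * Y) = -X / Y := by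
    rw [← mul_neg, mul_div_mul_left _ _ hc']
  by_cases hY : Y = 0
  · by_cases hX : X = 0
    · rw [hX, hY, mul_zero]
    · rw [planeSign, planeSign, hY, mul_zero, if_pos rfl, if_pos rfl, if_neg hX,
        if_neg (mul_ne_zero hc' hX), map_mul, AlgHom.commutes, mul_left_comm, mul_assoc,
        traceForm_algebraMap_mul, P.φ_smul c hc]
  · rw [planeSign, planeSign, if_neg hY, if_neg (mul_ne_zero hc' hY), h3, map_mul, AlgHom.commutes]
    simp only [h1, h2, P.φ_smul c hc]

end SignRule

namespace SignTable
section Represents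
variable {F E : Type*} [Field F] [Field E] [Algebra F E]
namespace Represents
variable {D : SignTable} {γ : E} {σ : E →ₐ[F] E} (R : D.Represents γ σ)
include R

/-- 2 = γ ^ N is not a square, because N is odd and the order M of γ is even. -/
theorem fact : Fact (∀ r : E, r ^ 2 ≠ 2 + 0 * r) := by
  refine ⟨fun r h => ?_⟩
  rw [zero_mul, add_zero] at h
  by_cases hr : r = 0
  · rw [hr, zero_pow _root_.two_ne_zero, ← R.pow_N] at h
    exact pow_ne_zero _ R.ne_zero h.symm
  · obtain ⟨i, rfl⟩ := R.exists_pow r hr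
    rw [← R.pow_N, ← pow_mul, R.pow_inj] at h
    have h1 : i * 2 ≡ D.N [MOD 2] := h.of_dvd ⟨_, R.valid.H_eq⟩
    have h2 := R.valid.N_odd
    rw [Nat.ModEq, h2] at h1
    omega

local notation "K" => QuadraticAlgebra E 2 0

variable [Fact (∀ r : E, r ^ 2 ≠ 2 + 0 * r)] [Fintype E] [DecidableEq E]
  [FiniteDimensional F (QuadraticAlgebra E (2 : E) 0)]

/-- Each of X = σ x - x and Y = σ y - y is hit q times, and `planeSign` is invariant under scaling
(X, Y) by F*; hence the factor q² (q - 1). -/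
theorem pencilSum_eq_lineSum {b : K} {ld e : ℕ} (hld : ld ≤ D.M) (he : D.IsCode e)
    (hre : b.re = elt γ e) (him : b.im = γ ^ ld) :
    R.signRule.pencilSum (Submodule.span F {1, b}) =
      D.q ^ 2 * (D.q - 1) * (D.pts.length * (D.ker.length + 2) - 2 * D.lineSum ld e : ℤ) := by
  have hd : b.im ≠ 0 := him ▸ pow_ne_zero _ R.ne_zero
  rw [SignRule.pencilSum_eq_sum R.frob hd]
  have h1 : ∀ X, ∑ y, R.signRule.planeSign b X (σ y - y) = D.q * (R.signRule.planeSign b X 0 +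
      (D.ker.map fun j => R.signRule.planeSign b X (γ ^ j)).sum) := fun X => R.sum_map_sub _
  simp only [h1]
  rw [← Finset.mul_sum, R.sum_map_sub fun X => R.signRule.planeSign b X 0 +
    (D.ker.map fun j => R.signRule.planeSign b X (γ ^ j)).sum]
  have h0 : R.signRule.planeSign b 0 0 = 0 := by simp [SignRule.planeSign]
  have e2 := R.sum_ker_eq (fun Y => R.signRule.planeSign b 0 Y) fun c hc Y => by
    conv_rhs => rw [← R.signRule.planeSign_mul hc, mul_zero]
  have e3 := R.sum_ker_eq (fun X => R.signRule.planeSign b X 0 +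
    (D.ker.map fun j => R.signRule.planeSign b X (γ ^ j)).sum) fun c hc X => by
      have := R.sum_ker_mul hc fun Y => R.signRule.planeSign b (algebraMap F E c * X) Y
      rw [← this]
      simp only [R.signRule.planeSign_mul hc]
      congr 1
      conv_rhs => rw [← R.signRule.planeSign_mul hc, mul_zero]
  rw [e2, e3, h0]
  have e4 : (D.pts.map fun j => R.signRule.planeSign b 0 (γ ^ j)) =
      D.pts.map fun j => (-1) ^ D.clubBit ld e 0 j :=
    List.map_congr_left fun j _ => R.clubBit_zero_spec he hre him
  have e5 : (D.pts.map fun i => R.signRule.planeSign b (γ ^ i) 0 +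
      (D.ker.map fun j => R.signRule.planeSign b (γ ^ i) (γ ^ j)).sum) =
      D.pts.map fun i => (-1) ^ D.inftyBit ld e i +
        (D.ker.length - 2 * sumBits D.ker (D.pairBit ld e i) : ℤ) :=
    List.map_congr_left fun i _ => by
      rw [R.inftyBit_spec hre him, ← sum_neg_one_pow]
      congr 2
      exact List.map_congr_left fun j hj =>
        R.pairBit_spec hld (R.valid.ker_lt j hj) he hre him
  have e6 : ∀ l : List ℕ, (l.map fun i => (D.ker.length - 2 * sumBits D.ker (D.pairBit ld e i) : ℤ)).sum
      = l.length * D.ker.length - 2 * (l.map fun i => sumBits D.ker (D.pairBit ld e i)).sum := by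
    intro l
    induction l with
    | nil => simp
    | cons a l ih =>
      rw [List.map_cons, List.sum_cons, ih, List.map_cons, List.sum_cons, List.length_cons]
      push_cast
      ring
  rw [e4, e5, List.sum_map_add, sum_neg_one_pow, sum_neg_one_pow, e6, lineSum]
  generalize (D.pts.map fun i => sumBits D.ker (D.pairBit ld e i)).sum = A
  push_cast
  ring

theorem pencilSum_span_add_smul {P : SignRule σ (2 : E)} {s t : F} (ht : t ≠ 0) (b : K)
    (h : P.pencilSum (Submodule.span F {1, s • (1 : K) + t • b}) = 0) :
    P.pencilSum (Submodule.span F {1, b}) = 0 := by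
  rwa [SignRule.span_one_add_smul ht] at h

theorem exists_elt (x : E) : ∃ a < D.q, ∃ b < D.q, ∃ c < D.q,
    x = elt γ (a + 16 * b + 256 * c) := by
  have hq := R.valid.q_le
  by_cases hx : x = 0
  · exact ⟨0, by omega, 0, by omega, 0, by omega, by simp [hx]⟩
  · obtain ⟨i, -, rfl⟩ := R.exists_lt x hx
    obtain ⟨h1, h2, h3⟩ := R.isCode_ex i
    refine ⟨_, h1, _, h2, _, h3, ?_⟩
    rw [← R.elt_ex]
    congr 1
    omega

/-- Strong induction on the logarithm of b.im mod N, a quantity invariant under scaling by F*. -/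
theorem pencilSum_eq_zero (b : K) (hb : b.im ≠ 0) :
    R.signRule.pencilSum (Submodule.span F {1, b}) = 0 := by
  have hq := R.valid.q_le
  have hN := R.N_pos
  have : Finite K := Finite.of_injective (fun k : K => (k.re, k.im)) fun k k' h =>
    QuadraticAlgebra.ext (congrArg Prod.fst h) (congrArg Prod.snd h)
  have hNM : D.N ≤ D.M := Nat.le_of_dvd R.M_pos R.N_dvd_M
  obtain ⟨k, hk⟩ : ∃ k, D.dlog γ b.im % D.N = k := ⟨_, rfl⟩
  induction k using Nat.strong_induction_on generalizing b with
  | _ ld ih =>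
  have hld : ld < D.N := hk ▸ Nat.mod_lt _ hN
  have hdim := R.pow_eq (D.dlog γ b.im)
  rw [R.pow_dlog hb, hk] at hdim
  generalize D.dlog γ b.im / D.N = k at hdim
  have hc : (2 ^ k : F) ≠ 0 := pow_ne_zero _ R.two_ne_zero
  have hcE : algebraMap F E (2 ^ k) ≠ 0 := by simpa using hc
  obtain ⟨a₀, h₀, a, ha, b', hb', hx⟩ := R.exists_elt ((2 ^ k : F)⁻¹ • b.re)
  -- Normalisation: the scalar makes the imaginary part γ ^ ld with ld < N, and the translation
  -- removes the constant coordinate of the real part.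
  refine pencilSum_span_add_smul (s := -(a₀ : F)) (t := (2 ^ k)⁻¹) R (inv_ne_zero hc) b ?_
  generalize hbb : -(a₀ : F) • (1 : K) + (2 ^ k : F)⁻¹ • b = b₁
  have hre : b₁.re = elt γ (16 * a + 256 * b') := by
    have e1 := elt_mk γ (a := a₀) (b := a) (c := b') (by omega) (by omega)
    have e2 := elt_mk γ (a := 0) (b := a) (c := b') (by omega) (by omega)
    rw [zero_add] at e2
    rw [e2, ← hbb, QuadraticAlgebra.re_add, QuadraticAlgebra.re_smul, QuadraticAlgebra.re_smul, hx,
      e1, SignRule.re_one_eq, Algebra.smul_def]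
    simp
    ring
  have him : b₁.im = γ ^ ld := by
    rw [← hbb, QuadraticAlgebra.im_add, QuadraticAlgebra.im_smul, QuadraticAlgebra.im_smul,
      SignRule.im_one_eq, smul_zero, zero_add, Algebra.smul_def, map_inv₀, hdim,
      inv_mul_cancel_left₀ hcE]
  have hcode : ∀ s < D.q, D.IsCode (16 * a + 256 * b' + s) := by
    intro s hs
    exact ⟨by omega, by omega, by omega⟩
  rcases R.valid.lineSum_eq ld hld a ha b' hb' with ⟨s, hs, hlt⟩ | h
  · refine pencilSum_span_add_smul (s := (s : F)) (t := 1) R one_ne_zero b₁ ?_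
    generalize hbs : (s : F) • (1 : K) + (1 : F) • b₁ = b₂
    have hre₂ : b₂.re = elt γ (16 * a + 256 * b' + s) := by
      rw [elt_add γ (by omega) (by omega), ← hre, ← hbs, R.elt_of_lt hs, QuadraticAlgebra.re_add,
        QuadraticAlgebra.re_smul, QuadraticAlgebra.re_smul, SignRule.re_one_eq, Algebra.smul_def,
        one_smul, add_comm]
      simp
    have him₂ : b₂.im = γ ^ ld := by
      rw [← hbs, QuadraticAlgebra.im_add, QuadraticAlgebra.im_smul, QuadraticAlgebra.im_smul,
        SignRule.im_one_eq, smul_zero, zero_add, one_smul, him]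
    have hne : b₂.im ≠ 0 := him₂ ▸ pow_ne_zero _ R.ne_zero
    have hb₂ : b₂ ≠ 0 := by
      rintro rfl
      simp at hne
    rw [R.lg_eq, ← hre₂, R.normLog_eq, ← him₂] at hlt
    have hQ := SignRule.sq_sub_ne_zero (δ := (2 : E)) (y := b₂.re) hne
    generalize hQ' : b₂.re * b₂.re - 2 * (b₂.im * b₂.im) = Q at *
    -- The imaginary part of b₂⁻¹ is -d / Q. The factor -1 = γ ^ H does not matter mod N, since N ∣
    -- H.
    have hinv : b₂⁻¹.im = γ ^ (ld + D.M - D.dlog γ Q + D.H) := by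
      have : b₂⁻¹ = ⟨b₂.re / Q, -b₂.im / Q⟩ := by
        apply inv_eq_of_mul_eq_one_right
        ext
        · simp only [QuadraticAlgebra.re_mul, SignRule.re_one_eq]
          field_simp
          linear_combination hQ'
        · simp only [QuadraticAlgebra.im_mul, SignRule.im_one_eq]
          field_simp
          ring
      rw [this, pow_add, R.pow_sub ((R.dlog_le Q).trans (by omega)), R.pow_dlog hQ, R.pow_H, him₂]
      ring
    refine SignRule.pencilSum_inv R.frob hb₂ (ih _ hlt _ ?_ ?_)
    · rw [hinv]
      exact pow_ne_zero _ R.ne_zero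
    · rw [hinv, R.dlog_pow, Nat.mod_mod_of_dvd _ R.N_dvd_M, Nat.add_mod, R.valid.H_mod, add_zero,
        Nat.mod_mod]
  · rw [R.pencilSum_eq_lineSum (by omega) (by simpa using hcode 0 (by omega)) hre him]
    zify at h
    rw [← h, sub_self, mul_zero]

theorem isHalving : IsHalving F 3 R.signRule.signFun :=
  SignRule.isHalving_signFun R.frob R.sum_φ_trace R.pencilSum_eq_zero

end Represents
end Represents
end SignTable

/-! ### Cubic extensions realising the tables, and dimension six -/

namespace SignTable

variable {F E : Type*} [Field F] [Field E] [Algebra F E]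

theorem Valid.represents {D : SignTable} (h : D.Valid) [Fintype F] [Finite E] (hF : Nat.card F = D.q)
    (hE : finrank F E = 3) {γ : E} (cube : γ ^ 3 = γ + 2) (pow_N : γ ^ D.N = 2)
    (order : orderOf γ = D.M) (hM : D.M + 1 = D.q ^ 3) :
    D.Represents γ (FiniteField.frobeniusAlgHom F E) := by
  have := Fintype.ofFinite E
  have hq := h.q_le
  have : FiniteDimensional F E := FiniteDimensional.of_finrank_pos (by omega)
  have hcard : Nat.card E = D.q ^ 3 := by rw [Module.natCard_eq_pow_finrank (K := F), hF, hE]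
  have hmap : ∀ x, FiniteField.frobeniusAlgHom F E x = x ^ D.q := fun x => by
    rw [FiniteField.frobeniusAlgHom_apply, ← Nat.card_eq_fintype_card, hF]
  have hone : ∀ i, γ ^ i = 1 ↔ D.M ∣ i := fun i => by rw [← order, orderOf_dvd_iff_pow_eq_one]
  have h27 : 3 ^ 3 ≤ D.q ^ 3 := Nat.pow_le_pow_left hq.1 3
  have hγ : γ ≠ 0 := by
    rintro rfl
    have := (hone D.M).2 dvd_rfl
    rw [zero_pow (by omega)] at this
    exact zero_ne_one this
  have hpow : ∀ x : E, x ≠ 0 → ∃ i, γ ^ i = x := by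
    intro x hx
    have htop : Subgroup.zpowers (Units.mk0 γ hγ) = ⊤ := by
      apply Subgroup.eq_top_of_card_eq
      rw [Nat.card_zpowers, ← orderOf_units, Units.val_mk0, order, Nat.card_units, hcard]
      omega
    have hmem : Units.mk0 x hx ∈ Subgroup.zpowers (Units.mk0 γ hγ) := htop ▸ Subgroup.mem_top _
    obtain ⟨i, hi⟩ := mem_powers_iff_mem_zpowers.2 hmem
    exact ⟨i, by simpa using congrArg Units.val hi⟩
  refine ⟨h, ?_, cube, hone, hpow, hmap, pow_N, hF, hcard, ?_, ?_, hE⟩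
  · rw [← map_natCast (algebraMap F E), ← hF, Nat.card_eq_fintype_card,
      FiniteField.cast_card_eq_zero, map_zero]
  · intro x
    rw [hmap, hmap, hmap, ← pow_mul, ← pow_mul, show D.q * (D.q * D.q) = D.q ^ 3 by ring, ← hcard,
      Nat.card_eq_fintype_card, FiniteField.pow_card]
  · intro x hx
    by_cases hx0 : x = 0
    · exact ⟨0, by rw [hx0, map_zero]⟩
    obtain ⟨i, rfl⟩ := hpow x hx0
    have h1 : γ ^ (i * (D.q - 1)) = 1 := by
      refine mul_left_cancel₀ hx0 ?_
      rw [← pow_add, mul_one]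
      conv_rhs => rw [← hx, hmap, ← pow_mul]
      congr 1
      obtain ⟨r, hr⟩ : ∃ r, D.q = r + 1 := ⟨D.q - 1, by omega⟩
      rw [hr, Nat.add_sub_cancel]
      ring
    rw [hone, h.M_eq] at h1
    obtain ⟨k, rfl⟩ := Nat.dvd_of_mul_dvd_mul_right (by omega) h1
    exact ⟨2 ^ k, by rw [pow_mul, pow_N, map_pow, map_ofNat (algebraMap F E) 2]⟩

end SignTable

section Transport

variable {F V V' : Type*} [Field F] [AddCommGroup V] [Module F V] [AddCommGroup V'] [Module F V']

theorem IsHalving.congr {k : ℕ} {f : Submodule F V → ℤ} (hf : IsHalving F k f) (e : V ≃ₗ[F] V') :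
    IsHalving F k fun U : Submodule F V' => f (U.map (e.symm : V' →ₗ[F] V)) where
  sign U hU := hf.sign _ (by rw [LinearEquiv.finrank_map_eq, hU])
  zero U hU := hf.zero _ (by rwa [LinearEquiv.finrank_map_eq])
  balanced T hT := by
    rw [← hf.balanced (T.map (e.symm : V' →ₗ[F] V)) (by rw [LinearEquiv.finrank_map_eq, hT]),
      ← finsum_comp_equiv e.symm.toEquiv]
    refine finsum_congr fun c => ?_
    rw [Submodule.map_sup, Submodule.map_span, Set.image_singleton]
    rfl

end Transport

section Existence

universe u

open Polynomial in
theorem Polynomial.exists_field_finrank_eq_natDegree {F : Type u} [Field F] {p : F[X]}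
    (hp : Irreducible p) :
    ∃ (E : Type u) (_ : Field E) (_ : Algebra F E) (γ : E),
      aeval γ p = 0 ∧ finrank F E = p.natDegree := by
  have := Fact.mk hp
  refine ⟨AdjoinRoot p, inferInstance, inferInstance, AdjoinRoot.root p, ?_, ?_⟩
  · rw [AdjoinRoot.aeval_eq, AdjoinRoot.mk_self]
  · exact (AdjoinRoot.powerBasis hp.ne_zero).finrank.trans (AdjoinRoot.powerBasis_dim _)

open Polynomial in
theorem exists_cubic_extension {F : Type u} [Field F] (h : ∀ x : F, x ^ 3 ≠ x + 2) :
    ∃ (E : Type u) (_ : Field E) (_ : Algebra F E) (γ : E), γ ^ 3 = γ + 2 ∧ finrank F E = 3 := by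
  have hmonic : (X ^ 3 - (X + C 2) : F[X]).Monic := by
    apply monic_X_pow_sub
    rw [degree_X_add_C]; norm_num
  have hnat : (X ^ 3 - (X + C 2) : F[X]).natDegree = 3 := by
    compute_degree!
  have hirr : Irreducible (X ^ 3 - (X + C 2) : F[X]) := by
    rw [hmonic.irreducible_iff_roots_eq_zero_of_degree_le_three (by omega) (by omega),
      Multiset.eq_zero_iff_forall_notMem]
    intro x hx
    rw [mem_roots hmonic.ne_zero, IsRoot.def] at hx
    simp only [eval_sub, eval_pow, eval_X, eval_add, eval_C] at hx
    exact h x (sub_eq_zero.1 hx)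
  obtain ⟨E, _, _, γ, hγ, hE⟩ := exists_field_finrank_eq_natDegree hirr
  refine ⟨E, _, _, γ, ?_, hE.trans hnat⟩
  simp only [map_sub, map_pow, map_add, aeval_X, aeval_C, map_ofNat (algebraMap F E) 2] at hγ
  exact sub_eq_zero.1 hγ

variable {F E : Type*} [Field F] [Field E] [Algebra F E]

theorem represents_table3 [Fintype F] [Finite E] (hF : Nat.card F = 3) (hE : finrank F E = 3)
    {γ : E} (hγ : γ ^ 3 = γ + 2) (h3 : (3 : E) = 0) :
    table3.Represents γ (FiniteField.frobeniusAlgHom F E) := by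
  have h13 : γ ^ 13 = 2 := by
    have h9 : γ ^ 9 = γ + 1 := by
      linear_combination (γ ^ 6 + γ ^ 3 * (γ + 2) + (γ + 2) ^ 2 + 1) * hγ +
        (2 * γ ^ 2 + 4 * γ + 3) * h3
    linear_combination γ ^ 4 * h9 + (γ ^ 2 + γ + 1) * hγ + (γ ^ 2 + γ) * h3
  have h2 : (2 : E) ≠ 0 := fun h2 => one_ne_zero (α := E) (by linear_combination h3 - h2)
  -- The order of γ is 26: its 26th power is 1, while the powers 26 / 2 and 26 / 13 are not.
  refine table3_valid.represents hF hE hγ h13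
    (orderOf_eq_of_pow_and_pow_div_prime (by norm_num [table3]) ?_ ?_) (by norm_num [table3])
  · change γ ^ 26 = 1
    linear_combination (γ ^ 13 + 2) * h13 + h3
  · change ∀ p, p.Prime → p ∣ 26 → γ ^ (26 / p) ≠ 1
    intro p hp hpd h1
    have : p ∈ Nat.primeFactors 26 := Nat.mem_primeFactors.2 ⟨hp, hpd, by norm_num⟩
    rw [show Nat.primeFactors 26 = {2, 13} by decide +kernel] at this
    simp only [Finset.mem_insert, Finset.mem_singleton] at this
    rcases this with rfl | rfl
    · change γ ^ 13 = 1 at h1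
      exact one_ne_zero (α := E) (by linear_combination h1 - h13)
    · change γ ^ 2 = 1 at h1
      exact h2 (by linear_combination γ * h1 - hγ)

theorem represents_table5 [Fintype F] [Finite E] (hF : Nat.card F = 5) (hE : finrank F E = 3)
    {γ : E} (hγ : γ ^ 3 = γ + 2) (h5 : (5 : E) = 0) :
    table5.Represents γ (FiniteField.frobeniusAlgHom F E) := by
  have h2 : (2 : E) ≠ 0 := fun h2 => one_ne_zero (α := E) (by linear_combination h5 - 2 * h2)
  have h31 : γ ^ 31 = 2 := by
    have h6 : γ ^ 6 = γ ^ 2 + 4 * γ + 4 := by linear_combination (γ ^ 3 + γ + 2) * hγ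
    have h12 : γ ^ 12 = 2 * γ + 2 := by
      linear_combination (γ ^ 6 + γ ^ 2 + 4 * γ + 4) * h6 + (γ + 8) * hγ +
        (5 * γ ^ 2 + 8 * γ + 6) * h5
    have h18 : γ ^ 18 = 3 * γ + 2 := by
      linear_combination γ ^ 6 * h12 + (2 * γ + 2) * h6 + 2 * hγ + (2 * γ ^ 2 + 3 * γ + 2) * h5
    linear_combination γ * γ ^ 18 * h12 + γ * (2 * γ + 2) * h18 + 6 * hγ +
      (2 * γ ^ 2 + 2 * γ + 2) * h5
  have h62 : γ ^ 62 = 4 := by linear_combination (γ ^ 31 + 2) * h31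
  refine table5_valid.represents hF hE hγ h31
    (orderOf_eq_of_pow_and_pow_div_prime (by norm_num [table5]) ?_ ?_) (by norm_num [table5])
  · change γ ^ 124 = 1
    linear_combination (γ ^ 62 + 4) * h62 + 3 * h5
  · change ∀ p, p.Prime → p ∣ 124 → γ ^ (124 / p) ≠ 1
    intro p hp hpd h1
    have : p ∈ Nat.primeFactors 124 := Nat.mem_primeFactors.2 ⟨hp, hpd, by norm_num⟩
    rw [show Nat.primeFactors 124 = {2, 31} by decide +kernel] at this
    simp only [Finset.mem_insert, Finset.mem_singleton] at this
    rcases this with rfl | rfl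
    · change γ ^ 62 = 1 at h1
      exact h2 (by linear_combination h5 + h62 - h1)
    · change γ ^ 4 = 1 at h1
      have h3 : γ ^ 2 = 1 - 2 * γ := by linear_combination h1 - γ * hγ
      have h4 : γ = 1 := by linear_combination γ * h3 - hγ - 2 * h3 + γ * h5 - h5
      rw [h4] at hγ
      exact h2 (by linear_combination -hγ)

theorem SignTable.Represents.exists_isHalving {D : SignTable} {γ : E} {σ : E →ₐ[F] E}
    (R : D.Represents γ σ) (V : Type*) [AddCommGroup V] [Module F V] (hV : finrank F V = 6) :
    ∃ f : Submodule F V → ℤ, IsHalving F 3 f := by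
  have := R.fact
  have hq := R.valid.q_le
  have : Finite E := Nat.finite_of_card_ne_zero (by rw [R.card_E]; exact pow_ne_zero _ (by omega))
  have := Fintype.ofFinite E
  have hK : finrank F (QuadraticAlgebra E (2 : E) 0) = 6 := by
    rw [← Module.finrank_mul_finrank F E, R.frob.finrank_eq, QuadraticAlgebra.finrank_eq_two]
  have : FiniteDimensional F (QuadraticAlgebra E (2 : E) 0) :=
    FiniteDimensional.of_finrank_pos (by omega)
  have : FiniteDimensional F V := FiniteDimensional.of_finrank_pos (by omega)
  classical
  exact ⟨_, R.isHalving.congr (LinearEquiv.ofFinrankEq _ V (hK.trans hV.symm))⟩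

theorem exists_isHalving_of_finrank_eq_six [Finite F] (hF : Nat.card F = 3 ∨ Nat.card F = 5)
    (V : Type*) [AddCommGroup V] [Module F V] (hV : finrank F V = 6) :
    ∃ f : Submodule F V → ℤ, IsHalving F 3 f := by
  have := Fintype.ofFinite F
  have hcast : ((Nat.card F : ℕ) : F) = 0 := by
    rw [Nat.card_eq_fintype_card, FiniteField.cast_card_eq_zero]
  have hpow : ∀ x : F, x ^ Nat.card F = x := fun x => by
    rw [Nat.card_eq_fintype_card, FiniteField.pow_card]
  rcases hF with hF | hF
  · rw [hF] at hcast hpow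
    push_cast at hcast
    obtain ⟨E, _, _, γ, hγ, hE⟩ := exists_cubic_extension (F := F) fun x hx => by
      rw [hpow] at hx
      exact one_ne_zero (α := F) (by linear_combination hcast + hx)
    have : FiniteDimensional F E := FiniteDimensional.of_finrank_pos (by omega)
    have : Finite E := Module.finite_of_finite F
    refine (represents_table3 hF hE hγ ?_).exists_isHalving V hV
    rw [← map_ofNat (algebraMap F E) 3, hcast, map_zero]
  · rw [hF] at hcast hpow
    push_cast at hcast
    obtain ⟨E, _, _, γ, hγ, hE⟩ := exists_cubic_extension (F := F) fun x hx => by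
      -- With x⁵ = x, a root of x³ = x + 2 satisfies 2 (x² + 1) = 0. Then -x = x + 2 gives x = -1,
      -- contradicting x² = -1.
      have h5 := hpow x
      have h2 : (2 : F) ≠ 0 := fun h2 => one_ne_zero (α := F) (by linear_combination hcast - 2 * h2)
      have h1 : x ^ 2 = -1 := mul_left_cancel₀ h2 (by linear_combination h5 - (x ^ 2 + 1) * hx)
      have hx1 : x = -1 := mul_left_cancel₀ h2 (by linear_combination x * h1 - hx)
      rw [hx1] at h1
      exact h2 (by linear_combination h1)
    have : FiniteDimensional F E := FiniteDimensional.of_finrank_pos (by omega)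
    have : Finite E := Module.finite_of_finite F
    refine (represents_table5 hF hE hγ ?_).exists_isHalving V hV
    rw [← map_ofNat (algebraMap F E) 5, hcast, map_zero]

end Existence

/-! ### Parity of Gaussian binomials -/

section Admissible

/-- In ZMod n the product is periodic in k with period p, so p residues decide. -/
theorem prod_pow_sub_one_mod (l : List ℕ) {q n p r : ℕ} (hq : q ≠ 0) (hp₀ : 0 < p)
    (hp : ((q : ZMod n) ^ 4) ^ p = 1)
    (h : ∀ j < p, (l.map fun a => ((q : ZMod n) ^ 4) ^ j * (q : ZMod n) ^ a - 1).prod = (r : ZMod n))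
    (k : ℕ) : (l.map fun a => q ^ (4 * k + a) - 1).prod % n = r % n := by
  rw [← ZMod.natCast_eq_natCast_iff', ← h _ (Nat.mod_lt k hp₀), Nat.cast_list_prod, List.map_map]
  congr 1
  refine List.map_congr_left fun a _ => ?_
  rw [Function.comp_apply, Nat.cast_sub (Nat.one_le_pow _ _ (Nat.pos_of_ne_zero hq)), pow_add,
    ← pow_eq_pow_mod k hp, ← pow_mul]
  push_cast
  rfl

theorem gaussianBinomial_one (q v : ℕ) : gaussianBinomial q v 1 = (q ^ v - 1) / (q - 1) := by
  simp [gaussianBinomial]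

theorem gaussianBinomial_two (q v : ℕ) : gaussianBinomial q (v + 1) 2 =
    (q ^ (v + 1) - 1) * (q ^ v - 1) / ((q - 1) * (q ^ 2 - 1)) := by
  simp [gaussianBinomial, Finset.prod_range_succ]

theorem gaussianBinomial_three (q v : ℕ) : gaussianBinomial q (v + 2) 3 =
    (q ^ (v + 2) - 1) * (q ^ (v + 1) - 1) * (q ^ v - 1) /
      ((q - 1) * (q ^ 2 - 1) * (q ^ 3 - 1)) := by
  simp [gaussianBinomial, Finset.prod_range_succ]

theorem two_dvd_gaussianBinomial_three {q : ℕ} (hq : q = 3 ∨ q = 5) (k : ℕ) :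
    2 ∣ gaussianBinomial q (4 * k + 6) 3 := by
  rw [gaussianBinomial_three]
  rcases hq with rfl | rfl
  · have := prod_pow_sub_one_mod [6, 5, 4] (q := 3) (n := 832) (p := 12) (r := 0) (by norm_num)
      (by norm_num) (by decide +kernel) (by decide +kernel) k
    simp only [List.map_cons, List.map_nil, List.prod_cons, List.prod_nil, mul_one, ← mul_assoc]
      at this
    norm_num [add_assoc]
    omega
  · have := prod_pow_sub_one_mod [6, 5, 4] (q := 5) (n := 23808) (p := 48) (r := 0) (by norm_num)
      (by norm_num) (by decide +kernel) (by decide +kernel) k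
    simp only [List.map_cons, List.map_nil, List.prod_cons, List.prod_nil, mul_one, ← mul_assoc]
      at this
    norm_num [add_assoc]
    omega

theorem two_dvd_gaussianBinomial_two {q : ℕ} (hq : q = 3 ∨ q = 5) (k : ℕ) :
    2 ∣ gaussianBinomial q (4 * k + 5) 2 := by
  rw [gaussianBinomial_two]
  rcases hq with rfl | rfl
  · have := prod_pow_sub_one_mod [5, 4] (q := 3) (n := 32) (p := 2) (r := 0) (by norm_num)
      (by norm_num) (by decide +kernel) (by decide +kernel) k
    simp only [List.map_cons, List.map_nil, List.prod_cons, List.prod_nil, mul_one] at this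
    norm_num [add_assoc]
    omega
  · have := prod_pow_sub_one_mod [5, 4] (q := 5) (n := 192) (p := 4) (r := 0) (by norm_num)
      (by norm_num) (by decide +kernel) (by decide +kernel) k
    simp only [List.map_cons, List.map_nil, List.prod_cons, List.prod_nil, mul_one] at this
    norm_num [add_assoc]
    omega

theorem not_two_dvd_gaussianBinomial_two {q : ℕ} (hq : q = 3 ∨ q = 5) (k : ℕ) :
    ¬ 2 ∣ gaussianBinomial q (4 * k + 3) 2 := by
  rw [gaussianBinomial_two]
  rcases hq with rfl | rfl
  · have := prod_pow_sub_one_mod [3, 2] (q := 3) (n := 32) (p := 2) (r := 16) (by norm_num)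
      (by norm_num) (by decide +kernel) (by decide +kernel) k
    simp only [List.map_cons, List.map_nil, List.prod_cons, List.prod_nil, mul_one] at this
    norm_num [add_assoc]
    omega
  · have := prod_pow_sub_one_mod [3, 2] (q := 5) (n := 192) (p := 4) (r := 96) (by norm_num)
      (by norm_num) (by decide +kernel) (by decide +kernel) k
    simp only [List.map_cons, List.map_nil, List.prod_cons, List.prod_nil, mul_one] at this
    norm_num [add_assoc]
    omega

/-- 1 + q + … + q ^ (v - 1) is a sum of v odd numbers. -/
theorem two_dvd_gaussianBinomial_one_iff {q : ℕ} (hq : q = 3 ∨ q = 5) (v : ℕ) :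
    2 ∣ gaussianBinomial q v 1 ↔ Even v := by
  rw [gaussianBinomial_one, ← Nat.geomSum_eq (by omega), ← even_iff_two_dvd,
    Finset.even_sum_iff_even_card_odd]
  have : Odd q := by rcases hq with rfl | rfl <;> decide
  simp [this.pow]

theorem six_le_and_modEq_of_two_dvd {q : ℕ} (hq : q = 3 ∨ q = 5) {v : ℕ} (hv : 3 ≤ v)
    (h1 : 2 ∣ gaussianBinomial q (v - 1) 2) (h2 : 2 ∣ gaussianBinomial q (v - 2) 1) :
    6 ≤ v ∧ v ≡ 2 [MOD 4] := by
  rw [two_dvd_gaussianBinomial_one_iff hq, Nat.even_iff] at h2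
  have h4 : v % 4 ≠ 0 := by
    intro h0
    obtain ⟨k, rfl⟩ : ∃ k, v = 4 * k + 4 := ⟨v / 4 - 1, by omega⟩
    exact not_two_dvd_gaussianBinomial_two hq k h1
  rw [Nat.ModEq]
  omega

theorem largeSetAdmissible_iff {q : ℕ} (hq : q = 3 ∨ q = 5) (v : ℕ) :
    LargeSetAdmissible q 2 2 3 v ↔ 6 ≤ v ∧ v ≡ 2 [MOD 4] := by
  constructor
  · rintro ⟨-, hv, h⟩
    exact six_le_and_modEq_of_two_dvd hq hv (h 1 (by norm_num)) (h 2 le_rfl)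
  · rintro ⟨hv, hm⟩
    rw [Nat.ModEq] at hm
    obtain ⟨k, rfl⟩ : ∃ k, v = 4 * k + 6 := ⟨(v - 6) / 4, by omega⟩
    refine ⟨by norm_num, by omega, fun i hi => ?_⟩
    interval_cases i
    · exact two_dvd_gaussianBinomial_three hq k
    · exact two_dvd_gaussianBinomial_two hq k
    · refine (two_dvd_gaussianBinomial_one_iff hq _).2 ⟨2 * k + 2, by omega⟩

end Admissible

/-! ### Products of halvings on a subspace and on a quotient -/

section Product

variable {F V : Type*} [Field F] [AddCommGroup V] [Module F V]

theorem Submodule.finrank_comap_subtype (A U : Submodule F V) :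
    finrank F (U.comap A.subtype) = finrank F ↥(U ⊓ A) := by
  rw [← Submodule.finrank_map_subtype_eq, Submodule.map_comap_subtype, inf_comm]

theorem Submodule.finrank_map_mkQ_add [FiniteDimensional F V] (B U : Submodule F V) :
    finrank F (U.map B.mkQ) + finrank F ↥(U ⊓ B) = finrank F U := by
  have h := LinearMap.finrank_range_add_finrank_ker (B.mkQ.comp U.subtype)
  rwa [LinearMap.range_comp, Submodule.range_subtype, LinearMap.ker_comp, Submodule.ker_mkQ,
    Submodule.finrank_comap_subtype, inf_comm] at h

theorem Submodule.comap_subtype_sup_span (A T : Submodule F V) (a : A) :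
    (T ⊔ Submodule.span F {(a : V)}).comap A.subtype =
      T.comap A.subtype ⊔ Submodule.span F {a} := by
  apply Submodule.map_injective_of_injective A.injective_subtype
  rw [Submodule.map_comap_subtype, Submodule.map_sup, Submodule.map_comap_subtype,
    Submodule.map_span, Set.image_singleton, inf_comm, sup_comm, sup_comm (A ⊓ T), inf_comm A T]
  exact sup_inf_assoc_of_le T (by simp)

theorem Submodule.sup_span_add {T : Submodule F V} {t : V} (ht : t ∈ T) (c : V) :
    T ⊔ Submodule.span F {t + c} = T ⊔ Submodule.span F {c} := by
  have h : ∀ t ∈ T, ∀ c, T ⊔ Submodule.span F {t + c} ≤ T ⊔ Submodule.span F {c} := by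
    intro t ht c
    refine sup_le le_sup_left ?_
    rw [Submodule.span_singleton_le_iff_mem]
    exact add_mem (Submodule.mem_sup_left ht)
      (Submodule.mem_sup_right (Submodule.mem_span_singleton_self c))
  refine le_antisymm (h t ht c) ?_
  conv_lhs => rw [show c = -t + (t + c) by abel]
  exact h _ (neg_mem ht) _

theorem Submodule.finrank_sup_span_le [FiniteDimensional F V] (T : Submodule F V) (c : V) :
    finrank F ↥(T ⊔ Submodule.span F {c}) ≤ finrank F T + 1 := by
  by_cases hc : c ∈ T
  · rw [Submodule.sup_span_singleton_eq_self hc]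
    omega
  · rw [Submodule.finrank_sup_span_singleton hc]

theorem Submodule.map_mkQ_sup_span (B T : Submodule F V) (c : V) :
    (T ⊔ Submodule.span F {c}).map B.mkQ = T.map B.mkQ ⊔ Submodule.span F {B.mkQ c} := by
  rw [Submodule.map_sup, Submodule.map_span, Set.image_singleton]

theorem mkQ_out (B : Submodule F V) (x : V ⧸ B) : B.mkQ x.out = x := by
  rw [Submodule.mkQ_apply]; exact Quotient.out_eq x

theorem finsum_eq_finsum_quotient [Finite V] (B : Submodule F V) (φ : V → ℤ) :
    ∑ᶠ c, φ c = ∑ᶠ x : V ⧸ B, ∑ᶠ w : B, φ (x.out + w) := by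
  have := Fintype.ofFinite V
  have := Fintype.ofFinite (V ⧸ B)
  have := Fintype.ofFinite B
  have hbij : Function.Bijective fun p : (V ⧸ B) × B => p.1.out + (p.2 : V) := by
    constructor
    · rintro ⟨x, w⟩ ⟨x', w'⟩ h
      have hx := congrArg B.mkQ h
      have hw : ∀ w : B, B.mkQ (w : V) = 0 := fun w => by simp
      simp only [map_add, mkQ_out, hw, add_zero] at hx
      subst hx
      simpa using h
    · intro c
      refine ⟨⟨B.mkQ c, ⟨c - (B.mkQ c).out, ?_⟩⟩, by simp⟩
      rw [← Submodule.Quotient.mk_eq_zero, ← Submodule.mkQ_apply, map_sub, mkQ_out, sub_self]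
  rw [← finsum_comp _ hbij, finsum_eq_sum_of_fintype, Fintype.sum_prod_type,
    finsum_eq_sum_of_fintype]
  exact Finset.sum_congr rfl fun x _ => (finsum_eq_sum_of_fintype _).symm

/-- The product of sign functions on a subspace `A` and on the quotient by a subspace `B`. -/
noncomputable def productSign (k : ℕ) (A B : Submodule F V) (g : Submodule F A → ℤ)
    (h : Submodule F (V ⧸ B) → ℤ) (U : Submodule F V) : ℤ :=
  if finrank F U = k then g (U.comap A.subtype) * h (U.map B.mkQ) else 0

variable {A B : Submodule F V} {i j : ℕ} {g : Submodule F A → ℤ} {h : Submodule F (V ⧸ B) → ℤ}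

theorem IsHalving.finrank_inf_eq (hg : IsHalving F i g) {U : Submodule F V}
    (h0 : g (U.comap A.subtype) ≠ 0) : finrank F ↥(U ⊓ A) = i := by
  by_contra hne
  exact h0 (hg.zero _ (by rwa [Submodule.finrank_comap_subtype]))

variable [FiniteDimensional F V]

theorem productSign_sign (hg : IsHalving F i g) (hh : IsHalving F j h) {U : Submodule F V}
    (hU : finrank F U = i + j) (hA : finrank F ↥(U ⊓ A) = i) (hB : finrank F ↥(U ⊓ B) = i) :
    productSign (i + j) A B g h U = 1 ∨ productSign (i + j) A B g h U = -1 := by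
  have h1 := Submodule.finrank_map_mkQ_add B U
  rw [productSign, if_pos hU]
  rcases hg.sign (U.comap A.subtype) (by rw [Submodule.finrank_comap_subtype, hA]) with e | e <;>
    rcases hh.sign (U.map B.mkQ) (by omega) with e' | e' <;> simp [e, e']

theorem productSign_zero (hg : IsHalving F i g) (hh : IsHalving F j h) {U : Submodule F V}
    (hU : ¬ (finrank F ↥(U ⊓ A) = i ∧ finrank F ↥(U ⊓ B) = i)) :
    productSign (i + j) A B g h U = 0 := by
  have h1 := Submodule.finrank_map_mkQ_add B U
  rw [productSign]
  split_ifs with hk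
  · by_contra hne
    have h2 := hg.finrank_inf_eq (left_ne_zero_of_mul hne)
    have h3 : finrank F (U.map B.mkQ) = j := by
      by_contra h3
      exact right_ne_zero_of_mul hne (hh.zero _ h3)
    exact hU ⟨h2, by omega⟩
  · rfl

theorem productSign_sup_span (hg : IsHalving F i g) (hh : IsHalving F j h) (hAB : A ≤ B)
    {T : Submodule F V} (hT : finrank F T + 1 = i + j) (c : V) :
    productSign (i + j) A B g h (T ⊔ Submodule.span F {c}) =
      g ((T ⊔ Submodule.span F {c}).comap A.subtype) *
        h (T.map B.mkQ ⊔ Submodule.span F {B.mkQ c}) := by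
  rw [productSign, Submodule.map_mkQ_sup_span, ite_eq_left_iff]
  -- If c ∈ T, the right-hand side also vanishes: it would need dim(T ∩ A) = i and image of
  -- dimension j in V / B, more than dim T = i + j - 1 allows since A ≤ B.
  intro hne
  have hc : c ∈ T := by
    by_contra hc
    exact hne (by rw [Submodule.finrank_sup_span_singleton hc, hT])
  rw [Submodule.sup_span_singleton_eq_self hc,
    Submodule.sup_span_singleton_eq_self (Submodule.mem_map_of_mem hc)]
  symm
  by_contra h0
  have h2 := hg.finrank_inf_eq (left_ne_zero_of_mul h0)
  have h3 : finrank F (T.map B.mkQ) = j := by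
    by_contra h3
    exact right_ne_zero_of_mul h0 (hh.zero _ h3)
  have h4 := Submodule.finrank_map_mkQ_add B T
  have h5 := Submodule.finrank_mono (inf_le_inf_left T hAB)
  omega

/-- Adding w ∈ B raises dim(T ∩ B) to at most i, so a nonzero term forces (T + w) ∩ A = (T + w) ∩ B,
which contains w. Only w ∈ A remain, and the modular law reduces the sum to the balance of g at T ∩
A. -/
theorem finsum_comap_sup_span [Finite V] (hg : IsHalving F i g) (hAB : A ≤ B) {T : Submodule F V}
    (hT : finrank F ↥(T ⊓ B) + 1 = i) :
    ∑ᶠ w : B, g ((T ⊔ Submodule.span F {(w : V)}).comap A.subtype) = 0 := by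
  have hB : ∀ w ∈ B, w ∉ A → g ((T ⊔ Submodule.span F {w}).comap A.subtype) = 0 := by
    intro w hwB hwA
    by_contra h0
    have h1 := hg.finrank_inf_eq h0
    have h2 := Submodule.finrank_map_mkQ_add B (T ⊔ Submodule.span F {w})
    have h3 := Submodule.finrank_map_mkQ_add B T
    rw [Submodule.map_mkQ_sup_span, (Submodule.Quotient.mk_eq_zero B).2 hwB |> fun e =>
      (show B.mkQ w = 0 from e), Submodule.span_singleton_eq_bot.2 rfl, sup_bot_eq] at h2
    have h4 := Submodule.finrank_sup_span_le T w
    have h5 : (T ⊔ Submodule.span F {w}) ⊓ A = (T ⊔ Submodule.span F {w}) ⊓ B :=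
      Submodule.eq_of_le_of_finrank_le (inf_le_inf_left _ hAB) (by omega)
    have h6 : w ∈ (T ⊔ Submodule.span F {w}) ⊓ A := by
      rw [h5]
      exact ⟨Submodule.mem_sup_right (Submodule.mem_span_singleton_self w), hwB⟩
    exact hwA h6.2
  have e : ∑ᶠ w : B, g ((T ⊔ Submodule.span F {(w : V)}).comap A.subtype) =
      ∑ᶠ a : A, g ((T ⊔ Submodule.span F {(a : V)}).comap A.subtype) := by
    have hs : ∀ S : Submodule F V, ∑ᶠ w : S, g ((T ⊔ Submodule.span F {(w : V)}).comap A.subtype) =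
        ∑ᶠ w ∈ (S : Set V), g ((T ⊔ Submodule.span F {w}).comap A.subtype) := fun S =>
      finsum_set_coe_eq_finsum_mem (S : Set V)
        (f := fun w => g ((T ⊔ Submodule.span F {w}).comap A.subtype))
    rw [hs, hs, finsum_mem_def, finsum_mem_def]
    refine finsum_congr fun w => ?_
    by_cases hw : w ∈ A
    · rw [Set.indicator_of_mem (show w ∈ (A : Set V) from hw),
        Set.indicator_of_mem (show w ∈ (B : Set V) from hAB hw)]
    · rw [Set.indicator_of_notMem (show w ∉ (A : Set V) from hw)]
      by_cases hw' : w ∈ B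
      · rw [Set.indicator_of_mem (show w ∈ (B : Set V) from hw'), hB w hw' hw]
      · rw [Set.indicator_of_notMem (show w ∉ (B : Set V) from hw')]
  rw [e]
  simp only [Submodule.comap_subtype_sup_span]
  have h5 := Submodule.finrank_mono (inf_le_inf_left T hAB)
  by_cases hA : finrank F (T.comap A.subtype) + 1 = i
  · exact hg.balanced _ hA
  · refine (finsum_congr fun a => hg.zero _ fun h0 => hA ?_).trans finsum_zero
    have h6 := Submodule.finrank_sup_span_le (T.comap A.subtype) a
    rw [Submodule.finrank_comap_subtype] at *
    omega

theorem productSign_balanced [Finite V] (hg : IsHalving F i g) (hh : IsHalving F j h) (hAB : A ≤ B)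
    {T : Submodule F V} (hT : finrank F T + 1 = i + j) :
    ∑ᶠ c, productSign (i + j) A B g h (T ⊔ Submodule.span F {c}) = 0 := by
  simp only [productSign_sup_span hg hh hAB hT]
  have hT' := Submodule.finrank_map_mkQ_add B T
  rw [finsum_eq_finsum_quotient B]
  have hout : ∀ (x : V ⧸ B) (w : B), B.mkQ (x.out + w) = x := fun x w => by
    rw [map_add, mkQ_out]
    simp
  simp only [hout]
  -- If T has image of dimension j - 1 in V / B, only vectors outside T + B count; they leave T ∩ B,
  -- hence T ∩ A, unchanged, and the balance of h applies. Otherwise only vectors of T + B count;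
  -- modulo T they lie in B, and the balance of g applies.
  by_cases hj : finrank F (T.map B.mkQ) + 1 = j
  · have key : ∀ (x : V ⧸ B) (w : B), g ((T ⊔ Submodule.span F {x.out + (w : V)}).comap A.subtype) *
        h (T.map B.mkQ ⊔ Submodule.span F {x}) =
        g (T.comap A.subtype) * h (T.map B.mkQ ⊔ Submodule.span F {x}) := by
      intro x w
      by_cases hx : x ∈ T.map B.mkQ
      · rw [Submodule.sup_span_singleton_eq_self hx, hh.zero _ (by omega), mul_zero, mul_zero]
      · congr 2
        have h1 := Submodule.finrank_map_mkQ_add B (T ⊔ Submodule.span F {x.out + (w : V)})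
        rw [Submodule.map_mkQ_sup_span, hout, Submodule.finrank_sup_span_singleton hx] at h1
        have h2 := Submodule.finrank_sup_span_le T (x.out + w)
        have h3 : T ⊓ B = (T ⊔ Submodule.span F {x.out + (w : V)}) ⊓ B :=
          Submodule.eq_of_le_of_finrank_le (inf_le_inf_right _ le_sup_left) (by omega)
        apply Submodule.map_injective_of_injective A.injective_subtype
        rw [Submodule.map_comap_subtype, Submodule.map_comap_subtype, inf_comm, inf_comm A,
          ← inf_eq_right.2 hAB, ← inf_assoc, ← inf_assoc, h3]
    simp only [key]
    have hconst : ∀ x : V ⧸ B, ∑ᶠ _ : B, g (T.comap A.subtype) *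
        h (T.map B.mkQ ⊔ Submodule.span F {x}) =
        Nat.card B * (g (T.comap A.subtype) * h (T.map B.mkQ ⊔ Submodule.span F {x})) := fun x => by
      have := Fintype.ofFinite B
      rw [finsum_eq_sum_of_fintype, Finset.sum_const, Finset.card_univ, Nat.card_eq_fintype_card,
        nsmul_eq_mul]
    simp only [hconst]
    rw [← mul_finsum, ← mul_finsum, hh.balanced _ hj, mul_zero, mul_zero]
  · refine (finsum_congr fun x => ?_).trans finsum_zero
    by_cases hx : x ∈ T.map B.mkQ
    · rw [Submodule.sup_span_singleton_eq_self hx, ← finsum_mul]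
      by_cases hj' : finrank F (T.map B.mkQ) = j
      · rw [mul_eq_zero]
        left
        obtain ⟨t, ht, rfl⟩ := hx
        have hw : (B.mkQ t).out - t ∈ B := by
          rw [← Submodule.Quotient.mk_eq_zero, ← Submodule.mkQ_apply, map_sub, mkQ_out, sub_self]
        have e : ∀ w : B, T ⊔ Submodule.span F {(B.mkQ t).out + (w : V)} =
            T ⊔ Submodule.span F {((Equiv.addLeft (⟨_, hw⟩ : B) w : B) : V)} := by
          intro w
          rw [← Submodule.sup_span_add ht (((Equiv.addLeft (⟨_, hw⟩ : B) w : B) : V))]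
          congr 3
          simp
          abel
        simp only [e]
        rw [finsum_comp_equiv (Equiv.addLeft (⟨_, hw⟩ : B))
          (f := fun w : B => g ((T ⊔ Submodule.span F {(w : V)}).comap A.subtype))]
        exact finsum_comap_sup_span hg hAB (by omega)
      · rw [hh.zero _ hj', mul_zero]
    · refine (finsum_congr fun w => ?_).trans finsum_zero
      rw [hh.zero _ (by rwa [Submodule.finrank_sup_span_singleton hx]), mul_zero]

end Product

/-! ### Derived halvings -/

section Derived

variable {F V : Type*} [Field F] [AddCommGroup V] [Module F V]

theorem isHalving_zero (F V : Type*) [Field F] [AddCommGroup V] [Module F V]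
    [FiniteDimensional F V] : IsHalving F 0 fun U : Submodule F V => if finrank F U = 0 then 1 else 0 where
  sign _ hU := Or.inl (if_pos hU)
  zero _ hU := if_neg hU
  balanced _ hT := absurd hT (Nat.succ_ne_zero _)

theorem Submodule.finrank_comap_mkQ [FiniteDimensional F V] (L : Submodule F V)
    (W : Submodule F (V ⧸ L)) : finrank F (W.comap L.mkQ) = finrank F W + finrank F L := by
  rw [← Submodule.finrank_map_mkQ_add L, Submodule.map_comap_eq_of_surjective L.mkQ_surjective,
    inf_eq_right.2 (Submodule.le_comap_mkQ L W)]

theorem Submodule.comap_mkQ_sup_span (L : Submodule F V) (W : Submodule F (V ⧸ L)) (c : V) :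
    (W ⊔ Submodule.span F {L.mkQ c}).comap L.mkQ = W.comap L.mkQ ⊔ Submodule.span F {c} := by
  have h := Submodule.comap_map_mkQ L (W.comap L.mkQ ⊔ Submodule.span F {c})
  rwa [Submodule.map_mkQ_sup_span, Submodule.map_comap_eq_of_surjective L.mkQ_surjective,
    sup_eq_right.2 ((Submodule.le_comap_mkQ L W).trans le_sup_left)] at h

/-- The sum at the preimage of T runs over V and depends only on cosets of L, so it is |L| times the
sum over V / L. -/
theorem IsHalving.derived [Finite V] {k : ℕ} {f : Submodule F V → ℤ} (hf : IsHalving F (k + 1) f)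
    [FiniteDimensional F V] {L : Submodule F V} (hL : finrank F L = 1) :
    IsHalving F k fun W : Submodule F (V ⧸ L) => f (W.comap L.mkQ) where
  sign W hW := hf.sign _ (by rw [Submodule.finrank_comap_mkQ, hW, hL])
  zero W hW := hf.zero _ (by rw [Submodule.finrank_comap_mkQ, hL]; omega)
  balanced T hT := by
    have h := hf.balanced (T.comap L.mkQ) (by rw [Submodule.finrank_comap_mkQ, hL, hT])
    rw [finsum_eq_finsum_quotient L] at h
    have := Fintype.ofFinite L
    have hout : ∀ (x : V ⧸ L) (w : L), L.mkQ (x.out + w) = x := fun x w => by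
      rw [map_add, mkQ_out]
      simp
    simp only [← Submodule.comap_mkQ_sup_span, hout, finsum_eq_sum_of_fintype, Finset.sum_const,
      Finset.card_univ] at h
    rw [← smul_finsum] at h
    exact (smul_eq_zero.1 h).resolve_left Fintype.card_ne_zero

end Derived

/-! ### From dimension n + 2 to dimension n + 6 -/

section Recursion

variable {F : Type*} [Field F]

/-- Every `d`-dimensional space over `F` has a balanced sign function on its `k`-subspaces. -/
def HasHalving (F : Type*) [Field F] (k d : ℕ) : Prop :=
  ∃ f : Submodule F (Fin d → F) → ℤ, IsHalving F k f

variable {V : Type*} [AddCommGroup V] [Module F V] [FiniteDimensional F V] {k d : ℕ}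

theorem IsHalving.hasHalving {f : Submodule F V → ℤ} (hf : IsHalving F k f)
    (hV : finrank F V = d) : HasHalving F k d :=
  ⟨_, hf.congr (LinearEquiv.ofFinrankEq V (Fin d → F) (by rw [hV, finrank_fin_fun]))⟩

theorem HasHalving.exists_isHalving (h : HasHalving F k d) (hV : finrank F V = d) :
    ∃ f : Submodule F V → ℤ, IsHalving F k f := by
  obtain ⟨f, hf⟩ := h
  exact ⟨_, hf.congr (LinearEquiv.ofFinrankEq (Fin d → F) V (by rw [hV, finrank_fin_fun]))⟩

theorem HasHalving.derived [Finite F] (h : HasHalving F (k + 1) (d + 1)) : HasHalving F k d := by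
  obtain ⟨f, hf⟩ := h
  have hL : finrank F (Submodule.span F {(1 : Fin (d + 1) → F)}) = 1 :=
    finrank_span_singleton one_ne_zero
  refine (hf.derived hL).hasHalving ?_
  have := Submodule.finrank_quotient_add_finrank (Submodule.span F {(1 : Fin (d + 1) → F)})
  rw [hL, finrank_fin_fun] at this
  omega

theorem Submodule.exists_le_finrank_eq_succ (S : Submodule F V) (h : finrank F S < finrank F V) :
    ∃ T : Submodule F V, S ≤ T ∧ finrank F T = finrank F S + 1 := by
  obtain ⟨c, hc⟩ : ∃ c, c ∉ S := by
    by_contra! hall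
    rw [(Submodule.eq_top_iff'.2 hall : S = ⊤), finrank_top] at h
    exact lt_irrefl _ h
  exact ⟨S ⊔ Submodule.span F {c}, le_sup_left, Submodule.finrank_sup_span_singleton hc⟩

theorem Submodule.exists_finrank_eq {n : ℕ} (h : n ≤ finrank F V) :
    ∃ S : Submodule F V, finrank F S = n := by
  induction n with
  | zero => exact ⟨⊥, finrank_bot F V⟩
  | succ n ih =>
    obtain ⟨S, hS⟩ := ih (by omega)
    obtain ⟨T, -, hT⟩ := S.exists_le_finrank_eq_succ (by omega)
    exact ⟨T, by rw [hT, hS]⟩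

theorem Submodule.finrank_inf_add_le {A B : Submodule F V} (h : A ≤ B) (U : Submodule F V) :
    finrank F ↥(U ⊓ B) + finrank F A ≤ finrank F ↥(U ⊓ A) + finrank F B := by
  have h1 := Submodule.finrank_sup_add_finrank_inf_eq (U ⊓ B) A
  rw [inf_assoc, inf_eq_right.2 h] at h1
  have h2 := Submodule.finrank_mono (sup_le (inf_le_right : U ⊓ B ≤ B) h)
  omega

theorem exists_isHalving_three_of_chain [Finite V] {A₄ A₅ A₆ : Submodule F V} (h₄₅ : A₄ ≤ A₅)
    (h₅₆ : A₅ ≤ A₆) (d₅ : finrank F A₅ = finrank F A₄ + 1) (d₆ : finrank F A₆ = finrank F A₅ + 1)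
    {g₃ : Submodule F A₆ → ℤ} (hg₃ : IsHalving F 3 g₃)
    {g₂ : Submodule F A₅ → ℤ} (hg₂ : IsHalving F 2 g₂)
    {g₁ : Submodule F A₄ → ℤ} (hg₁ : IsHalving F 1 g₁)
    {h₁ : Submodule F (V ⧸ A₆) → ℤ} (hh₁ : IsHalving F 1 h₁)
    {h₂ : Submodule F (V ⧸ A₅) → ℤ} (hh₂ : IsHalving F 2 h₂)
    {h₃ : Submodule F (V ⧸ A₄) → ℤ} (hh₃ : IsHalving F 3 h₃) :
    ∃ f : Submodule F V → ℤ, IsHalving F 3 f := by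
  have hg₀ := isHalving_zero F A₄
  have hh₀ := isHalving_zero F (V ⧸ A₆)
  set g₀ : Submodule F A₄ → ℤ := fun U => if finrank F U = 0 then 1 else 0
  set h₀ : Submodule F (V ⧸ A₆) → ℤ := fun U => if finrank F U = 0 then 1 else 0
  refine ⟨fun U => productSign (3 + 0) A₆ A₆ g₃ h₀ U + productSign (2 + 1) A₅ A₆ g₂ h₁ U +
    productSign (1 + 2) A₄ A₅ g₁ h₂ U + productSign (0 + 3) A₄ A₄ g₀ h₃ U, ?_, ?_, ?_⟩
  · intro U hU
    have b₄ := Submodule.finrank_mono (inf_le_inf_left U h₄₅)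
    have b₅ := Submodule.finrank_mono (inf_le_inf_left U h₅₆)
    have b₆ := Submodule.finrank_mono (inf_le_left : U ⊓ A₆ ≤ U)
    have c₄ := Submodule.finrank_inf_add_le h₄₅ U
    have c₅ := Submodule.finrank_inf_add_le h₅₆ U
    -- Along the chain the dimension of the intersection with U rises by at most one per step, so
    -- these cases are exhaustive and exclusive; each is the support of exactly one of the four
    -- products on 3-subspaces.
    have cases : finrank F ↥(U ⊓ A₆) = 3 ∨ (finrank F ↥(U ⊓ A₅) = 2 ∧ finrank F ↥(U ⊓ A₆) = 2) ∨
      (finrank F ↥(U ⊓ A₄) = 1 ∧ finrank F ↥(U ⊓ A₅) = 1) ∨ finrank F ↥(U ⊓ A₄) = 0 := by omega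
    rcases cases with h | ⟨h, h'⟩ | ⟨h, h'⟩ | h
    · rw [productSign_zero hg₂ hh₁ (by omega), productSign_zero hg₁ hh₂ (by omega),
        productSign_zero hg₀ hh₃ (by omega), add_zero, add_zero, add_zero]
      exact productSign_sign hg₃ hh₀ hU h h
    · rw [productSign_zero hg₃ hh₀ (by omega), productSign_zero hg₁ hh₂ (by omega),
        productSign_zero hg₀ hh₃ (by omega), add_zero, add_zero, zero_add]
      exact productSign_sign hg₂ hh₁ hU h h'
    · rw [productSign_zero hg₃ hh₀ (by omega), productSign_zero hg₂ hh₁ (by omega),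
        productSign_zero hg₀ hh₃ (by omega), add_zero, zero_add, zero_add]
      exact productSign_sign hg₁ hh₂ hU h h'
    · rw [productSign_zero hg₃ hh₀ (by omega), productSign_zero hg₂ hh₁ (by omega),
        productSign_zero hg₁ hh₂ (by omega), zero_add, zero_add, zero_add]
      exact productSign_sign hg₀ hh₃ hU h h
  · intro U hU
    simp [productSign, hU]
  · intro T hT
    have hfin : ∀ φ : V → ℤ, φ.HasFiniteSupport := fun φ => Set.toFinite _
    rw [finsum_add_distrib (hfin _) (hfin _), finsum_add_distrib (hfin _) (hfin _),
      finsum_add_distrib (hfin _) (hfin _), productSign_balanced hg₃ hh₀ le_rfl hT,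
      productSign_balanced hg₂ hh₁ h₅₆ hT, productSign_balanced hg₁ hh₂ h₄₅ hT,
      productSign_balanced hg₀ hh₃ le_rfl hT]
    rfl

theorem HasHalving.add_four [Finite F] (h₆ : HasHalving F 3 6) {n : ℕ}
    (h : HasHalving F 3 (n + 2)) : HasHalving F 3 (n + 6) := by
  have hV : finrank F (Fin (n + 6) → F) = n + 6 := finrank_fin_fun F
  obtain ⟨A₄, d₄⟩ := Submodule.exists_finrank_eq (F := F) (V := Fin (n + 6) → F) (n := 4) (by omega)
  obtain ⟨A₅, h₄₅, d₅⟩ := A₄.exists_le_finrank_eq_succ (by omega)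
  obtain ⟨A₆, h₅₆, d₆⟩ := A₅.exists_le_finrank_eq_succ (by omega)
  have q₄ := A₄.finrank_quotient_add_finrank
  have q₅ := A₅.finrank_quotient_add_finrank
  have q₆ := A₆.finrank_quotient_add_finrank
  obtain ⟨g₃, hg₃⟩ := h₆.exists_isHalving (V := A₆) (by omega)
  obtain ⟨g₂, hg₂⟩ := h₆.derived.exists_isHalving (V := A₅) (by omega)
  obtain ⟨g₁, hg₁⟩ := h₆.derived.derived.exists_isHalving (V := A₄) (by omega)
  obtain ⟨h₁, hh₁⟩ := h.derived.derived.exists_isHalving (V := _ ⧸ A₆) (by omega)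
  obtain ⟨h₂, hh₂⟩ := h.derived.exists_isHalving (V := _ ⧸ A₅) (by omega)
  obtain ⟨h₃, hh₃⟩ := h.exists_isHalving (V := _ ⧸ A₄) (by omega)
  obtain ⟨f, hf⟩ := exists_isHalving_three_of_chain h₄₅ h₅₆ d₅ d₆ hg₃ hg₂ hg₁ hh₁ hh₂ hh₃
  exact hf.hasHalving hV

theorem hasHalving_three [Finite F] (hF : Nat.card F = 3 ∨ Nat.card F = 5) (m : ℕ) :
    HasHalving F 3 (4 * m + 6) := by
  have h₆ : HasHalving F 3 6 := by
    obtain ⟨f, hf⟩ := exists_isHalving_of_finrank_eq_six hF (Fin 6 → F) (finrank_fin_fun F)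
    exact ⟨f, hf⟩
  induction m with
  | zero => exact h₆
  | succ m ih => exact h₆.add_four (n := 4 * m + 4) ih

end Recursion

/-! ### Counting subspaces through a given one -/

section Counting

variable {F V : Type*} [Field F] [AddCommGroup V] [Module F V] {k : ℕ}

theorem mem_subspaceGrassmannian [FiniteDimensional F V] {U : Submodule F V} :
    U ∈ subspaceGrassmannian F V k ↔ finrank F U = k :=
  ⟨And.right, fun h => ⟨inferInstance, h⟩⟩

theorem Submodule.ncard_coe [Finite F] [FiniteDimensional F V] (U : Submodule F V) :
    (U : Set V).ncard = Nat.card F ^ finrank F U := by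
  rw [← Nat.card_coe_set_eq]
  exact Module.natCard_eq_pow_finrank (K := F) (V := U)

theorem finsum_eq_ncard_sub_ncard {ι : Type*} [Finite ι] {f : ι → ℤ}
    (hf : ∀ i, f i = 1 ∨ f i = -1 ∨ f i = 0) :
    ∑ᶠ i, f i = {i | f i = 1}.ncard - {i | f i = -1}.ncard := by
  classical
  have := Fintype.ofFinite ι
  rw [finsum_eq_sum_of_fintype, Set.ncard_eq_toFinset_card', Set.ncard_eq_toFinset_card',
    Set.toFinset_ofPred, Set.toFinset_ofPred, Finset.card_filter, Finset.card_filter]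
  push_cast
  rw [← Finset.sum_sub_distrib]
  refine Finset.sum_congr rfl fun i _ => ?_
  rcases hf i with h | h | h <;> simp [h]

variable [FiniteDimensional F V]

theorem setOf_sup_span_eq {T U : Submodule F V} (hT : finrank F T = k)
    (hU : finrank F U = k + 1) (h : T ≤ U) :
    {c | T ⊔ Submodule.span F {c} = U} = (U : Set V) \ T := by
  ext c
  constructor
  · rintro rfl
    refine ⟨Submodule.mem_sup_right (Submodule.mem_span_singleton_self c), fun hc => ?_⟩
    rw [Submodule.sup_span_singleton_eq_self hc] at hU
    omega
  · rintro ⟨hcU, hcT⟩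
    exact Submodule.eq_of_le_of_finrank_eq (sup_le h (by simpa using hcU))
      (by rw [Submodule.finrank_sup_span_singleton hcT, hT, hU])

variable [Finite F]

/-- Each U through T is generated over T by the vectors of U \ T. -/
theorem ncard_setOf_sup_span_mem {B : Set (Submodule F V)}
    (hB : B ⊆ subspaceGrassmannian F V (k + 1)) {T : Submodule F V} (hT : finrank F T = k) :
    {c | T ⊔ Submodule.span F {c} ∈ B}.ncard =
      (Nat.card F ^ (k + 1) - Nat.card F ^ k) * {U ∈ B | T ≤ U}.ncard := by
  classical
  have := Module.finite_of_finite F (M := V)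
  have := Fintype.ofFinite V
  have := Fintype.ofFinite (Submodule F V)
  rw [Set.ncard_eq_toFinset_card', Set.ncard_eq_toFinset_card' {U ∈ B | T ≤ U}]
  rw [Finset.card_eq_sum_card_fiberwise (f := fun c => T ⊔ Submodule.span F {c})
    (t := {U ∈ B | T ≤ U}.toFinset)
    (fun c hc => by simp at hc ⊢; exact hc), Finset.sum_const_nat, mul_comm]
  intro U hU
  rw [Set.mem_toFinset] at hU
  have hU' := mem_subspaceGrassmannian.1 (hB hU.1)
  have e : (({c | T ⊔ Submodule.span F {c} ∈ B}.toFinset.filter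
      fun c => T ⊔ Submodule.span F {c} = U : Finset V) : Set V) = (U : Set V) \ T := by
    rw [← setOf_sup_span_eq hT hU' hU.2]
    ext c
    simp only [Finset.coe_filter, Set.mem_toFinset, Set.mem_ofPred_eq, and_iff_right_iff_imp]
    rintro rfl
    exact hU.1
  rw [← Set.ncard_coe_finset, e, Set.ncard_sdiff hU.2 (Set.toFinite _), Submodule.ncard_coe,
    Submodule.ncard_coe, hU', hT]

theorem mul_ncard_subspaceGrassmannian {T : Submodule F V} (hT : finrank F T = k) :
    (Nat.card F ^ (k + 1) - Nat.card F ^ k) *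
      {U ∈ subspaceGrassmannian F V (k + 1) | T ≤ U}.ncard =
      Nat.card F ^ finrank F V - Nat.card F ^ k := by
  have := Module.finite_of_finite F (M := V)
  rw [← ncard_setOf_sup_span_mem subset_rfl hT]
  have e : {c | T ⊔ Submodule.span F {c} ∈ subspaceGrassmannian F V (k + 1)} =
      ((⊤ : Submodule F V) : Set V) \ T := by
    ext c
    simp only [mem_subspaceGrassmannian, Set.mem_ofPred_eq, Submodule.top_coe, Set.mem_sdiff,
      Set.mem_univ, true_and, SetLike.mem_coe]
    constructor
    · intro h hc
      rw [Submodule.sup_span_singleton_eq_self hc] at h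
      omega
    · intro hc
      rw [Submodule.finrank_sup_span_singleton hc, hT]
  rw [e, Set.ncard_sdiff (SetLike.coe_subset_coe.2 le_top) (Set.toFinite _), Submodule.ncard_coe,
    Submodule.ncard_coe, hT, finrank_top]

theorem sum_ncard_setOf_mem {B : Set (Submodule F V)} (hB : B ⊆ subspaceGrassmannian F V k)
    [Fintype V] [DecidableEq V] :
    ∑ a : V with a ≠ 0, {U ∈ B | Submodule.span F {a} ≤ U}.ncard =
      B.ncard * (Nat.card F ^ k - 1) := by
  classical
  have := Fintype.ofFinite (Submodule F V)
  have h := Finset.sum_card_bipartiteAbove_eq_sum_card_bipartiteBelow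
    (s := Finset.univ.filter fun a : V => a ≠ 0) (t := B.toFinset)
    (fun (a : V) (U : Submodule F V) => Submodule.span F {a} ≤ U)
  rw [Finset.sum_const_nat (s := B.toFinset) (m := Nat.card F ^ k - 1),
    ← Set.ncard_eq_toFinset_card'] at h
  · rw [← h]
    refine Finset.sum_congr rfl fun a _ => ?_
    rw [← Set.ncard_coe_finset]
    congr 1
    ext U
    simp [Finset.bipartiteAbove]
  · intro U hU
    rw [Set.mem_toFinset] at hU
    rw [← mem_subspaceGrassmannian.1 (hB hU), ← U.ncard_coe, ← Set.ncard_coe_finset]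
    have e : ((Finset.bipartiteBelow (fun (a : V) (U : Submodule F V) => Submodule.span F {a} ≤ U)
      (Finset.univ.filter fun a : V => a ≠ 0) U : Finset V) : Set V) = (U : Set V) \ {0} := by
      ext a
      simp [Finset.bipartiteBelow, and_comm]
    rw [e, Set.ncard_sdiff_singleton_of_mem (zero_mem U)]

theorem mul_ncard_subspaceGrassmannian_two (F V : Type*) [Field F] [AddCommGroup V] [Module F V]
    [Finite F] [FiniteDimensional F V] :
    (Nat.card F ^ 2 - Nat.card F) * ((subspaceGrassmannian F V 2).ncard * (Nat.card F ^ 2 - 1)) =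
      (Nat.card F ^ finrank F V - Nat.card F) * (Nat.card F ^ finrank F V - 1) := by
  classical
  have := Module.finite_of_finite F (M := V)
  have := Fintype.ofFinite V
  rw [← sum_ncard_setOf_mem subset_rfl, Finset.mul_sum,
    Finset.sum_const_nat (m := Nat.card F ^ finrank F V - Nat.card F), mul_comm,
    Finset.filter_ne', Finset.card_erase_of_mem (Finset.mem_univ _), Finset.card_univ,
    ← Nat.card_eq_fintype_card, Module.natCard_eq_pow_finrank (K := F) (V := V)]
  intro a ha
  simpa using mul_ncard_subspaceGrassmannian (k := 1)
    (finrank_span_singleton (K := F) (Finset.mem_filter.1 ha).2)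

end Counting

/-! ### Halvings force even Gaussian binomials -/

section Parity

variable {F V : Type*} [Field F] [AddCommGroup V] [Module F V] {k : ℕ} {f : Submodule F V → ℤ}

theorem IsHalving.setOf_subset (hf : IsHalving F k f) [FiniteDimensional F V] {ε : ℤ} (hε : ε ≠ 0) :
    {U | f U = ε} ⊆ subspaceGrassmannian F V k := fun U hU => by
  rw [mem_subspaceGrassmannian]
  by_contra h
  exact hε ((hf.zero U h).symm.trans hU).symm

theorem IsHalving.sign_or_zero (hf : IsHalving F k f) (U : Submodule F V) :
    f U = 1 ∨ f U = -1 ∨ f U = 0 := by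
  by_cases h : finrank F U = k
  · exact (hf.sign U h).imp_right Or.inl
  · exact Or.inr (Or.inr (hf.zero U h))

theorem disjoint_setOf_eq_one_setOf_eq_neg_one (f : Submodule F V → ℤ) :
    Disjoint {U | f U = 1} {U | f U = -1} := by
  rw [Set.disjoint_left]
  intro U h h'
  rw [Set.mem_ofPred_eq] at h h'
  omega

variable [FiniteDimensional F V]

theorem IsHalving.union_eq (hf : IsHalving F k f) :
    {U | f U = 1} ∪ {U | f U = -1} = subspaceGrassmannian F V k :=
  (Set.union_subset (hf.setOf_subset one_ne_zero) (hf.setOf_subset (by norm_num))).antisymm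
    fun U hU => hf.sign U hU.2

variable [Finite F]

theorem IsHalving.ncard_eq_ncard (hf : IsHalving F (k + 1) f) {T : Submodule F V}
    (hT : finrank F T = k) :
    {U ∈ {U | f U = 1} | T ≤ U}.ncard = {U ∈ {U | f U = -1} | T ≤ U}.ncard := by
  have := Module.finite_of_finite F (M := V)
  have h := hf.balanced T (by rw [hT])
  rw [finsum_eq_ncard_sub_ncard fun c => hf.sign_or_zero _, sub_eq_zero, Nat.cast_inj] at h
  have h1 := ncard_setOf_sup_span_mem (hf.setOf_subset one_ne_zero) hT
  have h2 := ncard_setOf_sup_span_mem (hf.setOf_subset (ε := -1) (by norm_num)) hT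
  refine Nat.eq_of_mul_eq_mul_left ?_ (h1.symm.trans (h.trans h2))
  exact Nat.sub_pos_of_lt (Nat.pow_lt_pow_right Finite.one_lt_card k.lt_succ_self)

theorem IsHalving.two_mul_ncard (hf : IsHalving F (k + 1) f) {T : Submodule F V}
    (hT : finrank F T = k) :
    {U ∈ subspaceGrassmannian F V (k + 1) | T ≤ U}.ncard =
      2 * {U ∈ {U | f U = 1} | T ≤ U}.ncard := by
  have := Module.finite_of_finite F (M := V)
  rw [← hf.union_eq, two_mul]
  nth_rewrite 2 [hf.ncard_eq_ncard hT]
  rw [← Set.ncard_union_eq ((disjoint_setOf_eq_one_setOf_eq_neg_one f).mono (Set.sep_subset _ _)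
    (Set.sep_subset _ _))]
  congr 1
  ext U
  simp [or_and_right]

theorem HasHalving.two_dvd_gaussianBinomial_one {d : ℕ} (h : HasHalving F 1 d) :
    2 ∣ gaussianBinomial (Nat.card F) d 1 := by
  obtain ⟨f, hf⟩ := h
  have h1 := mul_ncard_subspaceGrassmannian (finrank_bot F (Fin d → F))
  rw [hf.two_mul_ncard (finrank_bot F _), finrank_fin_fun, zero_add, pow_one, pow_zero] at h1
  rw [gaussianBinomial_one, ← h1, Nat.mul_div_cancel_left]
  · exact dvd_mul_right _ _
  · exact Nat.sub_pos_of_lt Finite.one_lt_card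

/-- Double count pairs of a nonzero vector and a 2-subspace containing it; at every vector exactly
half of the 2-subspaces are positive. -/
theorem IsHalving.ncard_two (hf : IsHalving F 2 f) :
    (subspaceGrassmannian F V 2).ncard = 2 * {U | f U = 1}.ncard := by
  classical
  have := Module.finite_of_finite F (M := V)
  have := Fintype.ofFinite V
  have hq : 0 < Nat.card F ^ 2 - 1 :=
    Nat.sub_pos_of_lt (Nat.one_lt_pow two_ne_zero Finite.one_lt_card)
  apply Nat.eq_of_mul_eq_mul_right hq
  rw [mul_assoc, ← sum_ncard_setOf_mem subset_rfl,
    ← sum_ncard_setOf_mem (hf.setOf_subset one_ne_zero), Finset.mul_sum]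
  exact Finset.sum_congr rfl fun a ha =>
    hf.two_mul_ncard (finrank_span_singleton (Finset.mem_filter.1 ha).2)

theorem HasHalving.two_dvd_gaussianBinomial_two {d : ℕ} (h : HasHalving F 2 (d + 1)) :
    2 ∣ gaussianBinomial (Nat.card F) (d + 1) 2 := by
  obtain ⟨f, hf⟩ := h
  have h1 := mul_ncard_subspaceGrassmannian_two F (Fin (d + 1) → F)
  have hq : 1 < Nat.card F := Finite.one_lt_card
  have e : ∀ n, Nat.card F ^ (n + 1) - Nat.card F = Nat.card F * (Nat.card F ^ n - 1) := fun n => by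
    rw [Nat.mul_sub, mul_one, pow_succ']
  rw [hf.ncard_two, finrank_fin_fun, e, e, pow_one, mul_assoc, mul_assoc] at h1
  rw [mul_assoc (Nat.card F)] at h1
  have h2 := Nat.eq_of_mul_eq_mul_left (zero_lt_one.trans hq) h1
  rw [gaussianBinomial_two, mul_comm (Nat.card F ^ (d + 1) - 1), ← h2, ← mul_assoc 2]
  have h3 : (Nat.card F - 1) * (2 * {U | f U = 1}.ncard * (Nat.card F ^ 2 - 1)) =
      (Nat.card F - 1) * (Nat.card F ^ 2 - 1) * (2 * {U | f U = 1}.ncard) := by ring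
  rw [h3, Nat.mul_div_cancel_left]
  · exact dvd_mul_right _ _
  · exact Nat.mul_pos (by omega) (Nat.sub_pos_of_lt (Nat.one_lt_pow two_ne_zero hq))

end Parity

/-! ### Large sets with two parts are halvings -/

section LargeSet

variable {F V : Type*} [Field F] [AddCommGroup V] [Module F V] [FiniteDimensional F V] {k : ℕ}

theorem LargeSetRealizable.le_finrank {N t v : ℕ} (hN : N ≠ 0)
    (h : LargeSetRealizable F V N t k v) : k ≤ finrank F V := by
  obtain ⟨D, hD⟩ := h
  obtain ⟨B, hB⟩ : D.Nonempty := by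
    rw [← Set.encard_ne_zero, hD.encard_eq]
    exact_mod_cast hN
  obtain ⟨U, hU⟩ := hD.nonempty B hB
  have : U ∈ subspaceGrassmannian F V k := hD.sUnion_eq ▸ Set.mem_sUnion_of_mem hU hB
  exact this.2 ▸ U.finrank_le

variable [Finite F]

theorem IsHalving.largeSetRealizable {f : Submodule F V → ℤ} (hf : IsHalving F (k + 1) f)
    (hk : k < finrank F V) : LargeSetRealizable F V 2 k (k + 1) (finrank F V) := by
  have := Module.finite_of_finite F (M := V)
  have hq : 1 < Nat.card F := Finite.one_lt_card
  obtain ⟨S, hS⟩ := Submodule.exists_finrank_eq (F := F) (V := V) hk.le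
  have hc : 0 < Nat.card F ^ (k + 1) - Nat.card F ^ k :=
    Nat.sub_pos_of_lt (Nat.pow_lt_pow_right hq k.lt_succ_self)
  -- λ is half the number of (k + 1)-subspaces through T, which does not depend on T; S only serves
  -- to name it.
  have hlam : ∀ T : Submodule F V, finrank F T = k →
      {U ∈ {U | f U = 1} | T ≤ U}.ncard = {U ∈ {U | f U = 1} | S ≤ U}.ncard := fun T hT => by
    have h1 := mul_ncard_subspaceGrassmannian hT
    rw [← mul_ncard_subspaceGrassmannian hS, hf.two_mul_ncard hT, hf.two_mul_ncard hS] at h1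
    exact Nat.eq_of_mul_eq_mul_left two_pos (Nat.eq_of_mul_eq_mul_left hc h1)
  have hpos : {U ∈ {U | f U = 1} | S ≤ U}.ncard ≠ 0 := by
    intro h0
    have h1 := mul_ncard_subspaceGrassmannian hS
    rw [hf.two_mul_ncard hS, h0] at h1
    have := Nat.pow_lt_pow_right hq hk
    omega
  have hdisj := disjoint_setOf_eq_one_setOf_eq_neg_one f
  have hne : {U | f U = 1}.Nonempty :=
    (Set.nonempty_of_ncard_ne_zero hpos).mono (Set.sep_subset _ _)
  have hne' : {U | f U = -1}.Nonempty := by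
    rw [hf.ncard_eq_ncard hS] at hpos
    exact (Set.nonempty_of_ncard_ne_zero hpos).mono (Set.sep_subset _ _)
  have hdesign : ∀ B ⊆ subspaceGrassmannian F V (k + 1), (∀ T : Submodule F V, finrank F T = k →
      {U ∈ B | T ≤ U}.ncard = {U ∈ {U | f U = 1} | S ≤ U}.ncard) →
      IsSubspaceDesign F V k (finrank F V) (k + 1) {U ∈ {U | f U = 1} | S ≤ U}.ncard B :=
    fun B hB h => ⟨inferInstance, rfl, hB, fun T hT => by
      rw [← h T hT.2, (Set.toFinite _).cast_ncard_eq]⟩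
  refine ⟨{{U | f U = 1}, {U | f U = -1}}, Set.encard_pair (hdisj.ne hne.ne_empty), ?_,
    ?_, ?_, {U ∈ {U | f U = 1} | S ≤ U}.ncard, ?_⟩
  · rintro B (rfl | rfl)
    exacts [hne, hne']
  · rw [Set.pairwiseDisjoint_insert]
    refine ⟨Set.pairwiseDisjoint_singleton _ _, ?_⟩
    rintro B rfl -
    exact hdisj
  · rw [Set.sUnion_pair, hf.union_eq]
  · rintro B (rfl | rfl)
    · exact hdesign _ (hf.setOf_subset one_ne_zero) hlam
    · exact hdesign _ (hf.setOf_subset (by norm_num)) fun T hT =>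
        (hf.ncard_eq_ncard hT).symm.trans (hlam T hT)

theorem LargeSetRealizable.exists_isHalving {v : ℕ} (h : LargeSetRealizable F V 2 k (k + 1) v) :
    ∃ f : Submodule F V → ℤ, IsHalving F (k + 1) f := by
  classical
  have := Module.finite_of_finite F (M := V)
  obtain ⟨D, hD⟩ := h
  obtain ⟨B, C, hBC, rfl⟩ := Set.encard_eq_two.1 hD.encard_eq
  obtain ⟨lam, hlam⟩ := hD.exists_design
  have hB := hlam B (by simp)
  have hC := hlam C (by simp)
  have hdisj : Disjoint B C := hD.pairwiseDisjoint (by simp) (by simp) hBC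
  have hunion := hD.sUnion_eq
  rw [Set.sUnion_pair] at hunion
  let f : Submodule F V → ℤ := fun U => if U ∈ B then 1 else if U ∈ C then -1 else 0
  have hfB : {U | f U = 1} = B := by
    ext U
    simp only [Set.mem_ofPred_eq, f]
    split_ifs <;> simp_all
  have hfC : {U | f U = -1} = C := by
    ext U
    have := fun h : U ∈ B => Set.disjoint_left.1 hdisj h
    simp only [Set.mem_ofPred_eq, f]
    split_ifs <;> simp_all
  have hsign : ∀ U, f U = 1 ∨ f U = -1 ∨ f U = 0 := fun U => by
    simp only [f]
    split_ifs <;> simp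
  refine ⟨f, fun U hU => ?_, fun U hU => ?_, fun T hT => ?_⟩
  · rw [← mem_subspaceGrassmannian, ← hunion, ← hfB, ← hfC] at hU
    exact hU
  · rw [Ne, ← mem_subspaceGrassmannian, ← hunion, Set.mem_union, not_or] at hU
    simp only [f, if_neg hU.1, if_neg hU.2]
  · have hT' : finrank F T = k := by omega
    have card : ∀ A, IsSubspaceDesign F V k v (k + 1) lam A →
        {U ∈ A | T ≤ U}.ncard = lam := fun A hA => by
      rw [Set.ncard, hA.encard_eq T (mem_subspaceGrassmannian.2 hT'), ENat.toNat_natCast]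
    rw [finsum_eq_ncard_sub_ncard fun c => hsign _, sub_eq_zero, Nat.cast_inj]
    have h1 := ncard_setOf_sup_span_mem hB.subset_grassmannian hT'
    have h2 := ncard_setOf_sup_span_mem hC.subset_grassmannian hT'
    rw [card B hB, ← hfB] at h1
    rw [card C hC, ← hfC] at h2
    exact h1.trans h2.symm

end LargeSet

theorem corollary5p3 (q : ℕ) (hq : q = 3 ∨ q = 5) (v : ℕ)
    (F : Type*) [Field F] [Finite F] (hF : Nat.card F = q)
    (V : Type*) [AddCommGroup V] [Module F V] [FiniteDimensional F V]
    (hV : Module.finrank F V = v) :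
    (LargeSetAdmissible q 2 2 3 v ↔ LargeSetRealizable F V 2 2 3 v) ∧
      (LargeSetAdmissible q 2 2 3 v ↔ 6 ≤ v ∧ v ≡ 2 [MOD 4]) := by
  refine ⟨?_, largeSetAdmissible_iff hq v⟩
  rw [largeSetAdmissible_iff hq v]
  subst hF hV
  constructor
  · rintro ⟨hv, hm⟩
    rw [Nat.ModEq] at hm
    obtain ⟨f, hf⟩ := (hasHalving_three hq ((finrank F V - 6) / 4)).exists_isHalving (V := V)
      (by omega)
    exact hf.largeSetRealizable (by omega)
  · intro h
    have hv : 3 ≤ finrank F V := h.le_finrank two_ne_zero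
    obtain ⟨f, hf⟩ := h.exists_isHalving
    -- The dimension is written as a triple successor so that `derived` applies twice and
    -- `two_dvd_gaussianBinomial_two` still sees a successor.
    have h3 : HasHalving F 3 (finrank F V - 3 + 1 + 1 + 1) := hf.hasHalving (by omega)
    have h2 := h3.derived
    refine six_le_and_modEq_of_two_dvd hq hv ?_ ?_
    · convert h2.two_dvd_gaussianBinomial_two using 2
      omega
    · convert h2.derived.two_dvd_gaussianBinomial_one using 2
      omega
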